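/- **Setting.** A correlation is a family of real numbers $P=\{P(a,b|x,y)\}_{a,b,x,y\in\{0,1\}}$. It is *quantum*, $P\in\mathcal Q$, if $P(a,b|x,y)=\mathrm{tr}[(M_{a|x}\otimes N_{b|y})\rho]$ for some Hilbert spaces $H_A,H_B$ of arbitrary dimension, some density operator $\rho$ on $H_A\otimes H_B$ and some POVMs $\{M_{0|x},M_{1|x}\}$ on $H_A$ and $\{N_{0|y},N_{1|y}\}$ on $H_B$. Put $\mathcal Q_1=\{P\in\mathcal Q: P(0,0|0,0)=0\}$ and $S_{\rm CHSH}(P)=\sum_{x,y,a,b\in\{0,1\}}(-1)^{xy+a+b+1}P(a,b|x,y)$. A unit vector $\psi\in H_A\otimes H_B$ and POVMs $M,N$ as above *realize* $P$ if $P(a,b|x,y)=\langle\psi|M_{a|x}\otimes N_{b|y}|\psi\rangle$ for all $a,b,x,y$. They are *equivalent up to local isometries* to a two-qubit strategy $(\tilde\psi,\tilde M,\tilde N)$ if there are Hilbert spaces $H_{A'},H_{B'}$, linear isometries $\Phi_A:H_A\to H_{A'}\otimes\mathbb C^2$, $\Phi_B:H_B\to H_{B'}\otimes\mathbb C^2$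 and a unit vector $\varsigma\in H_{A'}\otimes H_{B'}$ such that, after regrouping the tensor factors, $$(\Phi_A\otimes\Phi_B)\,(M_{a|x}\otimes N_{b|y})\,\psi=\varsigma\otimes(\tilde M_{a|x}\otimes\tilde N_{b|y})\,\tilde\psi\qquad\text{for all }a,b,x,y.$$ A quantum correlation $P$ *self-tests* a realization $(\tilde\psi,\tilde M,\tilde N)$ of $P$ by two qubits if every $(\psi,M,N)$ that realizes $P$ is equivalent to it up to local isometries. Let $\xi_1\approx 0.2862$, $\xi_2\approx 0.0521$, $\xi_3\approx 2.6353$ (each to within $5\cdot10^{-5}$) be the smallest positive roots of $$x^3-9x^2-x+1,\qquad 7x^3-35x^2+21x-1,\qquad x^3+26x^2-36x-104,$$ respectively, and put $\theta=\arccos\sqrt{\xi_2}$, $\alpha=\arccos\xi_1$. The reference strategy is the permutation-invariant two-qubit strategy with state $$|\tilde\psi\rangle=\sin\theta\,\frac{|0\rangle|1\rangle+|1\rangle|0\rangle}{\sqrt2}+\cos\theta\,|1\rangle|1\rangle,$$ in which both parties measure the observable $\sigma_z$ for setting $0$ and $\cos\alpha\,\sigma_z+\sin\alpha\,\sigma_x$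 for setting $1$, the outcome $a$ of an observable $A$ having the measurement operator $(\mathbb 1+(-1)^aA)/2$. Let $P_{Q,4}$ be its correlation. **Theorem.** The maximum of $S_{\rm CHSH}$ over $\mathcal Q_1$ is $\xi_3$; it is attained at $P_{Q,4}\in\mathcal Q_1$ and at no other element of $\mathcal Q_1$. The correlation $P_{Q,4}$ self-tests the reference strategy. In particular, if $(\psi,M,N)$ realizes a correlation $P$ with $P(0,0|0,0)=0$ and $S_{\rm CHSH}(P)=\xi_3$, then $(\psi,M,N)$ is equivalent to the reference strategy up to local isometries. -/

import Mathlib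

open scoped TensorProduct InnerProductSpace

universe u

noncomputable section

/-- A bipartite correlation with two settings and two outcomes per party:
`P a b x y` is `P(a,b|x,y)`. -/
abbrev Correlation : Type := Fin 2 → Fin 2 → Fin 2 → Fin 2 → ℝ

/-- The CHSH value `∑ (-1)^(xy+a+b+1) P(a,b|x,y)`. -/
def chsh (P : Correlation) : ℝ :=
  ∑ x : Fin 2, ∑ y : Fin 2, ∑ a : Fin 2, ∑ b : Fin 2,
    (-1 : ℝ) ^ ((x : ℕ) * (y : ℕ) + (a : ℕ) + (b : ℕ) + 1) * P a b x y

/-- The Hilbert space tensor product: the completion of the algebraic tensor product with respect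
to the inner product `⟪u ⊗ v, u' ⊗ v'⟫ = ⟪u, u'⟫ ⟪v, v'⟫`. -/
abbrev HilbertTensor (E F : Type*) [NormedAddCommGroup E] [InnerProductSpace ℂ E]
    [NormedAddCommGroup F] [InnerProductSpace ℂ F] : Type _ :=
  UniformSpace.Completion (E ⊗[ℂ] F)

/-- The tensor product `S ⊗ T` of two bounded operators, on the Hilbert space tensor product. -/
def opTensor {E F E' F' : Type*} [NormedAddCommGroup E] [InnerProductSpace ℂ E]
    [NormedAddCommGroup F] [InnerProductSpace ℂ F]
    [NormedAddCommGroup E'] [InnerProductSpace ℂ E']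
    [NormedAddCommGroup F'] [InnerProductSpace ℂ F']
    (S : E →L[ℂ] E') (T : F →L[ℂ] F') : HilbertTensor E F →L[ℂ] HilbertTensor E' F' :=
  (TensorProduct.mapL S T).completion

/-- A two-outcome POVM. -/
def IsPOVM {E : Type*} [NormedAddCommGroup E] [InnerProductSpace ℂ E]
    (M : Fin 2 → (E →L[ℂ] E)) : Prop :=
  (∀ a, (M a).IsPositive) ∧ ∑ a, M a = 1

/-- `T` has trace `t`: its diagonal sums to `t` in every orthonormal basis. -/
def HasTrace {H : Type u} [NormedAddCommGroup H] [InnerProductSpace ℂ H]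
    (T : H →L[ℂ] H) (t : ℂ) : Prop :=
  ∀ (ι : Type u) (e : HilbertBasis ι ℂ H), HasSum (fun i => ⟪e i, T (e i)⟫_ℂ) t

/-- A density operator: positive, with trace one. -/
def IsDensityOperator {H : Type u} [NormedAddCommGroup H] [InnerProductSpace ℂ H]
    (ρ : H →L[ℂ] H) : Prop :=
  ρ.IsPositive ∧ HasTrace ρ 1

/-- The set `𝒬` of quantum correlations: those of the form
`P(a,b|x,y) = tr[(M_{a|x} ⊗ N_{b|y}) ρ]` for a (possibly mixed) state `ρ` on a tensor product of
two Hilbert spaces of arbitrary dimension, and local POVMs `M x`, `N y`. -/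
def quantumSet : Set Correlation :=
  {P | ∃ (HA HB : Type u)
      (_ : NormedAddCommGroup HA) (_ : InnerProductSpace ℂ HA) (_ : CompleteSpace HA)
      (_ : NormedAddCommGroup HB) (_ : InnerProductSpace ℂ HB) (_ : CompleteSpace HB)
      (ρ : HilbertTensor HA HB →L[ℂ] HilbertTensor HA HB)
      (M : Fin 2 → Fin 2 → (HA →L[ℂ] HA)) (N : Fin 2 → Fin 2 → (HB →L[ℂ] HB)),
      IsDensityOperator ρ ∧ (∀ x, IsPOVM (M x)) ∧ (∀ y, IsPOVM (N y)) ∧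
      ∀ a b x y, HasTrace (opTensor (M x a) (N y b) ∘L ρ) (P a b x y : ℂ)}

/-- `𝒬₁`: the quantum correlations with `P(0,0|0,0) = 0`. -/
def quantumClassOne : Set Correlation :=
  {P | P ∈ quantumSet.{u} ∧ P 0 0 0 0 = 0}

/-- The unit vector `ψ` and the local POVMs `M x`, `N y` form a (pure-state) quantum realization
of the correlation `P`. -/
def Realizes {HA HB : Type*} [NormedAddCommGroup HA] [InnerProductSpace ℂ HA]
    [NormedAddCommGroup HB] [InnerProductSpace ℂ HB]
    (ψ : HilbertTensor HA HB)
    (M : Fin 2 → Fin 2 → (HA →L[ℂ] HA)) (N : Fin 2 → Fin 2 → (HB →L[ℂ] HB))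
    (P : Correlation) : Prop :=
  ‖ψ‖ = 1 ∧ (∀ x, IsPOVM (M x)) ∧ (∀ y, IsPOVM (N y)) ∧
    ∀ a b x y, ⟪ψ, opTensor (M x a) (N y b) ψ⟫_ℂ = (P a b x y : ℂ)

/-- The tensor product `u ⊗ v` of two vectors, as a continuous bilinear map. -/
def vecTensor (E F : Type*) [NormedAddCommGroup E] [InnerProductSpace ℂ E]
    [NormedAddCommGroup F] [InnerProductSpace ℂ F] : E →L[ℂ] F →L[ℂ] HilbertTensor E F :=
  (ContinuousLinearMap.compL ℂ F (E ⊗[ℂ] F) (HilbertTensor E F)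
    UniformSpace.Completion.toComplL).comp (TensorProduct.mkL ℂ E F)

theorem vecTensor_apply {E F : Type*} [NormedAddCommGroup E] [InnerProductSpace ℂ E]
    [NormedAddCommGroup F] [InnerProductSpace ℂ F] (u : E) (v : F) :
    vecTensor E F u v = ((u ⊗ₜ[ℂ] v : E ⊗[ℂ] F) : HilbertTensor E F) := rfl

theorem opTensor_vecTensor {E F E' F' : Type*} [NormedAddCommGroup E] [InnerProductSpace ℂ E]
    [NormedAddCommGroup F] [InnerProductSpace ℂ F]
    [NormedAddCommGroup E'] [InnerProductSpace ℂ E']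
    [NormedAddCommGroup F'] [InnerProductSpace ℂ F']
    (S : E →L[ℂ] E') (T : F →L[ℂ] F') (u : E) (v : F) :
    opTensor S T (vecTensor E F u v) = vecTensor E' F' (S u) (T v) := by
  simp [opTensor, vecTensor_apply]

theorem opTensor_coe {E F E' F' : Type*} [NormedAddCommGroup E] [InnerProductSpace ℂ E]
    [NormedAddCommGroup F] [InnerProductSpace ℂ F]
    [NormedAddCommGroup E'] [InnerProductSpace ℂ E']
    [NormedAddCommGroup F'] [InnerProductSpace ℂ F']
    (S : E →L[ℂ] E') (T : F →L[ℂ] F') (w : E ⊗[ℂ] F) :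
    opTensor S T (w : HilbertTensor E F) =
      ((TensorProduct.mapL S T w : E' ⊗[ℂ] F') : HilbertTensor E' F') := by
  simp [opTensor]

theorem opTensor_add_left {E F E' F' : Type*} [NormedAddCommGroup E] [InnerProductSpace ℂ E]
    [NormedAddCommGroup F] [InnerProductSpace ℂ F]
    [NormedAddCommGroup E'] [InnerProductSpace ℂ E']
    [NormedAddCommGroup F'] [InnerProductSpace ℂ F']
    (S S' : E →L[ℂ] E') (T : F →L[ℂ] F') :
    opTensor (S + S') T = opTensor S T + opTensor S' T := by
  ext ξ
  induction ξ using UniformSpace.Completion.induction_on with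
  | hp => exact isClosed_eq (ContinuousLinearMap.continuous _) (ContinuousLinearMap.continuous _)
  | ih w =>
    rw [add_apply, opTensor_coe, opTensor_coe, opTensor_coe, TensorProduct.mapL_add_left,
      add_apply, UniformSpace.Completion.coe_add]

theorem opTensor_smul_left {E F E' F' : Type*} [NormedAddCommGroup E] [InnerProductSpace ℂ E]
    [NormedAddCommGroup F] [InnerProductSpace ℂ F]
    [NormedAddCommGroup E'] [InnerProductSpace ℂ E']
    [NormedAddCommGroup F'] [InnerProductSpace ℂ F']
    (c : ℂ) (S : E →L[ℂ] E') (T : F →L[ℂ] F') :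
    opTensor (c • S) T = c • opTensor S T := by
  ext ξ
  induction ξ using UniformSpace.Completion.induction_on with
  | hp => exact isClosed_eq (ContinuousLinearMap.continuous _) (ContinuousLinearMap.continuous _)
  | ih w =>
    rw [smul_apply, opTensor_coe, opTensor_coe,
      TensorProduct.mapL_smul_left, smul_apply,
      UniformSpace.Completion.coe_smul]

theorem opTensor_add_right {E F E' F' : Type*} [NormedAddCommGroup E] [InnerProductSpace ℂ E]
    [NormedAddCommGroup F] [InnerProductSpace ℂ F]
    [NormedAddCommGroup E'] [InnerProductSpace ℂ E']
    [NormedAddCommGroup F'] [InnerProductSpace ℂ F']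
    (S : E →L[ℂ] E') (T T' : F →L[ℂ] F') :
    opTensor S (T + T') = opTensor S T + opTensor S T' := by
  ext ξ
  induction ξ using UniformSpace.Completion.induction_on with
  | hp => exact isClosed_eq (ContinuousLinearMap.continuous _) (ContinuousLinearMap.continuous _)
  | ih w =>
    rw [add_apply, opTensor_coe, opTensor_coe, opTensor_coe, TensorProduct.mapL_add_right,
      add_apply, UniformSpace.Completion.coe_add]

theorem opTensor_smul_right {E F E' F' : Type*} [NormedAddCommGroup E] [InnerProductSpace ℂ E]
    [NormedAddCommGroup F] [InnerProductSpace ℂ F]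
    [NormedAddCommGroup E'] [InnerProductSpace ℂ E']
    [NormedAddCommGroup F'] [InnerProductSpace ℂ F']
    (c : ℂ) (S : E →L[ℂ] E') (T : F →L[ℂ] F') :
    opTensor S (c • T) = c • opTensor S T := by
  ext ξ
  induction ξ using UniformSpace.Completion.induction_on with
  | hp => exact isClosed_eq (ContinuousLinearMap.continuous _) (ContinuousLinearMap.continuous _)
  | ih w =>
    rw [smul_apply, opTensor_coe, opTensor_coe,
      TensorProduct.mapL_smul_right, smul_apply,
      UniformSpace.Completion.coe_smul]

/-- For `φ ∈ K_A ⊗ K_B` (algebraic tensor product), the operator `ς ↦ ς ⊗ φ` from `J_A ⊗ J_B` to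
`(J_A ⊗ K_A) ⊗ (J_B ⊗ K_B)`, the four tensor factors being regrouped by party. It is determined by
linearity in `φ`, continuity in `ς`, and `s ⊗ t ↦ (s ⊗ k) ⊗ (t ⊗ l)` for `φ = k ⊗ l`. -/
def attach (JA JB : Type*) {KA KB : Type*} [NormedAddCommGroup JA] [InnerProductSpace ℂ JA]
    [NormedAddCommGroup JB] [InnerProductSpace ℂ JB]
    [NormedAddCommGroup KA] [InnerProductSpace ℂ KA]
    [NormedAddCommGroup KB] [InnerProductSpace ℂ KB] :
    KA ⊗[ℂ] KB →ₗ[ℂ]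
      (HilbertTensor JA JB →L[ℂ] HilbertTensor (HilbertTensor JA KA) (HilbertTensor JB KB)) :=
  TensorProduct.lift <| LinearMap.mk₂ ℂ
    (fun k l => opTensor ((vecTensor JA KA).flip k) ((vecTensor JB KB).flip l))
    (fun _ _ _ => by rw [map_add, opTensor_add_left])
    (fun _ _ _ => by rw [map_smul, opTensor_smul_left])
    (fun _ _ _ => by rw [map_add, opTensor_add_right])
    (fun _ _ _ => by rw [map_smul, opTensor_smul_right])

theorem attach_tmul {JA JB KA KB : Type*} [NormedAddCommGroup JA] [InnerProductSpace ℂ JA]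
    [NormedAddCommGroup JB] [InnerProductSpace ℂ JB]
    [NormedAddCommGroup KA] [InnerProductSpace ℂ KA]
    [NormedAddCommGroup KB] [InnerProductSpace ℂ KB] (s : JA) (t : JB) (k : KA) (l : KB) :
    attach JA JB (k ⊗ₜ[ℂ] l) (vecTensor JA JB s t) =
      vecTensor _ _ (vecTensor JA KA s k) (vecTensor JB KB t l) := by
  simp [attach, opTensor_vecTensor]

/-- The Hilbert space `ℂ²` of a qubit. -/
abbrev Qubit : Type := EuclideanSpace ℂ (Fin 2)

/-- The computational basis vector `|i⟩`. -/
def ket (i : Fin 2) : Qubit := EuclideanSpace.single i 1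

/-- A two-qubit state vector together with local measurement operators on the two qubits. -/
structure QubitStrategy where
  state : Qubit ⊗[ℂ] Qubit
  alice : Fin 2 → Fin 2 → (Qubit →L[ℂ] Qubit)
  bob : Fin 2 → Fin 2 → (Qubit →L[ℂ] Qubit)

/-- The state `ψ` and measurements `M`, `N` are equivalent to the two-qubit strategy `R` up to
local isometries: there are Hilbert spaces `H_{A'}`, `H_{B'}`, isometries
`Φ_A : H_A → H_{A'} ⊗ ℂ²`, `Φ_B : H_B → H_{B'} ⊗ ℂ²` and a junk state `ς ∈ H_{A'} ⊗ H_{B'}` with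
`(Φ_A ⊗ Φ_B) (M_{a|x} ⊗ N_{b|y}) ψ = ς ⊗ (M̃_{a|x} ⊗ Ñ_{b|y}) ψ̃`. -/
def EquivUpToLocalIsometries {HA HB : Type u} [NormedAddCommGroup HA] [InnerProductSpace ℂ HA]
    [NormedAddCommGroup HB] [InnerProductSpace ℂ HB]
    (ψ : HilbertTensor HA HB)
    (M : Fin 2 → Fin 2 → (HA →L[ℂ] HA)) (N : Fin 2 → Fin 2 → (HB →L[ℂ] HB))
    (R : QubitStrategy) : Prop :=
  ∃ (JA JB : Type u)
    (_ : NormedAddCommGroup JA) (_ : InnerProductSpace ℂ JA) (_ : CompleteSpace JA)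
    (_ : NormedAddCommGroup JB) (_ : InnerProductSpace ℂ JB) (_ : CompleteSpace JB)
    (ΦA : HA →ₗᵢ[ℂ] HilbertTensor JA Qubit) (ΦB : HB →ₗᵢ[ℂ] HilbertTensor JB Qubit)
    (ς : HilbertTensor JA JB),
    ‖ς‖ = 1 ∧ ∀ a b x y,
      opTensor ΦA.toContinuousLinearMap ΦB.toContinuousLinearMap
          (opTensor (M x a) (N y b) ψ) =
        attach JA JB (TensorProduct.mapL (R.alice x a) (R.bob y b) R.state) ς

/-- The quantum correlation `P` self-tests its two-qubit realization `R`: every pure state and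
local measurements, on Hilbert spaces of any dimension, that give the correlation `P` are
equivalent to `R` up to local isometries. -/
def SelfTests (P : Correlation) (R : QubitStrategy) : Prop :=
  P ∈ quantumSet.{u} ∧
  Realizes (R.state : HilbertTensor Qubit Qubit) R.alice R.bob P ∧
  ∀ (HA HB : Type u)
    [NormedAddCommGroup HA] [InnerProductSpace ℂ HA] [CompleteSpace HA]
    [NormedAddCommGroup HB] [InnerProductSpace ℂ HB] [CompleteSpace HB]
    (ψ : HilbertTensor HA HB)
    (M : Fin 2 → Fin 2 → (HA →L[ℂ] HA)) (N : Fin 2 → Fin 2 → (HB →L[ℂ] HB)),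
    Realizes ψ M N P → EquivUpToLocalIsometries ψ M N R

/-- The Pauli operator `σ_z`. -/
def pauliZ : Qubit →L[ℂ] Qubit := Matrix.toEuclideanCLM (𝕜 := ℂ) !![1, 0; 0, -1]

/-- The Pauli operator `σ_x`. -/
def pauliX : Qubit →L[ℂ] Qubit := Matrix.toEuclideanCLM (𝕜 := ℂ) !![0, 1; 1, 0]

/-- The observables `σ_z` (setting `0`) and `cos α σ_z + sin α σ_x` (setting `1`). -/
def refObservable (α : ℝ) : Fin 2 → (Qubit →L[ℂ] Qubit) :=
  ![pauliZ, (Real.cos α : ℂ) • pauliZ + (Real.sin α : ℂ) • pauliX]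

/-- The measurement operator `(1 + (-1)^a A_x) / 2` of outcome `a` for setting `x`. -/
def refMeasurement (α : ℝ) (x a : Fin 2) : Qubit →L[ℂ] Qubit :=
  (1 / 2 : ℂ) • (1 + (-1 : ℂ) ^ (a : ℕ) • refObservable α x)

/-- The permutation-invariant two-qubit strategy with state
`sin θ (|0⟩|1⟩ + |1⟩|0⟩)/√2 + cos θ |1⟩|1⟩`, both parties measuring `σ_z` and
`cos α σ_z + sin α σ_x`. -/
def refStrategy (θ α : ℝ) : QubitStrategy where
  state := ((Real.sin θ / √2 : ℝ) : ℂ) • (ket 0 ⊗ₜ[ℂ] ket 1 + ket 1 ⊗ₜ[ℂ] ket 0) +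
    (Real.cos θ : ℂ) • (ket 1 ⊗ₜ[ℂ] ket 1)
  alice := refMeasurement α
  bob := refMeasurement α

/-- The correlation `⟨ψ̃| M̃_{a|x} ⊗ Ñ_{b|y} |ψ̃⟩` of a two-qubit strategy. -/
def QubitStrategy.correlation (R : QubitStrategy) : Correlation := fun a b x y =>
  (⟪R.state, TensorProduct.mapL (R.alice x a) (R.bob y b) R.state⟫_ℂ).re

end

/-! Let A₀, A₁ and B₀, B₁ be the observables of the two parties, taken to be involutions for the
moment. Put a = (A₀A₁ + A₁A₀)/2 (`cosOp`) and X = A₁ - aA₀ (`offDiag`). Then a commutes with both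
involutions, X anticommutes with A₀, and X² = 1 - a². Define b and Y in the same way for Bob. The
operators a, b, X, Y commute pairwise, so computing with them replaces the usual reduction to qubit
blocks and works in every dimension.

The condition P(0,0|0,0) = 0 says that ψ = x + y + z, where (A₀, B₀) has eigenvalues (+,-), (-,+),
(-,-) on x, y, z. With p = 1 - a, q = 1 - b and ξ₃ = 1 + 6γ - γ², γ = ξ₁, the difference ξ₃‖ψ‖² -
⟨CHSH⟩ is a quadratic form in (x, y, z) whose 3×3 matrix has entries in the commutative ring of p,
q, X, Y (`chshExpectation_sectors`). Completing squares leaves the determinant as the last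
coefficient, up to a positive factor, and modulo the cubic of γ it equals 4(√(pq) - (1-γ))² w +
8pq(√p - √q)² with w bounded below by a positive number. Hence the form is nonnegative. It vanishes
only if p and q act as 1 - γ on x, y, z and if x = κXz, y = κYz for an explicit κ
(`sectorForm_nonneg_and_eq`, `chshExpectation_le_and_eq`).

These relations give the self-test. On the eigenspace a = γ the operators A₀ and X/√(1-γ²) behave
like σ_z and σ_x, so the swap isometry extracts a qubit from each side. It sends ψ to the reference
state tensored with a multiple of XYz, which is the junk (`exists_junk_of_relations`).

General POVMs are dilated to involutions on H ⊕ H. A compression need not act like its dilation, but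
the relations above express Alice's action on the dilated state through Bob's operators. These
preserve the range on Alice's side, so for this state the compression loses nothing
(`apply_mem_of_relations`, `opTensor_compression_apply`).

A mixed state is a sum of vectors, each with P(0,0|0,0) = 0. Equality in the bound forces equality
for each vector, so each contributes a multiple of the reference correlation. This gives uniqueness
(`chsh_le_and_eq_of_mem_quantumClassOne`). Attainment is a direct computation
(`chsh_refCorrelation`). -/

noncomputable section

/-! ### Order calculus in a commutative ring of symmetric operators -/

/-- A commutative ring of symmetric operators on `K` that is closed under square roots of positive
elements and under inverses of elements bounded below. -/
structure SymmetricCalculus (R K : Type*) [CommRing R] [Algebra ℝ R] [NormedAddCommGroup K]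
    [InnerProductSpace ℂ K] [Module R K] : Prop where
  symm : ∀ (r : R) (x y : K), ⟪r • x, y⟫_ℂ = ⟪x, r • y⟫_ℂ
  nonneg_algebraMap : ∀ a : ℝ, 0 ≤ a → ∀ x : K, 0 ≤ (⟪x, algebraMap ℝ R a • x⟫_ℂ).re
  exists_sqrt : ∀ r : R, (∀ x : K, 0 ≤ (⟪x, r • x⟫_ℂ).re) →
    ∃ s : R, (∀ x : K, 0 ≤ (⟪x, s • x⟫_ℂ).re) ∧ s * s = r
  isUnit : ∀ (r : R) (ε : ℝ), 0 < ε →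
    (∀ x : K, 0 ≤ (⟪x, (r - algebraMap ℝ R ε) • x⟫_ℂ).re) → IsUnit r

/-- `r` acts as a positive operator on `K`. -/
def ActsPos {R : Type*} (K : Type*) [CommRing R] [NormedAddCommGroup K]
    [InnerProductSpace ℂ K] [Module R K] (r : R) : Prop :=
  ∀ x : K, 0 ≤ (⟪x, r • x⟫_ℂ).re

theorem ActsPos.add {R K : Type*} [CommRing R] [NormedAddCommGroup K]
    [InnerProductSpace ℂ K] [Module R K]
    {r s : R} (hr : ActsPos K r) (hs : ActsPos K s) : ActsPos K (r + s) := by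
  intro x
  rw [add_smul, inner_add_right, Complex.add_re]
  exact add_nonneg (hr x) (hs x)

theorem smul_cancel {R K : Type*} [CommRing R] [AddCommGroup K] [Module R K] {r s : R}
    (hs : s * r = 1) {x : K} (hx : r • x = 0) : x = 0 := by
  rw [← one_smul R x, ← hs, mul_smul, hx, smul_zero]

namespace SymmetricCalculus

variable {R K : Type*} [CommRing R] [Algebra ℝ R] [NormedAddCommGroup K]
    [InnerProductSpace ℂ K] [Module R K]

theorem sq_pos (h : SymmetricCalculus R K) (r : R) : ActsPos K (r * r) := by
  intro x
  rw [mul_smul, ← h.symm]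
  exact inner_self_nonneg (𝕜 := ℂ)

/-- Writing s = w², commutativity gives rs = wrw, and w is symmetric. This is where commutativity is
needed: products of positive operators are not positive in general. -/
theorem mul_pos (h : SymmetricCalculus R K) {r s : R} (hr : ActsPos K r) (hs : ActsPos K s) :
    ActsPos K (r * s) := by
  obtain ⟨w, -, rfl⟩ := h.exists_sqrt s hs
  intro x
  have e : r * (w * w) = w * (r * w) := by ring
  rw [e, mul_smul, ← h.symm, mul_smul]
  exact hr _

theorem real_pos (h : SymmetricCalculus R K) {a : ℝ} (ha : 0 ≤ a) :
    ActsPos K (algebraMap ℝ R a) := h.nonneg_algebraMap a ha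

theorem smul_eq_zero_of_pos (h : SymmetricCalculus R K) {r : R} (hr : ActsPos K r) {x : K}
    (hx : (⟪x, r • x⟫_ℂ).re = 0) : r • x = 0 := by
  obtain ⟨w, -, rfl⟩ := h.exists_sqrt r hr
  rw [mul_smul, ← h.symm] at hx
  have : w • x = 0 := by
    rw [← inner_self_eq_zero (𝕜 := ℂ)]
    exact Complex.ext hx (inner_self_im (𝕜 := ℂ) _)
  rw [mul_smul, this, smul_zero]

theorem inv_pos (h : SymmetricCalculus R K) {r s : R} (hr : ActsPos K r) (hs : s * r = 1) :
    ActsPos K s := by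
  have e : s = r * (s * s) := by linear_combination (-s) * hs
  rw [e]
  exact h.mul_pos hr (h.sq_pos s)

theorem quad_expand (h : SymmetricCalculus R K) (w a b d : R) (x y z : K) :
    (⟪a • x + b • y + d • z, w • (a • x + b • y + d • z)⟫_ℂ).re =
      (⟪x, (w * a * a) • x⟫_ℂ).re + (⟪y, (w * b * b) • y⟫_ℂ).re + (⟪z, (w * d * d) • z⟫_ℂ).re
      + 2 * (⟪x, (w * a * b) • y⟫_ℂ).re + 2 * (⟪x, (w * a * d) • z⟫_ℂ).re
      + 2 * (⟪y, (w * b * d) • z⟫_ℂ).re := by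
  have key : ∀ (r s : R) (u v : K), ⟪r • u, w • s • v⟫_ℂ = ⟪u, (w * r * s) • v⟫_ℂ := by
    intro r s u v
    rw [h.symm, smul_smul, smul_smul]; congr 2; ring
  have flip : ∀ (r s : R) (u v : K),
      (⟪u, (w * r * s) • v⟫_ℂ).re = (⟪v, (w * s * r) • u⟫_ℂ).re := by
    intro r s u v
    rw [← h.symm, ← inner_conj_symm, Complex.conj_re]; congr 3; ring
  simp only [smul_add, inner_add_left, inner_add_right, key, Complex.add_re]
  rw [flip b a y x, flip d a z x, flip d b z y]
  ring

end SymmetricCalculus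

/-- Once p and q act as 1 - c, every coefficient becomes a scalar up to X and Y: X² and Y² act as 1
- c², the diagonal entry as 4c, and its square minus X²Y² as (c² + 4c - 1)(4c + 1 - c²). The two
remaining linear equations are then solved by division, and κ is their solution. -/
theorem kernel_at_common_angle {R K : Type*} [CommRing R] [Algebra ℝ R] [AddCommGroup K]
    [Module R K] {γ : ℝ} (hγ1 : 0.28 < γ) (hγ2 : γ < 0.29)
    {c p q X Y κ : R} (hc : c = algebraMap ℝ R γ) (hκ : κ * (c ^ 2 + 4 * c - 1) = 1 - c)
    (hX : X ^ 2 = p * (2 - p)) (hY : Y ^ 2 = q * (2 - q)) {x y z : K}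
    (hpx : p • x = (1 - c) • x) (hqx : q • x = (1 - c) • x)
    (hpy : p • y = (1 - c) • y) (hqy : q • y = (1 - c) • y)
    (hpz : p • z = (1 - c) • z) (hqz : q • z = (1 - c) • z)
    (hmx : (6 * c - c ^ 2 - 1 + p * q) • x = (X * Y) • y + (q * X) • z)
    (hDy : ((6 * c - c ^ 2 - 1 + p * q) * (6 * c - c ^ 2 - 1 + p * q) - X ^ 2 * Y ^ 2) • y =
      ((6 * c - c ^ 2 - 1 + p * q) * (p * Y) + X ^ 2 * Y * q) • z) :
    x = (κ * X) • z ∧ y = (κ * Y) • z := by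
  obtain ⟨m, hm⟩ : ∃ m, m = 6 * c - c ^ 2 - 1 + p * q := ⟨_, rfl⟩
  rw [← hm] at hmx hDy
  obtain ⟨D, hD⟩ : ∃ D, D = m * m - X ^ 2 * Y ^ 2 := ⟨_, rfl⟩
  obtain ⟨E, hE⟩ : ∃ E, E = m * (p * Y) + X ^ 2 * Y * q := ⟨_, rfl⟩
  rw [← hD, ← hE] at hDy
  have hXX : ∀ u : K, p • u = (1 - c) • u → (X * X) • u = (1 - c ^ 2) • u := by
    intro u hu
    have e1 : X * X = (2 - p) * p := by linear_combination hX
    rw [e1, mul_smul, hu, smul_comm, sub_smul _ _ u, hu, ← sub_smul, smul_smul]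
    congr 1; ring
  have hYY : ∀ u : K, q • u = (1 - c) • u → (Y * Y) • u = (1 - c ^ 2) • u := by
    intro u hu
    have e1 : Y * Y = (2 - q) * q := by linear_combination hY
    rw [e1, mul_smul, hu, smul_comm, sub_smul _ _ u, hu, ← sub_smul, smul_smul]
    congr 1; ring
  have htt : ∀ u : K, p • u = (1 - c) • u → q • u = (1 - c) • u →
      m • u = (4 * c) • u := by
    intro u hu hu'
    rw [hm, add_smul, mul_smul, hu', smul_comm, hu, smul_smul, ← add_smul]
    congr 1; ring
  have hEz : E • z = ((1 - c) * (4 * c + (1 - c ^ 2))) • Y • z := by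
    have e1 : E • z = Y • (m • p • z + q • (X * X) • z) := by
      rw [hE]
      simp only [smul_smul, ← add_smul]; congr 1; ring
    rw [e1, hpz, hXX z hpz, smul_comm m, htt z hpz hqz, smul_comm q, hqz]
    simp only [smul_smul, ← add_smul]; congr 1; ring
  have hDy' : D • y = ((c ^ 2 + 4 * c - 1) * (4 * c + (1 - c ^ 2))) • y := by
    have e1 : D • y = m • m • y - (X * X) • (Y * Y) • y := by
      rw [hD]
      simp only [smul_smul, ← sub_smul]; congr 1; ring
    rw [e1, htt y hpy hqy, smul_comm m, htt y hpy hqy, hYY y hqy, smul_comm (X * X), hXX y hpy]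
    simp only [smul_smul, ← sub_smul]; congr 1; ring
  -- Only three nonzero real scalars have to be inverted; c² + 4c - 1 is nonzero because γ > 0.28.
  have hinv : ∀ a : ℝ, a ≠ 0 → ∃ v : R, v * algebraMap ℝ R a = 1 := fun a ha =>
    ⟨algebraMap ℝ R a⁻¹, by rw [← map_mul, inv_mul_cancel₀ ha, map_one]⟩
  obtain ⟨v1, hv1⟩ := hinv (4 * γ + (1 - γ ^ 2)) (by nlinarith)
  obtain ⟨v2, hv2⟩ := hinv (γ ^ 2 + 4 * γ - 1) (by nlinarith)
  obtain ⟨v3, hv3⟩ := hinv (4 * γ) (by nlinarith)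
  simp only [map_sub, map_add, map_mul, map_pow, map_one, map_ofNat, ← hc] at hv1 hv2 hv3
  have hy : y = (κ * Y) • z := by
    rw [hDy', hEz] at hDy
    have := congrArg (fun u => (v1 * v2) • u) hDy
    simp only [smul_smul] at this
    have e1 : v1 * v2 * ((c ^ 2 + 4 * c - 1) * (4 * c + (1 - c ^ 2))) = 1 := by
      linear_combination v2 * (c ^ 2 + 4 * c - 1) * hv1 + hv2
    have e2 : v1 * v2 * ((1 - c) * (4 * c + (1 - c ^ 2))) = κ := by
      linear_combination v2 * (1 - c) * hv1 - v2 * hκ + κ * hv2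
    rwa [e1, one_smul, ← mul_assoc, e2] at this
  have hx : x = (κ * X) • z := by
    have e1 : (4 * c) • x = (4 * c * κ * X) • z := by
      rw [← htt x hpx hqx, hmx]
      have e2 : (X * Y) • y = (κ * X * (1 - c ^ 2)) • z := by
        rw [hy, smul_smul, mul_smul (κ * X), ← hYY z hqz, smul_smul]; congr 1; ring
      have e3 : (q * X) • z = (X * (1 - c)) • z := by
        rw [mul_comm q, mul_smul, hqz, smul_smul]
      rw [e2, e3, ← add_smul]
      congr 1
      linear_combination (-X) * hκ
    have := congrArg (fun u => v3 • u) e1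
    simp only [smul_smul] at this
    have e2 : v3 * (4 * c * κ * X) = κ * X := by linear_combination κ * X * hv3
    rwa [hv3, one_smul, e2] at this
  exact ⟨hx, hy⟩

/-! ### Positivity of the 3×3 form and its kernel -/

section Form

variable {R K : Type*} [CommRing R] [Algebra ℝ R] [NormedAddCommGroup K]
    [InnerProductSpace ℂ K] [Module R K]

/-- The quadratic form of `ξ₃ - S_CHSH` on the three sectors allowed by `P(0,0|0,0) = 0`. -/
def sectorForm (c p q X Y : R) (x y z : K) : ℝ :=
  (⟪x, (6 * c - c ^ 2 - 1 + p * q) • x⟫_ℂ).re + (⟪y, (6 * c - c ^ 2 - 1 + p * q) • y⟫_ℂ).re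
    + (⟪z, (3 + 6 * c - c ^ 2 - p * q) • z⟫_ℂ).re
    - 2 * (⟪x, (X * Y) • y⟫_ℂ).re - 2 * (⟪x, (q * X) • z⟫_ℂ).re - 2 * (⟪y, (p * Y) • z⟫_ℂ).re

set_option maxHeartbeats 1000000 in
-- An LDL* decomposition over the commutative ring, with pivots m, D/m and det/D. The first two
-- pivots are bounded below. The determinant is a sum of two positive terms, whose common zero is p
-- = q = 1 - c. On the kernel the eigenvalue relations are obtained first for z and then propagated
-- to y and x by back substitution.
theorem sectorForm_nonneg_and_eq (h : SymmetricCalculus R K) {γ : ℝ}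
    (hγ : γ ^ 3 - 9 * γ ^ 2 - γ + 1 = 0) (hγ1 : 0.28 < γ) (hγ2 : γ < 0.29)
    {c p q X Y κ : R} (hc : c = algebraMap ℝ R γ) (hκ : κ * (c ^ 2 + 4 * c - 1) = 1 - c)
    (hp : ActsPos K p) (hp2 : ActsPos K (2 - p)) (hq : ActsPos K q) (hq2 : ActsPos K (2 - q))
    (hX : X ^ 2 = p * (2 - p)) (hY : Y ^ 2 = q * (2 - q)) (x y z : K) :
    0 ≤ sectorForm c p q X Y x y z ∧ (sectorForm c p q X Y x y z = 0 →
      (p • x = (1 - c) • x ∧ p • y = (1 - c) • y ∧ p • z = (1 - c) • z) ∧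
      (q • x = (1 - c) • x ∧ q • y = (1 - c) • y ∧ q • z = (1 - c) • z) ∧
      x = (κ * X) • z ∧ y = (κ * Y) • z) := by
  have hc3 : c ^ 3 - 9 * c ^ 2 - c + 1 = 0 := by
    rw [hc]
    have := congrArg (algebraMap ℝ R) hγ
    simpa only [map_sub, map_add, map_mul, map_pow, map_one, map_zero, map_ofNat] using this
  obtain ⟨P, hP, rfl⟩ := h.exists_sqrt p hp
  obtain ⟨Q, hQ, rfl⟩ := h.exists_sqrt q hq
  obtain ⟨t, ht⟩ : ∃ t, t = P * Q := ⟨_, rfl⟩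
  have htpos : ActsPos K t := ht ▸ h.mul_pos hP hQ
  obtain ⟨e, he⟩ : ∃ e, e = algebraMap ℝ R (1 / 2) := ⟨_, rfl⟩
  have hepos : ActsPos K e := he ▸ h.real_pos (by norm_num)
  have he2 : e * 2 = 1 := by
    rw [he, ← map_ofNat (algebraMap ℝ R) 2, ← map_mul]; norm_num
  have htwo : ActsPos K (2 : R) := by
    have := h.real_pos (a := 2) (by norm_num)
    rwa [map_ofNat] at this
  have ht2 : ActsPos K (2 - t) := by
    -- The arithmetic-geometric mean inequality: t = √(pq) ≤ (p + q)/2 ≤ 2.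
    have e1 : 2 - t = e * ((P - Q) * (P - Q) + (2 - P * P) + (2 - Q * Q)) := by
      rw [ht]; linear_combination (-(2 - P * Q)) * he2
    rw [e1]
    exact h.mul_pos hepos (((h.sq_pos _).add hp2).add hq2)
  have hc0 : ActsPos K (6 * c - c ^ 2 - 1) := by
    have := h.real_pos (a := 6 * γ - γ ^ 2 - 1) (by nlinarith)
    simpa only [map_sub, map_mul, map_pow, map_one, map_ofNat, ← hc] using this
  have hc1 : ActsPos K (6 * c - c ^ 2 - 1 - e) := by
    have := h.real_pos (a := 6 * γ - γ ^ 2 - 1 - 1 / 2) (by nlinarith)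
    simpa only [map_sub, map_mul, map_pow, map_one, map_ofNat, ← hc, ← he] using this
  have hc2 : ActsPos K (2 * c) := by
    have := h.real_pos (a := 2 * γ) (by nlinarith)
    simpa only [map_mul, map_ofNat, ← hc] using this
  obtain ⟨m, hm⟩ : ∃ m, m = 6 * c - c ^ 2 - 1 + t * t := ⟨_, rfl⟩
  have hmpos : ActsPos K m := hm ▸ hc0.add (h.sq_pos t)
  obtain ⟨im, him⟩ : ∃ im, im * m = 1 := by
    refine (h.isUnit m (6 * γ - γ ^ 2 - 1) (by nlinarith) ?_).exists_left_inv
    have e1 : m - algebraMap ℝ R (6 * γ - γ ^ 2 - 1) = t * t := by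
      simp only [map_sub, map_mul, map_pow, map_one, map_ofNat, ← hc, hm]; ring
    rw [e1]; exact h.sq_pos t
  have himpos : ActsPos K im := h.inv_pos hmpos him
  obtain ⟨D, hD⟩ : ∃ D, D = m * m - X ^ 2 * Y ^ 2 := ⟨_, rfl⟩
  -- With k = 6c - c² - 1 one has D = (k + 2t² - 2t)(k + 2t) + 2t²(P - Q)², and 2t² - 2t = (2t -
  -- 1)²/2 - 1/2. So D ≥ (k - 1/2)k, and k > 1/2 because γ > 0.28.
  have hDe : D - (6 * c - c ^ 2 - 1 - e) * (6 * c - c ^ 2 - 1) =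
      (6 * c - c ^ 2 - 1 - e) * (2 * t) + e * ((2 * t - 1) * (2 * t - 1)) * (6 * c - c ^ 2 - 1)
        + e * ((2 * t - 1) * (2 * t - 1)) * (2 * t) + 2 * (t * (P - Q) * (t * (P - Q))) := by
    rw [hD, hX, hY, hm, ht]
    linear_combination (P * Q) * (6 * c - c ^ 2 - 1 + 2 * P * Q) * (2 - 2 * P * Q) * he2
  have hDpos' : ActsPos K (D - (6 * c - c ^ 2 - 1 - e) * (6 * c - c ^ 2 - 1)) := by
    rw [hDe]
    have h2t := h.mul_pos htwo htpos
    have hes := h.mul_pos hepos (h.sq_pos (2 * t - 1))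
    exact (((h.mul_pos hc1 h2t).add (h.mul_pos hes hc0)).add (h.mul_pos hes h2t)).add
      (h.mul_pos htwo (h.sq_pos _))
  have hDpos : ActsPos K D := by
    have := hDpos'.add (h.mul_pos hc1 hc0)
    rwa [sub_add_cancel] at this
  obtain ⟨iD, hiD⟩ : ∃ iD, iD * D = 1 := by
    refine (h.isUnit D ((6 * γ - γ ^ 2 - 1 - 1 / 2) * (6 * γ - γ ^ 2 - 1))
      (_root_.mul_pos (by nlinarith) (by nlinarith)) ?_).exists_left_inv
    change ActsPos K _
    simpa only [map_sub, map_mul, map_pow, map_one, map_ofNat, ← hc, ← he] using hDpos'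
  have hiDpos : ActsPos K iD := h.inv_pos hDpos hiD
  obtain ⟨w, hw⟩ : ∃ w, w = t * (2 - t) + 2 * c * t + (1 - c ^ 2) := ⟨_, rfl⟩
  have hwpos' : ActsPos K (t * (2 - t) + 2 * c * t) :=
    (h.mul_pos htpos ht2).add (h.mul_pos hc2 htpos)
  have hwe : w - algebraMap ℝ R (1 - γ ^ 2) = t * (2 - t) + 2 * c * t := by
    simp only [map_sub, map_pow, map_one, ← hc, hw]; ring
  obtain ⟨iw, hiw⟩ : ∃ iw, iw * w = 1 := by
    refine (h.isUnit w (1 - γ ^ 2) (by nlinarith) ?_).exists_left_inv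
    rw [hwe]; exact hwpos'
  have hwpos : ActsPos K w := by
    have := hwpos'.add (h.real_pos (a := 1 - γ ^ 2) (by nlinarith))
    rwa [← hwe, sub_add_cancel] at this
  have hfour : ActsPos K (4 : R) := by
    have := h.real_pos (a := 4) (by norm_num)
    rwa [map_ofNat] at this
  -- This is the determinant at p = q = t, a quartic in t with a double zero at 1 - c.
  obtain ⟨f, hf⟩ : ∃ f, f = 4 * ((t - (1 - c)) * (t - (1 - c)) * w) := ⟨_, rfl⟩
  have hfpos : ActsPos K f := hf ▸ h.mul_pos hfour (h.mul_pos (h.sq_pos _) hwpos)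
  obtain ⟨d, hd⟩ : ∃ d, d = t * (P - Q) := ⟨_, rfl⟩
  have hdpos : ActsPos K (8 * (d * d)) := by
    have := h.mul_pos (h.mul_pos htwo hfour) (h.sq_pos d)
    have e1 : (2 : R) * 4 * (d * d) = 8 * (d * d) := by ring
    rwa [e1] at this
  obtain ⟨n, hn⟩ : ∃ n, n = 3 + 6 * c - c ^ 2 - t * t := ⟨_, rfl⟩
  obtain ⟨E, hE⟩ : ∃ E, E = m * (P * P * Y) + X ^ 2 * Y * (Q * Q) := ⟨_, rfl⟩
  obtain ⟨x', hx'⟩ : ∃ x', x' = m • x + (-(X * Y)) • y + (-(Q * Q * X)) • z := ⟨_, rfl⟩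
  obtain ⟨y', hy'⟩ : ∃ y', y' = (0 : R) • x + D • y + (-E) • z := ⟨_, rfl⟩
  -- The condensation identity for a 3×3 symmetric matrix: the 2×2 determinant of the minors is m
  -- times the full determinant.
  have hdet : D * (n * m - (Q * Q * X) ^ 2) - E ^ 2 = m * (f + 8 * (d * d)) := by
    -- For fixed pq = t² the determinant is affine in p + q with slope 8t². Since p + q = 2t + (P -
    -- Q)², moving away from p = q adds exactly 8d². The cubic of γ, together with the value 1 + 6γ
    -- - γ² of the maximum, is what makes the remaining quartic have a double zero at t = 1 - c.
    have h1 : m ^ 2 * n - m * (Q * Q) ^ 2 * X ^ 2 - n * (X ^ 2 * Y ^ 2) - m * (P * P) ^ 2 * Y ^ 2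
        - 2 * (X ^ 2 * Y ^ 2) * (P * P) * (Q * Q) = f + 8 * (d * d) := by
      rw [hf, hw, hd, hX, hY, hm, hn, ht]
      linear_combination (-1 - 23 * c + 9 * c ^ 2 - c ^ 3 + (c - 3) * (P * Q) ^ 2) * hc3
    rw [hD, hE, ← h1]
    ring
  -- Completed squares: x' and y' are the rows of the eliminated system, weighted by inverses of
  -- positive elements.
  have hform : sectorForm c (P * P) (Q * Q) X Y x y z = (⟪x', im • x'⟫_ℂ).re
      + (⟪y', (im * iD) • y'⟫_ℂ).re + (⟪z, (iD * (f + 8 * (d * d))) • z⟫_ℂ).re := by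
    have hadd : ∀ (r s : R) (u v : K),
        (⟪u, (r + s) • v⟫_ℂ).re = (⟪u, r • v⟫_ℂ).re + (⟪u, s • v⟫_ℂ).re := by
      intro r s u v; rw [add_smul, inner_add_right, Complex.add_re]
    have hneg : ∀ (r : R) (u v : K), (⟪u, (-r) • v⟫_ℂ).re = -(⟪u, r • v⟫_ℂ).re := by
      intro r u v; rw [neg_smul, inner_neg_right, Complex.neg_re]
    have hpq : P * P * (Q * Q) = t * t := by rw [ht]; ring
    have e11 : im * m * m = m := by linear_combination m * him
    have e12 : im * m * (-(X * Y)) = -(X * Y) := by linear_combination (-(X * Y)) * him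
    have e13 : im * m * (-(Q * Q * X)) = -(Q * Q * X) := by
      linear_combination (-(Q * Q * X)) * him
    have e22 : im * (-(X * Y)) * (-(X * Y)) + im * iD * D * D = m := by
      linear_combination im * D * hiD + m * him + im * hD
    have e23 : im * (-(X * Y)) * (-(Q * Q * X)) + im * iD * D * (-E) = -(P * P * Y) := by
      linear_combination (-im * E) * hiD + (- (P * P * Y)) * him - im * hE
    have e33 : im * (-(Q * Q * X)) * (-(Q * Q * X)) + im * iD * (-E) * (-E)
        + iD * (f + 8 * (d * d)) = n := by
      linear_combination (-im * iD) * hdet + n * him + (im * (n * m - (Q * Q * X) ^ 2)) * hiD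
        + (- iD * (f + 8 * (d * d))) * him
    have h22 := hadd (im * (-(X * Y)) * (-(X * Y))) (im * iD * D * D) y y
    have h23 := hadd (im * (-(X * Y)) * (-(Q * Q * X))) (im * iD * D * (-E)) y z
    have h33 := hadd (im * (-(Q * Q * X)) * (-(Q * Q * X)) + im * iD * (-E) * (-E))
      (iD * (f + 8 * (d * d))) z z
    rw [e22] at h22
    rw [e23, hneg] at h23
    rw [e33, hadd] at h33
    rw [hx', hy', h.quad_expand, h.quad_expand, e11, e12, e13, hneg, hneg, sectorForm, hpq,
      ← hm, ← hn]
    simp only [mul_zero, zero_mul, zero_smul, inner_zero_right, Complex.zero_re]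
    linarith
  have hfd := hfpos.add hdpos
  have n1 := himpos x'
  have n2 := h.mul_pos himpos hiDpos y'
  have n3 := h.mul_pos hiDpos hfd z
  refine ⟨by rw [hform]; positivity, fun h0 => ?_⟩
  rw [hform] at h0
  have z1 : x' = 0 := smul_cancel (mul_comm im m ▸ him)
    (h.smul_eq_zero_of_pos himpos (by linarith))
  have z2 : y' = 0 := by
    have := h.smul_eq_zero_of_pos (h.mul_pos himpos hiDpos) (x := y') (by linarith)
    refine smul_cancel (s := D * m) (r := im * iD) ?_ this
    linear_combination hiD + iD * D * him
  have z3 : (f + 8 * (d * d)) • z = 0 := by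
    have := h.smul_eq_zero_of_pos (h.mul_pos hiDpos hfd) (x := z) (by linarith)
    rw [mul_smul] at this
    exact smul_cancel (mul_comm iD D ▸ hiD) this
  have z4 : (⟪z, f • z⟫_ℂ).re + (⟪z, (8 * (d * d)) • z⟫_ℂ).re = 0 := by
    rw [← Complex.add_re, ← inner_add_right, ← add_smul, z3, inner_zero_right, Complex.zero_re]
  have hfz : f • z = 0 := h.smul_eq_zero_of_pos hfpos (by linarith [hfpos z, hdpos z])
  have hdz : (8 * (d * d)) • z = 0 :=
    h.smul_eq_zero_of_pos hdpos (by linarith [hfpos z, hdpos z])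
  have hsq : ∀ r : R, (r * r) • z = 0 → r • z = 0 := by
    intro r hr
    rw [← inner_self_eq_zero (𝕜 := ℂ), h.symm, smul_smul, hr, inner_zero_right]
  have hee : e * e * e * 8 = 1 := by linear_combination (e * e * 4 + e * 2 + 1) * he2
  have hdz' : d • z = 0 := by
    refine hsq d (smul_cancel (s := e * e * e) (r := 8) hee ?_)
    rwa [smul_smul]
  have htz : (t - (1 - c)) • z = 0 := by
    refine hsq _ (smul_cancel (s := e * e * iw) (r := 4 * w) ?_ ?_)
    · linear_combination e * e * 4 * hiw + (e * 2 + 1) * he2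
    · rw [smul_smul, ← hfz, hf]; congr 1; ring
  have hc4 : ∃ v : R, v * (1 - c) = 1 := by
    refine ⟨algebraMap ℝ R (1 - γ)⁻¹, ?_⟩
    rw [hc, ← map_one (algebraMap ℝ R), ← map_sub, ← map_mul, inv_mul_cancel₀ (by linarith)]
  obtain ⟨v, hv⟩ := hc4
  have htz' : t • z = (1 - c) • z := by rwa [sub_smul, sub_eq_zero] at htz
  -- From t(P - Q)z = 0, where t acts on z as the invertible scalar 1 - c. Then p, q and t all agree
  -- on z.
  have hPQ : P • z = Q • z := by
    rw [← sub_eq_zero, ← sub_smul]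
    refine smul_cancel hv ?_
    rw [smul_smul, mul_comm, mul_smul, ← htz', smul_smul, mul_comm, ← hd, hdz']
  have hpz : (P * P) • z = (1 - c) • z := by
    rw [mul_smul, hPQ, smul_smul, ← ht, htz']
  have hqz : (Q * Q) • z = (1 - c) • z := by
    rw [mul_smul, ← hPQ, smul_smul, mul_comm, ← ht, htz']
  have hm' : m = 6 * c - c ^ 2 - 1 + (P * P) * (Q * Q) := by rw [hm, ht]; ring
  have hDy : D • y = E • z := by
    rw [hy', zero_smul, zero_add, neg_smul, add_neg_eq_zero] at z2; exact z2
  have hmx : m • x = (X * Y) • y + (Q * Q * X) • z := by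
    rw [hx', neg_smul, neg_smul, add_neg_eq_zero, add_neg_eq_iff_eq_add] at z1
    rw [z1]; abel
  have pull : ∀ {r s : R} {u : K}, r • u = (1 - c) • u → r • s • u = (1 - c) • s • u := by
    intro r s u hu
    rw [smul_comm, hu, smul_comm]
  have cancel : ∀ {i r s : R} {u : K}, i * r = 1 → s • r • u = (1 - c) • r • u →
      s • u = (1 - c) • u := by
    intro i r s u hir hs
    rw [← sub_eq_zero, ← sub_smul]
    refine smul_cancel hir ?_
    rw [smul_comm, sub_smul, hs, sub_self]
  have hpy : (P * P) • y = (1 - c) • y := cancel hiD (by rw [hDy, pull hpz])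
  have hqy : (Q * Q) • y = (1 - c) • y := cancel hiD (by rw [hDy, pull hqz])
  have hpx : (P * P) • x = (1 - c) • x :=
    cancel him (by rw [hmx, smul_add, smul_add, pull hpz, pull hpy])
  have hqx : (Q * Q) • x = (1 - c) • x :=
    cancel him (by rw [hmx, smul_add, smul_add, pull hqz, pull hqy])
  obtain ⟨hx, hy⟩ := kernel_at_common_angle hγ1 hγ2 hc hκ hX hY hpx hqx hpy hqy hpz hqz
    (by rw [← hm']; exact hmx) (by rw [← hm', ← hD, ← hE]; exact hDy)
  exact ⟨⟨hpx, hpy, hpz⟩, ⟨hqx, hqy, hqz⟩, hx, hy⟩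

end Form

/-! ### The double commutant as a ring of symmetric operators -/

section Bicommutant

variable {K : Type*} [NormedAddCommGroup K] [InnerProductSpace ℂ K] [CompleteSpace K]

/-- A commuting family S lies in its commutant S', hence S'' ⊆ S', and S'' commutes with S'. -/
theorem mul_comm_of_mem_bicommutant {A : Type*} [Mul A] {S : Set A}
    (hS : ∀ a ∈ S, ∀ b ∈ S, a * b = b * a) {r s : A} (hr : r ∈ S.centralizer.centralizer)
    (hs : s ∈ S.centralizer.centralizer) : r * s = s * r :=
  (hr s (Set.centralizer_subset (fun a ha b hb => hS b hb a ha) hs)).symm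

/-- The self-adjoint elements of the double commutant of a commuting family. -/
def symmetricBicommutant (S : Set (K →L[ℂ] K)) (hS : ∀ a ∈ S, ∀ b ∈ S, a * b = b * a) :
    Subalgebra ℝ (K →L[ℂ] K) where
  carrier := {r | IsSelfAdjoint r ∧ r ∈ S.centralizer.centralizer}
  mul_mem' hr hs := ⟨(IsSelfAdjoint.commute_iff hr.1 hs.1).mp
    (mul_comm_of_mem_bicommutant hS hr.2 hs.2), Set.mul_mem_centralizer hr.2 hs.2⟩
  add_mem' hr hs := ⟨hr.1.add hs.1, Set.add_mem_centralizer hr.2 hs.2⟩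
  algebraMap_mem' a := ⟨.algebraMap _ (.all a), fun b _ => (Algebra.commutes a b).symm⟩

/-- The commutative ring structure on `symmetricBicommutant`. -/
abbrev symmetricBicommutantCommRing (S : Set (K →L[ℂ] K))
    (hS : ∀ a ∈ S, ∀ b ∈ S, a * b = b * a) : CommRing (symmetricBicommutant S hS) :=
  { (symmetricBicommutant S hS).toRing with
    mul_comm := fun r s => Subtype.ext (mul_comm_of_mem_bicommutant hS r.2.2 s.2.2) }

theorem isPositive_of_isSelfAdjoint_of_re {r : K →L[ℂ] K} (hr : IsSelfAdjoint r)
    (h : ∀ x : K, 0 ≤ (⟪x, r x⟫_ℂ).re) : r.IsPositive := by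
  rw [ContinuousLinearMap.isPositive_def']
  refine ⟨hr, fun x => ?_⟩
  have := h x
  rw [← inner_conj_symm, Complex.conj_re] at this
  exact this

/-- Square roots and inverses commute with everything the operator commutes with, so they stay in
the double commutant without any approximation argument. Since the ring is commutative, operator
identities become polynomial identities. -/
theorem symmetricCalculus_bicommutant (S : Set (K →L[ℂ] K))
    (hS : ∀ a ∈ S, ∀ b ∈ S, a * b = b * a) :
    letI := symmetricBicommutantCommRing S hS
    SymmetricCalculus (symmetricBicommutant S hS) K := by
  let := symmetricBicommutantCommRing S hS
  refine ⟨fun r x y => ?_, fun a ha x => ?_, fun r hr => ?_, fun r ε hε hr => ?_⟩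
  · exact (ContinuousLinearMap.isSelfAdjoint_iff_isSymmetric.mp r.2.1) x y
  · change 0 ≤ (⟪x, (algebraMap ℝ (K →L[ℂ] K) a) x⟫_ℂ).re
    have e : (algebraMap ℝ (K →L[ℂ] K) a) x = (a : ℂ) • x := by
      rw [Algebra.algebraMap_eq_smul_one]; simp
    rw [e, inner_smul_right, Complex.re_ofReal_mul]
    exact mul_nonneg ha (inner_self_nonneg (𝕜 := ℂ))
  · have hr0 : 0 ≤ (r : K →L[ℂ] K) := (ContinuousLinearMap.nonneg_iff_isPositive _).mpr
      (isPositive_of_isSelfAdjoint_of_re r.2.1 hr)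
    have hs := CFC.sqrt_nonneg (r : K →L[ℂ] K)
    refine ⟨⟨CFC.sqrt (r : K →L[ℂ] K), .of_nonneg hs, fun b hb => ?_⟩, fun x => ?_, ?_⟩
    · rw [CFC.sqrt_eq_real_sqrt (r : K →L[ℂ] K)]
      exact (Commute.cfcₙ_real (show Commute (r : K →L[ℂ] K) b from (r.2.2 b hb).symm) _).symm
    · exact ((ContinuousLinearMap.nonneg_iff_isPositive _).mp hs).re_inner_nonneg_right x
    · exact Subtype.ext (CFC.sqrt_mul_sqrt_self (r : K →L[ℂ] K) hr0)
  · have hle : algebraMap ℝ (K →L[ℂ] K) ε ≤ r := by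
      rw [ContinuousLinearMap.le_def]
      exact isPositive_of_isSelfAdjoint_of_re (r - algebraMap ℝ _ ε).2.1 hr
    have hu : IsUnit (r : K →L[ℂ] K) := CStarAlgebra.isUnit_of_le _ hle
      (isStrictlyPositive_algebraMap hε)
    obtain ⟨v, hv⟩ := hu
    refine IsUnit.of_mul_eq_one ⟨((v⁻¹ : (K →L[ℂ] K)ˣ) : K →L[ℂ] K), ?_, fun b hb => ?_⟩ ?_
    · have : IsSelfAdjoint (v : K →L[ℂ] K) := hv ▸ r.2.1
      have h2 : IsSelfAdjoint v := Units.ext this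
      exact congrArg Units.val (show star v⁻¹ = v⁻¹ by rw [star_inv, h2.star_eq])
    · have : Commute b (v : K →L[ℂ] K) := hv ▸ (r.2.2 b hb)
      exact this.units_inv_right
    · exact Subtype.ext (by
        change (r : K →L[ℂ] K) * _ = 1
        exact (congrArg (· * _) hv.symm).trans (Units.mul_inv v))

end Bicommutant

/-! ### CHSH as a quadratic form on the sectors -/

section Sectors

variable {R K : Type*} [CommRing R] [Algebra ℝ R] [NormedAddCommGroup K]
    [InnerProductSpace ℂ K] [Module R K]

theorem inner_eq_zero_of_eigen_neg {A : K →L[ℂ] K} (hA : (A : K →ₗ[ℂ] K).IsSymmetric) {u v : K}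
    (hu : A u = u) (hv : A v = -v) : ⟪u, v⟫_ℂ = 0 ∧ ⟪v, u⟫_ℂ = 0 := by
  have h : ⟪u, v⟫_ℂ = 0 := by
    have := hA u v
    simp only [ContinuousLinearMap.coe_coe, hu, hv, inner_neg_right] at this
    exact self_eq_neg.mp this
  exact ⟨h, inner_eq_zero_symm.mp h⟩

/-- The CHSH expectation value `-⟨A₀B₀⟩ - ⟨A₀B₁⟩ - ⟨A₁B₀⟩ + ⟨A₁B₁⟩`. -/
def chshExpectation (A₀ A₁ B₀ B₁ : K →L[ℂ] K) (ψ : K) : ℝ :=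
  (⟪ψ, -A₀ (B₀ ψ) - A₀ (B₁ ψ) - A₁ (B₀ ψ) + A₁ (B₁ ψ)⟫_ℂ).re

/-- A₁ = (1 - p)A₀ + X splits into a part preserving the eigenspaces of A₀ and a part exchanging
them, and likewise for Bob. So each matrix entry is read off by tracking which sector every term
lands in; different sectors are orthogonal. -/
theorem chshExpectation_sectors (h : SymmetricCalculus R K) {A₀ A₁ B₀ B₁ : K →L[ℂ] K}
    (hA : (A₀ : K →ₗ[ℂ] K).IsSymmetric) (hB : (B₀ : K →ₗ[ℂ] K).IsSymmetric)
    {c p q X Y : R} (hAc : ∀ v, A₀ (c • v) = c • A₀ v) (hBc : ∀ v, B₀ (c • v) = c • B₀ v)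
    (hA1 : ∀ v, A₁ v = (1 - p) • A₀ v + X • v) (hB1 : ∀ v, B₁ v = (1 - q) • B₀ v + Y • v)
    (hAp : ∀ v, A₀ (p • v) = p • A₀ v) (hAq : ∀ v, A₀ (q • v) = q • A₀ v)
    (hAX : ∀ v, A₀ (X • v) = -(X • A₀ v)) (hAY : ∀ v, A₀ (Y • v) = Y • A₀ v)
    (hBp : ∀ v, B₀ (p • v) = p • B₀ v) (hBq : ∀ v, B₀ (q • v) = q • B₀ v)
    (hBX : ∀ v, B₀ (X • v) = X • B₀ v) (hBY : ∀ v, B₀ (Y • v) = -(Y • B₀ v))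
    {x y z : K} (hAx : A₀ x = x) (hBx : B₀ x = -x) (hAy : A₀ y = -y) (hBy : B₀ y = y)
    (hAz : A₀ z = -z) (hBz : B₀ z = -z) :
    sectorForm c p q X Y x y z = (⟪x + y + z, (1 + 6 * c - c ^ 2) • (x + y + z)⟫_ℂ).re
      - chshExpectation A₀ A₁ B₀ B₁ (x + y + z) := by
  -- The components of the CHSH operator applied to x + y + z: u, v, w lie in the sectors of x, y,
  -- z. The fourth, o, lies in the excluded sector (+,+) and does not contribute.
  obtain ⟨u, hu⟩ : ∃ u, u = (2 - p * q) • x + X • Y • y + q • X • z := ⟨_, rfl⟩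
  obtain ⟨v, hv⟩ : ∃ v, v = (2 - p * q) • y + X • Y • x + p • Y • z := ⟨_, rfl⟩
  obtain ⟨w, hw⟩ : ∃ w, w = (-(2 - p * q)) • z + q • X • x + p • Y • y := ⟨_, rfl⟩
  obtain ⟨o, ho⟩ : ∃ o, o = X • Y • z - p • Y • x - q • X • y := ⟨_, rfl⟩
  have hS : -A₀ (B₀ (x + y + z)) - A₀ (B₁ (x + y + z)) - A₁ (B₀ (x + y + z))
      + A₁ (B₁ (x + y + z)) = u + v + w + o := by
    simp only [hA1, hB1, map_add, map_neg, smul_add, sub_smul, one_smul, smul_neg, map_sub,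
      hAq, hAY, hAx, hBx, hAy, hBy, hAz, hBz, hu, hv, hw, ho]
    module
  have two : ∀ v : K, (2 : R) • v = v + v := fun v => by module
  have hAu : A₀ u = u := by
    simp only [hu, map_add, sub_smul, mul_smul, two, map_sub, hAp, hAq, hAX, hAY, hAx, hAy, hAz,
      smul_neg, neg_neg]
  have hBu : B₀ u = -u := by
    simp only [hu, map_add, sub_smul, mul_smul, two, map_sub, hBp, hBq, hBX, hBY, hBx, hBy, hBz,
      smul_neg]
    abel
  have hAv : A₀ v = -v := by
    simp only [hv, map_add, sub_smul, mul_smul, two, map_sub, hAp, hAq, hAX, hAY, hAx, hAy, hAz,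
      smul_neg]
    abel
  have hBv : B₀ v = v := by
    simp only [hv, map_add, sub_smul, mul_smul, two, map_sub, hBp, hBq, hBX, hBY, hBx, hBy, hBz,
      smul_neg, neg_neg]
  have hAw : A₀ w = -w := by
    simp only [hw, map_add, sub_smul, neg_smul, mul_smul, two, map_sub, hAp, hAq, hAX, hAY, hAx,
      hAy, hAz, smul_neg, map_neg]
    abel
  have hBw : B₀ w = -w := by
    simp only [hw, map_add, sub_smul, neg_smul, mul_smul, two, map_sub, hBp, hBq, hBX, hBY, hBx,
      hBy, hBz, smul_neg, map_neg]
    abel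
  have hAo : A₀ o = o := by
    simp only [ho, map_sub, hAp, hAq, hAX, hAY, hAx, hAy, hAz, smul_neg, neg_neg]
  have hBo : B₀ o = o := by
    simp only [ho, map_sub, hBp, hBq, hBX, hBY, hBx, hBy, hBz, smul_neg, neg_neg]
  have hAl : ∀ v, A₀ ((1 + 6 * c - c ^ 2) • v) = (1 + 6 * c - c ^ 2) • A₀ v := by
    intro v
    have e : ∀ v : K, (1 + 6 * c - c ^ 2) • v =
        v + (c • v + c • v + c • v + c • v + c • v + c • v) - c • c • v := fun v => by module
    simp only [e, map_add, map_sub, hAc]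
  have hBl : ∀ v, B₀ ((1 + 6 * c - c ^ 2) • v) = (1 + 6 * c - c ^ 2) • B₀ v := by
    intro v
    have e : ∀ v : K, (1 + 6 * c - c ^ 2) • v =
        v + (c • v + c • v + c • v + c • v + c • v + c • v) - c • c • v := fun v => by module
    simp only [e, map_add, map_sub, hBc]
  obtain ⟨l, hl⟩ : ∃ l, l = 1 + 6 * c - c ^ 2 := ⟨_, rfl⟩
  rw [← hl] at hAl hBl
  have hlx : A₀ (l • x) = l • x := by rw [hAl, hAx]
  have hlz : B₀ (l • z) = -(l • z) := by rw [hBl, hBz, smul_neg]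
  have hlz' : A₀ (l • z) = -(l • z) := by rw [hAl, hAz, smul_neg]
  have hly : A₀ (l • y) = -(l • y) := by rw [hAl, hAy, smul_neg]
  have hly' : B₀ (l • y) = l • y := by rw [hBl, hBy]
  have hsymm : ∀ (r : R) (a b : K), (⟪a, r • b⟫_ℂ).re = (⟪b, r • a⟫_ℂ).re := by
    intro r a b
    rw [← h.symm, ← inner_conj_symm, Complex.conj_re]
  have hadd : ∀ (r s : R) (u v : K),
      (⟪u, (r + s) • v⟫_ℂ).re = (⟪u, r • v⟫_ℂ).re + (⟪u, s • v⟫_ℂ).re := by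
    intro r s u v; rw [add_smul, inner_add_right, Complex.add_re]
  have hneg : ∀ (r : R) (u v : K), (⟪u, (-r) • v⟫_ℂ).re = -(⟪u, r • v⟫_ℂ).re := by
    intro r u v; rw [neg_smul, inner_neg_right, Complex.neg_re]
  rw [chshExpectation, hS, ← hl]
  simp only [smul_add, inner_add_left, inner_add_right, Complex.add_re,
    (inner_eq_zero_of_eigen_neg hA hAx hAv).1, (inner_eq_zero_of_eigen_neg hA hAx hAw).1,
    (inner_eq_zero_of_eigen_neg hB hBo hBx).2, (inner_eq_zero_of_eigen_neg hA hAu hAy).2,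
    (inner_eq_zero_of_eigen_neg hB hBy hBw).1, (inner_eq_zero_of_eigen_neg hA hAo hAy).2,
    (inner_eq_zero_of_eigen_neg hA hAu hAz).2, (inner_eq_zero_of_eigen_neg hB hBv hBz).2,
    (inner_eq_zero_of_eigen_neg hA hAo hAz).2, (inner_eq_zero_of_eigen_neg hA hAx hly).1,
    (inner_eq_zero_of_eigen_neg hA hAx hlz').1, (inner_eq_zero_of_eigen_neg hA hlx hAy).2,
    (inner_eq_zero_of_eigen_neg hB hBy hlz).1, (inner_eq_zero_of_eigen_neg hA hlx hAz).2,
    (inner_eq_zero_of_eigen_neg hB hly' hBz).2, Complex.zero_re]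
  have e1 : 6 * c - c ^ 2 - 1 + p * q = l + (-(2 - p * q)) := by rw [hl]; ring
  have e2 : 3 + 6 * c - c ^ 2 - p * q = l + (2 - p * q) := by rw [hl]; ring
  rw [hu, hv, hw, sectorForm, e1, e2]
  simp only [smul_smul, inner_add_right, Complex.add_re, hadd, hneg]
  rw [hsymm (X * Y) y x, hsymm (q * X) z x, hsymm (p * Y) z y]
  ring

end Sectors

/-! ### Two involutions: the cosine and the anticommuting part -/

section Involutions

variable {K : Type*} [NormedAddCommGroup K] [InnerProductSpace ℂ K]

/-- Half the anticommutator: the cosine of the angle between two involutions. -/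
def cosOp (A₀ A₁ : K →L[ℂ] K) : K →L[ℂ] K := (1 / 2 : ℂ) • (A₀ * A₁ + A₁ * A₀)

/-- The part of `A₁` that anticommutes with `A₀`. -/
def offDiag (A₀ A₁ : K →L[ℂ] K) : K →L[ℂ] K := A₁ - cosOp A₀ A₁ * A₀

theorem Commute.cosOp_right {A₀ A₁ T : K →L[ℂ] K} (h0 : Commute T A₀) (h1 : Commute T A₁) :
    Commute T (cosOp A₀ A₁) :=
  ((h0.mul_right h1).add_right (h1.mul_right h0)).smul_right _

theorem Commute.offDiag_right {A₀ A₁ T : K →L[ℂ] K} (h0 : Commute T A₀) (h1 : Commute T A₁) :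
    Commute T (offDiag A₀ A₁) :=
  h1.sub_right ((h0.cosOp_right h1).mul_right h0)

theorem commute_cosOp_left {A₀ A₁ : K →L[ℂ] K} (h0 : A₀ * A₀ = 1) : Commute A₀ (cosOp A₀ A₁) := by
  refine Commute.smul_right ?_ _
  change A₀ * _ = _ * A₀
  rw [mul_add, add_mul, ← mul_assoc, h0, one_mul, mul_assoc A₁, h0, mul_one, ← mul_assoc, add_comm]

theorem commute_cosOp_right {A₀ A₁ : K →L[ℂ] K} (h1 : A₁ * A₁ = 1) :
    Commute A₁ (cosOp A₀ A₁) := by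
  rw [cosOp, add_comm]
  exact commute_cosOp_left h1

theorem two_cosOp (A₀ A₁ : K →L[ℂ] K) :
    A₀ * A₁ + A₁ * A₀ = cosOp A₀ A₁ + cosOp A₀ A₁ := by
  rw [cosOp, ← add_smul]; norm_num

theorem offDiag_anticomm {A₀ A₁ : K →L[ℂ] K} (h0 : A₀ * A₀ = 1) :
    A₀ * offDiag A₀ A₁ = -(offDiag A₀ A₁ * A₀) := by
  have h := commute_cosOp_left (A₁ := A₁) h0
  rw [eq_neg_iff_add_eq_zero, offDiag, mul_sub, sub_mul, mul_assoc, h0, mul_one, ← mul_assoc,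
    h.eq, mul_assoc, h0, mul_one, sub_add_sub_comm, two_cosOp, sub_self]

/-- The operator form of sin² = 1 - cos²: the cross terms of (A₁ - aA₀)² combine to -2a², as a
commutes with both involutions and the anticommutator is 2a. -/
theorem offDiag_sq {A₀ A₁ : K →L[ℂ] K} (h0 : A₀ * A₀ = 1) (h1 : A₁ * A₁ = 1) :
    offDiag A₀ A₁ * offDiag A₀ A₁ = 1 - cosOp A₀ A₁ * cosOp A₀ A₁ := by
  have ha := (commute_cosOp_left (A₁ := A₁) h0).eq
  have hb := (commute_cosOp_right (A₀ := A₀) h1).eq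
  have h2 := two_cosOp A₀ A₁
  rw [offDiag]
  generalize cosOp A₀ A₁ = a at *
  have e1 : A₁ * (a * A₀) + a * A₀ * A₁ = a * a + a * a := by
    rw [← mul_assoc, hb, mul_assoc, mul_assoc, ← mul_add, add_comm, h2, mul_add]
  have e2 : a * A₀ * (a * A₀) = a * a := by
    rw [mul_assoc, ← mul_assoc A₀, ha, mul_assoc, h0, mul_one]
  calc (A₁ - a * A₀) * (A₁ - a * A₀)
      = A₁ * A₁ - (A₁ * (a * A₀) + a * A₀ * A₁) + a * A₀ * (a * A₀) := by noncomm_ring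
    _ = 1 - a * a := by rw [h1, e1, e2]; noncomm_ring

variable [CompleteSpace K]

theorem isSelfAdjoint_cosOp {A₀ A₁ : K →L[ℂ] K} (h0 : IsSelfAdjoint A₀) (h1 : IsSelfAdjoint A₁) :
    IsSelfAdjoint (cosOp A₀ A₁) := by
  rw [IsSelfAdjoint, cosOp, star_smul, star_add, star_mul, star_mul, h0.star_eq, h1.star_eq,
    add_comm]
  simp

theorem isSelfAdjoint_offDiag {A₀ A₁ : K →L[ℂ] K} (h0 : IsSelfAdjoint A₀)
    (h1 : IsSelfAdjoint A₁) (h00 : A₀ * A₀ = 1) : IsSelfAdjoint (offDiag A₀ A₁) := by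
  rw [IsSelfAdjoint, offDiag, star_sub, star_mul, h0.star_eq, h1.star_eq,
    (isSelfAdjoint_cosOp h0 h1).star_eq, (commute_cosOp_left h00).eq]

/-- 1 - a = (A₀ - A₁)²/2 is a square. -/
theorem re_inner_one_sub_cosOp {A₀ A₁ : K →L[ℂ] K} (h0 : IsSelfAdjoint A₀)
    (h1 : IsSelfAdjoint A₁) (h00 : A₀ * A₀ = 1) (h11 : A₁ * A₁ = 1) (x : K) :
    0 ≤ (⟪x, (1 - cosOp A₀ A₁) x⟫_ℂ).re := by
  have e : 1 - cosOp A₀ A₁ = (1 / 2 : ℂ) • ((A₀ - A₁) * (A₀ - A₁)) := by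
    have : (A₀ - A₁) * (A₀ - A₁) = A₀ * A₀ + A₁ * A₁ - (A₀ * A₁ + A₁ * A₀) := by noncomm_ring
    rw [this, h00, h11, cosOp, smul_sub]
    congr 1
    ext x
    change x = (1 / 2 : ℂ) • (x + x)
    rw [← two_smul ℂ x, smul_smul]
    norm_num
  have hs : IsSelfAdjoint (A₀ - A₁) := h0.sub h1
  have := (ContinuousLinearMap.isSelfAdjoint_iff_isSymmetric.mp hs) x ((A₀ - A₁) x)
  rw [e, smul_apply, inner_smul_right]
  change 0 ≤ (1 / 2 * ⟪x, (A₀ - A₁) ((A₀ - A₁) x)⟫_ℂ).re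
  simp only [ContinuousLinearMap.coe_coe] at this
  rw [← this]
  have h2 : 0 ≤ (⟪(A₀ - A₁) x, (A₀ - A₁) x⟫_ℂ).re := inner_self_nonneg (𝕜 := ℂ)
  have : ((1 / 2 : ℂ) * ⟪(A₀ - A₁) x, (A₀ - A₁) x⟫_ℂ).re
      = (1 / 2) * (⟪(A₀ - A₁) x, (A₀ - A₁) x⟫_ℂ).re := by
    simp [Complex.mul_re]
  rw [this]; positivity

theorem re_inner_one_add_cosOp {A₀ A₁ : K →L[ℂ] K} (h0 : IsSelfAdjoint A₀)
    (h1 : IsSelfAdjoint A₁) (h00 : A₀ * A₀ = 1) (h11 : A₁ * A₁ = 1) (x : K) :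
    0 ≤ (⟪x, (1 + cosOp A₀ A₁) x⟫_ℂ).re := by
  have := re_inner_one_sub_cosOp h0 h1.neg h00 (by rw [neg_mul_neg, h11]) x
  have e : cosOp A₀ (-A₁) = -cosOp A₀ A₁ := by
    rw [cosOp, cosOp, mul_neg, neg_mul, ← neg_add, smul_neg]
  rwa [e, sub_neg_eq_add] at this

end Involutions

/-- The abstract form is applied in the double commutant of {a, b, X, Y}. A₀ and B₀ stay outside
that ring, because they anticommute with X and Y; they serve only to separate the sectors. -/
theorem chshExpectation_le_and_eq {K : Type*} [NormedAddCommGroup K] [InnerProductSpace ℂ K]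
    [CompleteSpace K] {A₀ A₁ B₀ B₁ : K →L[ℂ] K}
    (sA₀ : IsSelfAdjoint A₀) (sA₁ : IsSelfAdjoint A₁)
    (sB₀ : IsSelfAdjoint B₀) (sB₁ : IsSelfAdjoint B₁)
    (iA₀ : A₀ * A₀ = 1) (iA₁ : A₁ * A₁ = 1) (iB₀ : B₀ * B₀ = 1) (iB₁ : B₁ * B₁ = 1)
    (c₀₀ : Commute A₀ B₀) (c₀₁ : Commute A₀ B₁) (c₁₀ : Commute A₁ B₀) (c₁₁ : Commute A₁ B₁)
    {γ : ℝ} (hγ : γ ^ 3 - 9 * γ ^ 2 - γ + 1 = 0) (hγ1 : 0.28 < γ) (hγ2 : γ < 0.29)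
    {x y z : K} (hAx : A₀ x = x) (hBx : B₀ x = -x) (hAy : A₀ y = -y) (hBy : B₀ y = y)
    (hAz : A₀ z = -z) (hBz : B₀ z = -z) :
    chshExpectation A₀ A₁ B₀ B₁ (x + y + z) ≤ (1 + 6 * γ - γ ^ 2) * ‖x + y + z‖ ^ 2 ∧
    (chshExpectation A₀ A₁ B₀ B₁ (x + y + z) = (1 + 6 * γ - γ ^ 2) * ‖x + y + z‖ ^ 2 →
      (cosOp A₀ A₁ x = (γ : ℂ) • x ∧ cosOp A₀ A₁ y = (γ : ℂ) • y ∧ cosOp A₀ A₁ z = (γ : ℂ) • z) ∧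
      (cosOp B₀ B₁ x = (γ : ℂ) • x ∧ cosOp B₀ B₁ y = (γ : ℂ) • y ∧ cosOp B₀ B₁ z = (γ : ℂ) • z) ∧
      x = (((13 + 44 * γ - 5 * γ ^ 2) / 8 : ℝ) : ℂ) • offDiag A₀ A₁ z ∧
      y = (((13 + 44 * γ - 5 * γ ^ 2) / 8 : ℝ) : ℂ) • offDiag B₀ B₁ z) := by
  obtain ⟨a, ha⟩ : ∃ a, a = cosOp A₀ A₁ := ⟨_, rfl⟩
  obtain ⟨b, hb⟩ : ∃ b, b = cosOp B₀ B₁ := ⟨_, rfl⟩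
  obtain ⟨X, hX⟩ : ∃ X, X = offDiag A₀ A₁ := ⟨_, rfl⟩
  obtain ⟨Y, hY⟩ : ∃ Y, Y = offDiag B₀ B₁ := ⟨_, rfl⟩
  have cA₀b : Commute A₀ b := hb ▸ c₀₀.cosOp_right c₀₁
  have cA₁b : Commute A₁ b := hb ▸ c₁₀.cosOp_right c₁₁
  have cA₀Y : Commute A₀ Y := hY ▸ c₀₀.offDiag_right c₀₁
  have cA₁Y : Commute A₁ Y := hY ▸ c₁₀.offDiag_right c₁₁
  have cB₀a : Commute B₀ a := ha ▸ c₀₀.symm.cosOp_right c₁₀.symm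
  have cB₀X : Commute B₀ X := hX ▸ c₀₀.symm.offDiag_right c₁₀.symm
  have cA₀a : Commute A₀ a := ha ▸ commute_cosOp_left iA₀
  have cA₁a : Commute A₁ a := ha ▸ commute_cosOp_right iA₁
  have cB₀b : Commute B₀ b := hb ▸ commute_cosOp_left iB₀
  have cB₁b : Commute B₁ b := hb ▸ commute_cosOp_right iB₁
  have caX : Commute a X := hX ▸ cA₀a.symm.offDiag_right cA₁a.symm
  have cbY : Commute b Y := hY ▸ cB₀b.symm.offDiag_right cB₁b.symm
  have cab : Commute a b := ha ▸ (cA₀b.symm.cosOp_right cA₁b.symm).symm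
  have cbX : Commute b X := hX ▸ cA₀b.symm.offDiag_right cA₁b.symm
  have caY : Commute a Y := ha ▸ (cA₀Y.symm.cosOp_right cA₁Y.symm).symm
  have cXY : Commute X Y := hX ▸ (cA₀Y.symm.offDiag_right cA₁Y.symm).symm
  obtain ⟨S, hSdef⟩ : ∃ S : Set (K →L[ℂ] K), S = {a, b, X, Y} := ⟨_, rfl⟩
  have hS : ∀ r ∈ S, ∀ s ∈ S, r * s = s * r := by
    rw [hSdef]
    rintro r (rfl | rfl | rfl | rfl) s (rfl | rfl | rfl | rfl) <;>
      first
      | rfl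
      | exact cab.eq | exact cab.symm.eq | exact caX.eq | exact caX.symm.eq | exact caY.eq
      | exact caY.symm.eq | exact cbX.eq | exact cbX.symm.eq | exact cbY.eq | exact cbY.symm.eq
      | exact cXY.eq | exact cXY.symm.eq
  let := symmetricBicommutantCommRing S hS
  have hC := symmetricCalculus_bicommutant S hS
  have hmem : ∀ r ∈ S, IsSelfAdjoint r → r ∈ symmetricBicommutant S hS :=
    fun r hr hs => ⟨hs, Set.subset_centralizer_centralizer hr⟩
  obtain ⟨a', ha'⟩ : ∃ r : symmetricBicommutant S hS, (r : K →L[ℂ] K) = a :=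
    ⟨⟨a, hmem a (by simp [hSdef]) (ha ▸ isSelfAdjoint_cosOp sA₀ sA₁)⟩, rfl⟩
  obtain ⟨b', hb'⟩ : ∃ r : symmetricBicommutant S hS, (r : K →L[ℂ] K) = b :=
    ⟨⟨b, hmem b (by simp [hSdef]) (hb ▸ isSelfAdjoint_cosOp sB₀ sB₁)⟩, rfl⟩
  obtain ⟨X', hX'⟩ : ∃ r : symmetricBicommutant S hS, (r : K →L[ℂ] K) = X :=
    ⟨⟨X, hmem X (by simp [hSdef]) (hX ▸ isSelfAdjoint_offDiag sA₀ sA₁ iA₀)⟩, rfl⟩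
  obtain ⟨Y', hY'⟩ : ∃ r : symmetricBicommutant S hS, (r : K →L[ℂ] K) = Y :=
    ⟨⟨Y, hmem Y (by simp [hSdef]) (hY ▸ isSelfAdjoint_offDiag sB₀ sB₁ iB₀)⟩, rfl⟩
  have hsmul : ∀ (r : symmetricBicommutant S hS) (v : K), r • v = (r : K →L[ℂ] K) v :=
    fun _ _ => rfl
  have halg : ∀ (r : ℝ) (v : K),
      (algebraMap ℝ (symmetricBicommutant S hS) r) • v = (r : ℂ) • v := by
    intro r v
    change (algebraMap ℝ (K →L[ℂ] K) r) v = _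
    rw [Algebra.algebraMap_eq_smul_one]; simp
  have app : ∀ {T r : K →L[ℂ] K}, Commute T r → ∀ v, T (r v) = r (T v) := fun h v =>
    DFunLike.congr_fun h.eq v
  have happ : ∀ {T : K →L[ℂ] K} {r : symmetricBicommutant S hS} (v : K),
      Commute T (r : K →L[ℂ] K) → T ((1 - r) • v) = (1 - r) • T v := by
    intro T r v h
    exact app ((Commute.one_right T).sub_right h) v
  have hX2 : X' ^ 2 = (1 - a') * (2 - (1 - a')) := by
    have e : X' * X' = 1 - a' * a' := by
      refine Subtype.ext ?_
      change (X' : K →L[ℂ] K) * X' = 1 - (a' : K →L[ℂ] K) * a'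
      rw [hX', ha', hX, ha]; exact offDiag_sq iA₀ iA₁
    linear_combination e
  have hY2 : Y' ^ 2 = (1 - b') * (2 - (1 - b')) := by
    have e : Y' * Y' = 1 - b' * b' := by
      refine Subtype.ext ?_
      change (Y' : K →L[ℂ] K) * Y' = 1 - (b' : K →L[ℂ] K) * b'
      rw [hY', hb', hY, hb]; exact offDiag_sq iB₀ iB₁
    linear_combination e
  have hp : ActsPos K (1 - a') := fun v => by
    change 0 ≤ (⟪v, ((1 : K →L[ℂ] K) - a') v⟫_ℂ).re
    rw [ha', ha]; exact re_inner_one_sub_cosOp sA₀ sA₁ iA₀ iA₁ v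
  have hq : ActsPos K (1 - b') := fun v => by
    change 0 ≤ (⟪v, ((1 : K →L[ℂ] K) - b') v⟫_ℂ).re
    rw [hb', hb]; exact re_inner_one_sub_cosOp sB₀ sB₁ iB₀ iB₁ v
  have hp2 : ActsPos K (2 - (1 - a')) := by
    have e : 2 - (1 - a') = 1 + a' := by ring
    rw [e]; intro v
    change 0 ≤ (⟪v, ((1 : K →L[ℂ] K) + a') v⟫_ℂ).re
    rw [ha', ha]; exact re_inner_one_add_cosOp sA₀ sA₁ iA₀ iA₁ v
  have hq2 : ActsPos K (2 - (1 - b')) := by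
    have e : 2 - (1 - b') = 1 + b' := by ring
    rw [e]; intro v
    change 0 ≤ (⟪v, ((1 : K →L[ℂ] K) + b') v⟫_ℂ).re
    rw [hb', hb]; exact re_inner_one_add_cosOp sB₀ sB₁ iB₀ iB₁ v
  obtain ⟨c, hc⟩ : ∃ c, c = algebraMap ℝ (symmetricBicommutant S hS) γ := ⟨_, rfl⟩
  obtain ⟨κ, hκ⟩ : ∃ κ, κ = algebraMap ℝ (symmetricBicommutant S hS)
    ((13 + 44 * γ - 5 * γ ^ 2) / 8) := ⟨_, rfl⟩
  have hκc : κ * (c ^ 2 + 4 * c - 1) = 1 - c := by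
    -- Modulo the cubic, (13 + 44γ - 5γ²)/8 is (1 - γ)/(γ² + 4γ - 1) written as a polynomial.
    have e : (13 + 44 * γ - 5 * γ ^ 2) / 8 * (γ ^ 2 + 4 * γ - 1) = 1 - γ := by
      linear_combination (-21 - 5 * γ) / 8 * hγ
    have := congrArg (algebraMap ℝ (symmetricBicommutant S hS)) e
    rw [map_mul, ← hκ] at this
    simpa only [map_sub, map_add, map_mul, map_pow, map_one, map_ofNat, ← hc] using this
  have hAc : ∀ (T : K →L[ℂ] K) (v : K), T (c • v) = c • T v := by
    intro T v; rw [hc, halg, halg, map_smul]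
  have key := chshExpectation_sectors hC (c := c) (p := 1 - a') (q := 1 - b') (X := X') (Y := Y')
    (ContinuousLinearMap.isSelfAdjoint_iff_isSymmetric.mp sA₀)
    (ContinuousLinearMap.isSelfAdjoint_iff_isSymmetric.mp sB₀) (hAc A₀) (hAc B₀)
    (A₁ := A₁) (B₁ := B₁)
    (fun v => by
      rw [sub_sub_cancel, hsmul, hsmul, ha', hX', hX, offDiag, ← ha]; simp)
    (fun v => by
      rw [sub_sub_cancel, hsmul, hsmul, hb', hY', hY, offDiag, ← hb]; simp)
    (fun v => happ v (ha' ▸ cA₀a))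
    (fun v => happ v (hb' ▸ cA₀b))
    (fun v => by
      simp only [hsmul, hX', hX]
      exact DFunLike.congr_fun (offDiag_anticomm (A₁ := A₁) iA₀) v)
    (fun v => by simp only [hsmul, hY', app cA₀Y])
    (fun v => happ v (ha' ▸ cB₀a))
    (fun v => happ v (hb' ▸ cB₀b))
    (fun v => by simp only [hsmul, hX', app cB₀X])
    (fun v => by
      simp only [hsmul, hY', hY]
      exact DFunLike.congr_fun (offDiag_anticomm (A₁ := B₁) iB₀) v)
    hAx hBx hAy hBy hAz hBz
  have hnorm : (⟪x + y + z, (1 + 6 * c - c ^ 2) • (x + y + z)⟫_ℂ).re =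
      (1 + 6 * γ - γ ^ 2) * ‖x + y + z‖ ^ 2 := by
    have e : 1 + 6 * c - c ^ 2 = algebraMap ℝ (symmetricBicommutant S hS) (1 + 6 * γ - γ ^ 2) := by
      simp only [map_sub, map_add, map_mul, map_pow, map_one, map_ofNat, ← hc]
    rw [e, halg, inner_smul_right, Complex.re_ofReal_mul, ← inner_self_eq_norm_sq (𝕜 := ℂ)]
    rfl
  obtain ⟨h1, h2⟩ := sectorForm_nonneg_and_eq hC hγ hγ1 hγ2 hc hκc hp hp2 hq hq2 hX2 hY2 x y z
  rw [key, hnorm] at h1 h2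
  refine ⟨by linarith, fun heq => ?_⟩
  obtain ⟨⟨p1, p2, p3⟩, ⟨q1, q2, q3⟩, hx, hy⟩ := h2 (by linarith)
  have conv : ∀ (r : symmetricBicommutant S hS) (v : K), (1 - r) • v = (1 - c) • v →
      (r : K →L[ℂ] K) v = (γ : ℂ) • v := by
    intro r v h
    rw [sub_smul, sub_smul, sub_right_inj, hc, halg] at h
    exact h
  rw [← ha, ← hb, ← hX, ← hY, ← ha', ← hb']
  refine ⟨⟨conv _ _ p1, conv _ _ p2, conv _ _ p3⟩, ⟨conv _ _ q1, conv _ _ q2, conv _ _ q3⟩, ?_, ?_⟩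
  · rw [mul_smul, hκ, halg, hsmul, hX'] at hx; exact hx
  · rw [mul_smul, hκ, halg, hsmul, hY'] at hy; exact hy

/-! ### Operators on the completed tensor product -/

section HilbertTensor

variable {E F E' F' E'' F'' : Type*} [NormedAddCommGroup E] [InnerProductSpace ℂ E]
    [NormedAddCommGroup F] [InnerProductSpace ℂ F]
    [NormedAddCommGroup E'] [InnerProductSpace ℂ E']
    [NormedAddCommGroup F'] [InnerProductSpace ℂ F']
    [NormedAddCommGroup E''] [InnerProductSpace ℂ E'']
    [NormedAddCommGroup F''] [InnerProductSpace ℂ F'']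

theorem HilbertTensor.clm_ext {G : Type*} [NormedAddCommGroup G] [NormedSpace ℂ G]
    {f g : HilbertTensor E F →L[ℂ] G}
    (h : ∀ u v, f (vecTensor E F u v) = g (vecTensor E F u v)) : f = g := by
  ext ξ
  induction ξ using UniformSpace.Completion.induction_on with
  | hp => exact isClosed_eq f.continuous g.continuous
  | ih w =>
    induction w using TensorProduct.induction_on with
    | zero => rw [UniformSpace.Completion.coe_zero, map_zero, map_zero]
    | tmul u v => exact h u v
    | add a b ha hb => rw [UniformSpace.Completion.coe_add, map_add, map_add, ha, hb]

theorem inner_vecTensor (u u' : E) (v v' : F) :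
    ⟪vecTensor E F u v, vecTensor E F u' v'⟫_ℂ = ⟪u, u'⟫_ℂ * ⟪v, v'⟫_ℂ := by
  rw [vecTensor_apply, vecTensor_apply, UniformSpace.Completion.inner_coe,
    TensorProduct.inner_tmul]

theorem HilbertTensor.ext_inner {ξ η : HilbertTensor E F}
    (h : ∀ u v, ⟪vecTensor E F u v, ξ⟫_ℂ = ⟪vecTensor E F u v, η⟫_ℂ) : ξ = η := by
  have : innerSL ℂ (ξ - η) = 0 := HilbertTensor.clm_ext fun u v => by
    rw [innerSL_apply_apply, zero_apply, ← inner_conj_symm, inner_sub_right, h, sub_self, map_zero]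
  have h2 := DFunLike.congr_fun this (ξ - η)
  rw [innerSL_apply_apply, zero_apply, inner_self_eq_zero] at h2
  exact sub_eq_zero.mp h2

theorem opTensor_comp (S' : E' →L[ℂ] E'') (T' : F' →L[ℂ] F'') (S : E →L[ℂ] E') (T : F →L[ℂ] F') :
    opTensor S' T' ∘L opTensor S T = opTensor (S' ∘L S) (T' ∘L T) :=
  HilbertTensor.clm_ext fun u v => by
    simp only [ContinuousLinearMap.comp_apply, opTensor_vecTensor]

theorem opTensor_opTensor (S' : E' →L[ℂ] E'') (T' : F' →L[ℂ] F'') (S : E →L[ℂ] E')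
    (T : F →L[ℂ] F') (ξ : HilbertTensor E F) :
    opTensor S' T' (opTensor S T ξ) = opTensor (S' ∘L S) (T' ∘L T) ξ :=
  DFunLike.congr_fun (opTensor_comp S' T' S T) ξ

theorem opTensor_mul (S' S : E →L[ℂ] E) (T' T : F →L[ℂ] F) :
    opTensor (S' * S) (T' * T) = opTensor S' T' * opTensor S T :=
  (opTensor_comp S' T' S T).symm

@[simp] theorem opTensor_one_one : opTensor (1 : E →L[ℂ] E) (1 : F →L[ℂ] F) = 1 :=
  HilbertTensor.clm_ext fun u v => by
    rw [opTensor_vecTensor]; rfl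

theorem opTensor_neg_left (S : E →L[ℂ] E') (T : F →L[ℂ] F') :
    opTensor (-S) T = -opTensor S T := by
  rw [← neg_one_smul ℂ S, opTensor_smul_left, neg_one_smul]

theorem opTensor_neg_right (S : E →L[ℂ] E') (T : F →L[ℂ] F') :
    opTensor S (-T) = -opTensor S T := by
  rw [← neg_one_smul ℂ T, opTensor_smul_right, neg_one_smul]

theorem opTensor_sub_left (S S' : E →L[ℂ] E') (T : F →L[ℂ] F') :
    opTensor (S - S') T = opTensor S T - opTensor S' T := by
  rw [sub_eq_add_neg, opTensor_add_left, opTensor_neg_left, sub_eq_add_neg]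

theorem opTensor_sub_right (S : E →L[ℂ] E') (T T' : F →L[ℂ] F') :
    opTensor S (T - T') = opTensor S T - opTensor S T' := by
  rw [sub_eq_add_neg, opTensor_add_right, opTensor_neg_right, sub_eq_add_neg]

theorem adjoint_opTensor [CompleteSpace E] [CompleteSpace F] [CompleteSpace E'] [CompleteSpace F']
    (S : E →L[ℂ] E') (T : F →L[ℂ] F') :
    (opTensor S T).adjoint = opTensor S.adjoint T.adjoint :=
  HilbertTensor.clm_ext fun u v => HilbertTensor.ext_inner fun e f => by
    rw [ContinuousLinearMap.adjoint_inner_right, opTensor_vecTensor, opTensor_vecTensor,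
      inner_vecTensor, inner_vecTensor, ContinuousLinearMap.adjoint_inner_right,
      ContinuousLinearMap.adjoint_inner_right]

theorem IsSelfAdjoint.opTensor [CompleteSpace E] [CompleteSpace F] {S : E →L[ℂ] E}
    {T : F →L[ℂ] F} (hS : IsSelfAdjoint S) (hT : IsSelfAdjoint T) :
    IsSelfAdjoint (opTensor S T) := by
  rw [ContinuousLinearMap.isSelfAdjoint_iff', adjoint_opTensor,
    ContinuousLinearMap.isSelfAdjoint_iff'.mp hS, ContinuousLinearMap.isSelfAdjoint_iff'.mp hT]

theorem inner_opTensor_isometry [CompleteSpace E] [CompleteSpace F] [CompleteSpace E']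
    [CompleteSpace F'] (V : E →ₗᵢ[ℂ] E') (W : F →ₗᵢ[ℂ] F') (ξ η : HilbertTensor E F) :
    ⟪opTensor V.toContinuousLinearMap W.toContinuousLinearMap ξ,
      opTensor V.toContinuousLinearMap W.toContinuousLinearMap η⟫_ℂ = ⟪ξ, η⟫_ℂ := by
  have hV : V.toContinuousLinearMap.adjoint ∘L V.toContinuousLinearMap = 1 :=
    (ContinuousLinearMap.norm_map_iff_adjoint_comp_self _).mp V.norm_map
  have hW : W.toContinuousLinearMap.adjoint ∘L W.toContinuousLinearMap = 1 :=
    (ContinuousLinearMap.norm_map_iff_adjoint_comp_self _).mp W.norm_map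
  rw [← ContinuousLinearMap.adjoint_inner_right, adjoint_opTensor, opTensor_opTensor, hV, hW,
    opTensor_one_one, one_apply_eq_self]

/-- The orthogonal complement of ker T is the closure of the range of T, and ⟨Tg ⊗ v, ψ⟩ = ⟨g ⊗ v,
(T ⊗ 1)ψ⟩ = 0. This turns an eigenvalue equation for ψ into a statement about the local support of
ψ, without a Schmidt decomposition. -/
theorem opTensor_starProjection_ker_left [CompleteSpace E] [CompleteSpace F]
    {T : E →L[ℂ] E} (hT : IsSelfAdjoint T) {ψ : HilbertTensor E F}
    (h : opTensor T (1 : F →L[ℂ] F) ψ = 0) :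
    opTensor (T.ker.starProjection) (1 : F →L[ℂ] F) ψ = ψ := by
  refine HilbertTensor.ext_inner fun u v => ?_
  have key : ∀ w ∈ T.kerᗮ, ⟪vecTensor E F w v, ψ⟫_ℂ = 0 := by
    have hcl : IsClosed {w : E | ⟪vecTensor E F w v, ψ⟫_ℂ = 0} :=
      isClosed_eq (Continuous.inner ((vecTensor E F).flip v).continuous continuous_const)
        continuous_const
    intro w hw
    rw [ContinuousLinearMap.orthogonal_ker, ContinuousLinearMap.isSelfAdjoint_iff'.mp hT] at hw
    refine closure_minimal ?_ hcl hw
    rintro _ ⟨g, rfl⟩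
    have e : vecTensor E F (T g) v = opTensor T 1 (vecTensor E F g v) := by
      rw [opTensor_vecTensor]; rfl
    change ⟪vecTensor E F (T g) v, ψ⟫_ℂ = 0
    rw [e, ← ContinuousLinearMap.adjoint_inner_right,
      ContinuousLinearMap.isSelfAdjoint_iff'.mp (hT.opTensor (.one _)), h, inner_zero_right]
  have hQ : IsSelfAdjoint (T.ker.starProjection) := isSelfAdjoint_starProjection _
  rw [← ContinuousLinearMap.isSelfAdjoint_iff'.mp (hQ.opTensor (.one (F →L[ℂ] F))),
    ContinuousLinearMap.adjoint_inner_right, opTensor_vecTensor]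
  have h2 := key (u - T.ker.starProjection u) (Submodule.sub_starProjection_mem_orthogonal u)
  rw [map_sub, sub_apply, inner_sub_left, sub_eq_zero] at h2
  exact h2.symm

theorem opTensor_starProjection_ker_right [CompleteSpace E] [CompleteSpace F]
    {T : F →L[ℂ] F} (hT : IsSelfAdjoint T) {ψ : HilbertTensor E F}
    (h : opTensor (1 : E →L[ℂ] E) T ψ = 0) :
    opTensor (1 : E →L[ℂ] E) (T.ker.starProjection) ψ = ψ := by
  refine HilbertTensor.ext_inner fun u v => ?_
  have key : ∀ w ∈ T.kerᗮ, ⟪vecTensor E F u w, ψ⟫_ℂ = 0 := by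
    have hcl : IsClosed {w : F | ⟪vecTensor E F u w, ψ⟫_ℂ = 0} :=
      isClosed_eq (Continuous.inner (vecTensor E F u).continuous continuous_const) continuous_const
    intro w hw
    rw [ContinuousLinearMap.orthogonal_ker, ContinuousLinearMap.isSelfAdjoint_iff'.mp hT] at hw
    refine closure_minimal ?_ hcl hw
    rintro _ ⟨g, rfl⟩
    have e : vecTensor E F u (T g) = opTensor 1 T (vecTensor E F u g) := by
      rw [opTensor_vecTensor]; rfl
    change ⟪vecTensor E F u (T g), ψ⟫_ℂ = 0
    rw [e, ← ContinuousLinearMap.adjoint_inner_right,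
      ContinuousLinearMap.isSelfAdjoint_iff'.mp (IsSelfAdjoint.opTensor (.one _) hT), h,
      inner_zero_right]
  have hQ : IsSelfAdjoint (T.ker.starProjection) := isSelfAdjoint_starProjection _
  rw [← ContinuousLinearMap.isSelfAdjoint_iff'.mp (IsSelfAdjoint.opTensor (.one (E →L[ℂ] E)) hQ),
    ContinuousLinearMap.adjoint_inner_right, opTensor_vecTensor]
  have h2 := key (v - T.ker.starProjection v) (Submodule.sub_starProjection_mem_orthogonal v)
  rw [map_sub, inner_sub_left, sub_eq_zero] at h2
  exact h2.symm

end HilbertTensor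

/-! ### Adjoining a finite state to the junk -/

section Attach

variable {JA JB KA KB : Type*} [NormedAddCommGroup JA] [InnerProductSpace ℂ JA]
    [NormedAddCommGroup JB] [InnerProductSpace ℂ JB]
    [NormedAddCommGroup KA] [InnerProductSpace ℂ KA]
    [NormedAddCommGroup KB] [InnerProductSpace ℂ KB]

theorem attach_tmul_eq (k : KA) (l : KB) : attach JA JB (k ⊗ₜ[ℂ] l) =
    opTensor ((vecTensor JA KA).flip k) ((vecTensor JB KB).flip l) := by
  simp [attach]

theorem opTensor_one_comp_flip (M : KA →L[ℂ] KB) (k : KA) :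
    opTensor (1 : JA →L[ℂ] JA) M ∘L (vecTensor JA KA).flip k = (vecTensor JA KB).flip (M k) := by
  ext s
  rw [ContinuousLinearMap.comp_apply, ContinuousLinearMap.flip_apply, opTensor_vecTensor]
  rfl

theorem adjoint_flip_comp_flip [CompleteSpace JA] (k k' : KA) :
    ((vecTensor JA KA).flip k).adjoint ∘L (vecTensor JA KA).flip k' =
      ⟪k, k'⟫_ℂ • (1 : JA →L[ℂ] JA) := by
  ext s
  refine ext_inner_left ℂ fun v => ?_
  rw [ContinuousLinearMap.comp_apply, ContinuousLinearMap.adjoint_inner_right,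
    ContinuousLinearMap.flip_apply, ContinuousLinearMap.flip_apply, inner_vecTensor,
    smul_apply, one_apply_eq_self, inner_smul_right, mul_comm]

theorem TensorProduct.intertwine_of_tmul {G G' : Type*} [NormedAddCommGroup G] [NormedSpace ℂ G]
    [NormedAddCommGroup G'] [NormedSpace ℂ G'] (f : KA ⊗[ℂ] KB →ₗ[ℂ] (G →L[ℂ] G'))
    (T : G' →L[ℂ] G') (L : KA ⊗[ℂ] KB →L[ℂ] KA ⊗[ℂ] KB) (ς : G)
    (h : ∀ k l, T (f (k ⊗ₜ[ℂ] l) ς) = f (L (k ⊗ₜ[ℂ] l)) ς) (φ : KA ⊗[ℂ] KB) :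
    T (f φ ς) = f (L φ) ς := by
  induction φ using TensorProduct.induction_on with
  | zero => simp
  | tmul k l => exact h k l
  | add a b ha hb => simp only [map_add, add_apply, ha, hb]

theorem TensorProduct.inner_of_tmul {G G' : Type*} [NormedAddCommGroup G] [InnerProductSpace ℂ G]
    [NormedAddCommGroup G'] [InnerProductSpace ℂ G'] (f : KA ⊗[ℂ] KB →ₗ[ℂ] (G →L[ℂ] G')) (ς ς' : G)
    (h : ∀ k l k' l', ⟪f (k ⊗ₜ[ℂ] l) ς, f (k' ⊗ₜ[ℂ] l') ς'⟫_ℂ =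
      ⟪k ⊗ₜ[ℂ] l, k' ⊗ₜ[ℂ] l'⟫_ℂ * ⟪ς, ς'⟫_ℂ) (φ φ' : KA ⊗[ℂ] KB) :
    ⟪f φ ς, f φ' ς'⟫_ℂ = ⟪φ, φ'⟫_ℂ * ⟪ς, ς'⟫_ℂ := by
  induction φ using TensorProduct.induction_on with
  | zero => simp
  | add a b ha hb => simp only [map_add, add_apply, inner_add_left, ha, hb, add_mul]
  | tmul k l =>
    induction φ' using TensorProduct.induction_on with
    | zero => simp
    | add a b ha hb => simp only [map_add, add_apply, inner_add_right, ha, hb, add_mul]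
    | tmul k' l' => exact h k l k' l'

theorem opTensor_attach (M : KA →L[ℂ] KA) (N : KB →L[ℂ] KB) (φ : KA ⊗[ℂ] KB)
    (ς : HilbertTensor JA JB) :
    opTensor (opTensor (1 : JA →L[ℂ] JA) M) (opTensor (1 : JB →L[ℂ] JB) N) (attach JA JB φ ς) =
      attach JA JB (TensorProduct.mapL M N φ) ς := by
  refine TensorProduct.intertwine_of_tmul (attach JA JB) _ (TensorProduct.mapL M N) ς
    (fun k l => ?_) φ
  rw [attach_tmul_eq, opTensor_opTensor, opTensor_one_comp_flip, opTensor_one_comp_flip,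
    TensorProduct.mapL_tmul, attach_tmul_eq]

/-- For elementary tensors, the adjoint of s ↦ s ⊗ k composed with s ↦ s ⊗ k' is the scalar ⟨k, k'⟩.
Bilinearity does the rest. -/
theorem inner_attach [CompleteSpace JA] [CompleteSpace JB] (φ φ' : KA ⊗[ℂ] KB)
    (ς ς' : HilbertTensor JA JB) :
    ⟪attach JA JB φ ς, attach JA JB φ' ς'⟫_ℂ = ⟪φ, φ'⟫_ℂ * ⟪ς, ς'⟫_ℂ := by
  refine TensorProduct.inner_of_tmul (attach JA JB) ς ς' (fun k l k' l' => ?_) φ φ'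
  rw [attach_tmul_eq, attach_tmul_eq, ← ContinuousLinearMap.adjoint_inner_right,
    adjoint_opTensor, opTensor_opTensor, adjoint_flip_comp_flip, adjoint_flip_comp_flip,
    opTensor_smul_left, opTensor_smul_right, opTensor_one_one, smul_apply, smul_apply,
    one_apply_eq_self, inner_smul_right, inner_smul_right, TensorProduct.inner_tmul, mul_assoc]

end Attach

/-! ### Dilating two contractions to involutions -/

section Dilation

variable {H : Type u} [NormedAddCommGroup H] [InnerProductSpace ℂ H]

/-- The operator with block matrix `[[A, S], [S, -A]]` on `H ⊕ H`. -/
def blockOp (A S : H →L[ℂ] H) : WithLp 2 (H × H) →L[ℂ] WithLp 2 (H × H) :=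
  (WithLp.prodContinuousLinearEquiv 2 ℂ H H).symm.toContinuousLinearMap ∘L
    ((A ∘L .fst ℂ H H + S ∘L .snd ℂ H H).prod (S ∘L .fst ℂ H H - A ∘L .snd ℂ H H)) ∘L
    (WithLp.prodContinuousLinearEquiv 2 ℂ H H).toContinuousLinearMap

theorem blockOp_apply (A S : H →L[ℂ] H) (v : WithLp 2 (H × H)) :
    blockOp A S v = WithLp.toLp 2 (A v.fst + S v.snd, S v.fst - A v.snd) := rfl

/-- The inclusion of `H` as the first summand of `H ⊕ H`. -/
def inlIsometry (H : Type u) [NormedAddCommGroup H] [InnerProductSpace ℂ H] :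
    H →ₗᵢ[ℂ] WithLp 2 (H × H) where
  toFun h := WithLp.toLp 2 (h, 0)
  map_add' x y := by rw [← WithLp.toLp_add, Prod.mk_add_mk, add_zero]
  map_smul' c x := by rw [RingHom.id_apply, ← WithLp.toLp_smul, Prod.smul_mk, smul_zero]
  norm_map' h := by
    change ‖WithLp.toLp 2 (h, (0 : H))‖ = ‖h‖
    rw [WithLp.prod_norm_eq_of_L2]; simp

variable [CompleteSpace H]

theorem isSelfAdjoint_blockOp {A S : H →L[ℂ] H} (hA : IsSelfAdjoint A) (hS : IsSelfAdjoint S) :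
    IsSelfAdjoint (blockOp A S) := by
  rw [ContinuousLinearMap.isSelfAdjoint_iff_isSymmetric] at *
  intro x y
  have hA' : ∀ x y, ⟪A x, y⟫_ℂ = ⟪x, A y⟫_ℂ := hA
  have hS' : ∀ x y, ⟪S x, y⟫_ℂ = ⟪x, S y⟫_ℂ := hS
  change ⟪A x.fst + S x.snd, y.fst⟫_ℂ + ⟪S x.fst - A x.snd, y.snd⟫_ℂ =
    ⟪x.fst, A y.fst + S y.snd⟫_ℂ + ⟪x.snd, S y.fst - A y.snd⟫_ℂ
  simp only [inner_add_left, inner_add_right, inner_sub_left, inner_sub_right, hA', hS']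
  ring

theorem blockOp_mul_self {A S : H →L[ℂ] H} (hc : Commute A S) (h : A * A + S * S = 1) :
    blockOp A S * blockOp A S = 1 := by
  have h1 : ∀ x, A (A x) + S (S x) = x := DFunLike.congr_fun h
  have h2 : ∀ x, A (S x) = S (A x) := DFunLike.congr_fun hc.eq
  refine ContinuousLinearMap.ext fun v => congrArg (WithLp.toLp 2) (Prod.ext ?_ ?_)
  · change A (A v.fst + S v.snd) + S (S v.fst - A v.snd) = v.fst
    rw [map_add, map_sub, h2, add_add_sub_cancel, h1]
  · change S (A v.fst + S v.snd) - A (S v.fst - A v.snd) = v.snd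
    rw [map_add, map_sub, h2]
    exact (by abel : _ = A (A v.snd) + S (S v.snd)).trans (h1 _)

/-- Each contraction A is the corner of the Halmos block matrix with off-diagonal entry √(1 - A²).
Both observables use the same embedding into the first summand, so the pair is dilated at once and
nothing is required of their commutator. -/
theorem exists_involutive_dilation {A₀ A₁ : H →L[ℂ] H} (sA₀ : IsSelfAdjoint A₀)
    (sA₁ : IsSelfAdjoint A₁) (hA₀ : 0 ≤ 1 - A₀ * A₀) (hA₁ : 0 ≤ 1 - A₁ * A₁) :
    ∃ (D : Type u) (_ : NormedAddCommGroup D) (_ : InnerProductSpace ℂ D) (_ : CompleteSpace D)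
      (V : H →ₗᵢ[ℂ] D) (T₀ T₁ : D →L[ℂ] D), IsSelfAdjoint T₀ ∧ IsSelfAdjoint T₁ ∧
      T₀ * T₀ = 1 ∧ T₁ * T₁ = 1 ∧
      V.toContinuousLinearMap.adjoint ∘L T₀ ∘L V.toContinuousLinearMap = A₀ ∧
      V.toContinuousLinearMap.adjoint ∘L T₁ ∘L V.toContinuousLinearMap = A₁ := by
  have key : ∀ A : H →L[ℂ] H, IsSelfAdjoint A → 0 ≤ 1 - A * A →
      ∃ T : WithLp 2 (H × H) →L[ℂ] WithLp 2 (H × H), IsSelfAdjoint T ∧ T * T = 1 ∧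
        (inlIsometry H).toContinuousLinearMap.adjoint ∘L T ∘L
          (inlIsometry H).toContinuousLinearMap = A := by
    intro A hA h
    refine ⟨blockOp A (CFC.sqrt (1 - A * A)),
      isSelfAdjoint_blockOp hA (.of_nonneg (CFC.sqrt_nonneg _)), blockOp_mul_self ?_ ?_, ?_⟩
    · rw [CFC.sqrt_eq_real_sqrt (1 - A * A)]
      have : Commute (1 - A * A) A :=
        (Commute.one_left A).sub_left ((Commute.refl A).mul_left (.refl A))
      exact (Commute.cfcₙ_real this _).symm
    · rw [CFC.sqrt_mul_sqrt_self _ h, add_sub_cancel]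
    · ext x
      refine ext_inner_left ℂ fun v => ?_
      rw [ContinuousLinearMap.comp_apply, ContinuousLinearMap.adjoint_inner_right,
        ContinuousLinearMap.comp_apply, blockOp_apply]
      change ⟪WithLp.toLp 2 (v, (0 : H)), WithLp.toLp 2 (A x + _, _)⟫_ℂ = _
      rw [WithLp.prod_inner_apply]
      simp [inlIsometry]
  obtain ⟨T₀, s0, i0, c0⟩ := key A₀ sA₀ hA₀
  obtain ⟨T₁, s1, i1, c1⟩ := key A₁ sA₁ hA₁
  exact ⟨WithLp 2 (H × H), inferInstance, inferInstance, inferInstance, inlIsometry H, T₀, T₁,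
    s0, s1, i0, i1, c0, c1⟩

end Dilation

/-! ### The local swap isometry -/

section SwapIsometry

variable {H : Type*} [NormedAddCommGroup H] [InnerProductSpace ℂ H] [CompleteSpace H]

/-- The eigenspace of `cosOp A₀ A₁` for the eigenvalue `γ`. -/
def angleSpace (A₀ A₁ : H →L[ℂ] H) (γ : ℝ) : Submodule ℂ H :=
  (cosOp A₀ A₁ - (γ : ℂ) • (1 : H →L[ℂ] H)).ker

theorem mem_angleSpace {A₀ A₁ : H →L[ℂ] H} {γ : ℝ} {v : H} :
    v ∈ angleSpace A₀ A₁ γ ↔ cosOp A₀ A₁ v = (γ : ℂ) • v := by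
  rw [angleSpace, LinearMap.mem_ker]
  exact sub_eq_zero

instance (A₀ A₁ : H →L[ℂ] H) (γ : ℝ) : CompleteSpace (angleSpace A₀ A₁ γ) :=
  (ContinuousLinearMap.isClosed_ker _).completeSpace_coe

theorem map_mem_angleSpace {A₀ A₁ T : H →L[ℂ] H} {γ : ℝ} (h : Commute T (cosOp A₀ A₁)) {v : H}
    (hv : v ∈ angleSpace A₀ A₁ γ) : T v ∈ angleSpace A₀ A₁ γ := by
  rw [mem_angleSpace] at *
  rw [← map_smul, ← hv]
  exact (DFunLike.congr_fun h.eq v).symm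

/-- The swap map: on the eigenspace of `cosOp A₀ A₁` it extracts the qubit on which `A₀`, `A₁` act,
elsewhere it adjoins `|0⟩`. -/
def swapMap (A₀ A₁ : H →L[ℂ] H) (γ s : ℝ) : H →L[ℂ] HilbertTensor H Qubit :=
  (vecTensor H Qubit).flip (ket 0) ∘L
      (1 - (angleSpace A₀ A₁ γ).starProjection +
        ((1 / 2 : ℂ) • (1 + A₀)) * (angleSpace A₀ A₁ γ).starProjection) +
    (vecTensor H Qubit).flip (ket 1) ∘L
      (((s⁻¹ : ℝ) : ℂ) • offDiag A₀ A₁ * ((1 / 2 : ℂ) • (1 - A₀)) *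
        (angleSpace A₀ A₁ γ).starProjection)

theorem inner_ket (i j : Fin 2) : ⟪ket i, ket j⟫_ℂ = if i = j then 1 else 0 := by
  simp [ket, EuclideanSpace.inner_single_left]

theorem swapMap_apply (A₀ A₁ : H →L[ℂ] H) (γ s : ℝ) (h : H) {v : H}
    (hv : v = (angleSpace A₀ A₁ γ).starProjection h) :
    swapMap A₀ A₁ γ s h = vecTensor H Qubit (h - v + (1 / 2 : ℂ) • (v + A₀ v)) (ket 0) +
      vecTensor H Qubit (((s⁻¹ : ℝ) : ℂ) • offDiag A₀ A₁ ((1 / 2 : ℂ) • (v - A₀ v))) (ket 1) := by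
  rw [hv]; rfl

theorem swapMap_apply_mem (A₀ A₁ : H →L[ℂ] H) (γ s : ℝ) {v : H} (hv : v ∈ angleSpace A₀ A₁ γ) :
    swapMap A₀ A₁ γ s v = vecTensor H Qubit ((1 / 2 : ℂ) • (v + A₀ v)) (ket 0) +
      vecTensor H Qubit (((s⁻¹ : ℝ) : ℂ) • offDiag A₀ A₁ ((1 / 2 : ℂ) • (v - A₀ v))) (ket 1) := by
  rw [swapMap_apply A₀ A₁ γ s v (v := v) (Submodule.starProjection_eq_self_iff.mpr hv).symm,
    sub_self, zero_add]

variable {A₀ A₁ : H →L[ℂ] H} {γ s : ℝ}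

theorem offDiag_offDiag_of_mem (iA₀ : A₀ * A₀ = 1) (iA₁ : A₁ * A₁ = 1) (hs : s ^ 2 = 1 - γ ^ 2)
    {v : H} (hv : v ∈ angleSpace A₀ A₁ γ) :
    offDiag A₀ A₁ (offDiag A₀ A₁ v) = ((s ^ 2 : ℝ) : ℂ) • v := by
  have h := DFunLike.congr_fun (offDiag_sq iA₀ iA₁) v
  change offDiag A₀ A₁ (offDiag A₀ A₁ v) = v - cosOp A₀ A₁ (cosOp A₀ A₁ v) at h
  rw [h, mem_angleSpace.mp hv, map_smul, mem_angleSpace.mp hv, hs]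
  push_cast
  module

/-- On the eigenspace X² = s², so X/s preserves norms and the two branches (1 ± A₀)v/2 have total
norm ‖v‖. The complementary part of h is orthogonal to v and to A₀v, since A₀ preserves the
eigenspace, so placing it in the |0⟩ slot creates no cross term. -/
theorem norm_swapMap (sA₀ : IsSelfAdjoint A₀) (sA₁ : IsSelfAdjoint A₁) (iA₀ : A₀ * A₀ = 1)
    (iA₁ : A₁ * A₁ = 1) (hs : s ^ 2 = 1 - γ ^ 2) (hs0 : s ≠ 0) (h : H) :
    ‖swapMap A₀ A₁ γ s h‖ = ‖h‖ := by
  obtain ⟨v, hv⟩ : ∃ v, v = (angleSpace A₀ A₁ γ).starProjection h := ⟨_, rfl⟩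
  have hvm : v ∈ angleSpace A₀ A₁ γ := hv ▸ Submodule.starProjection_apply_mem _ h
  have hw : h - v ∈ (angleSpace A₀ A₁ γ)ᗮ := hv ▸ Submodule.sub_starProjection_mem_orthogonal h
  obtain ⟨w, hwe⟩ : ∃ w, w = h - v := ⟨_, rfl⟩
  rw [← hwe] at hw
  have hAv : A₀ v ∈ angleSpace A₀ A₁ γ := map_mem_angleSpace (commute_cosOp_left iA₀) hvm
  have o1 : ⟪v, w⟫_ℂ = 0 := hw v hvm
  have o2 : ⟪A₀ v, w⟫_ℂ = 0 := hw _ hAv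
  have o1' : ⟪w, v⟫_ℂ = 0 := inner_eq_zero_symm.mp o1
  have o2' : ⟪w, A₀ v⟫_ℂ = 0 := inner_eq_zero_symm.mp o2
  have hA : ∀ x y, ⟪A₀ x, y⟫_ℂ = ⟪x, A₀ y⟫_ℂ :=
    ContinuousLinearMap.isSelfAdjoint_iff_isSymmetric.mp sA₀
  have hX : ∀ x y, ⟪offDiag A₀ A₁ x, y⟫_ℂ = ⟪x, offDiag A₀ A₁ y⟫_ℂ :=
    ContinuousLinearMap.isSelfAdjoint_iff_isSymmetric.mp (isSelfAdjoint_offDiag sA₀ sA₁ iA₀)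
  have hAA : A₀ (A₀ v) = v := DFunLike.congr_fun iA₀ v
  obtain ⟨y, hy⟩ : ∃ y, y = (1 / 2 : ℂ) • (v - A₀ v) := ⟨_, rfl⟩
  have hym : y ∈ angleSpace A₀ A₁ γ :=
    hy ▸ Submodule.smul_mem _ _ (Submodule.sub_mem _ hvm hAv)
  have hhalf : (starRingEnd ℂ) (1 / 2) = 1 / 2 := by
    rw [map_div₀, map_one, map_ofNat]
  have hy2 : ⟪((s⁻¹ : ℝ) : ℂ) • offDiag A₀ A₁ y, ((s⁻¹ : ℝ) : ℂ) • offDiag A₀ A₁ y⟫_ℂ =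
      ⟪y, y⟫_ℂ := by
    rw [inner_smul_left, inner_smul_right, hX, offDiag_offDiag_of_mem iA₀ iA₁ hs hym,
      inner_smul_right, Complex.conj_ofReal, ← mul_assoc, ← mul_assoc, ← Complex.ofReal_mul,
      ← Complex.ofReal_mul]
    have : s⁻¹ * s⁻¹ * s ^ 2 = 1 := by field_simp
    rw [this]; simp
  have hh : h = w + v := by rw [hwe]; abel
  have key : ⟪swapMap A₀ A₁ γ s h, swapMap A₀ A₁ γ s h⟫_ℂ = ⟪h, h⟫_ℂ := by
    rw [swapMap_apply A₀ A₁ γ s h hv, ← hwe, ← hy, inner_add_left, inner_add_right,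
      inner_add_right]
    simp only [inner_vecTensor, inner_ket]
    rw [hy2, hy, hh]
    simp only [inner_add_left, inner_add_right, inner_sub_left, inner_sub_right, inner_smul_left,
      inner_smul_right, hA, hAA, o1, o1', o2', hhalf]
    rw [← hA v w, o2]
    simp
    ring
  rw [← sq_eq_sq₀ (norm_nonneg _) (norm_nonneg _), ← inner_self_eq_norm_sq (𝕜 := ℂ),
    ← inner_self_eq_norm_sq (𝕜 := ℂ), key]

/-- The swap map as a linear isometry. -/
def swapIsometry (sA₀ : IsSelfAdjoint A₀) (sA₁ : IsSelfAdjoint A₁) (iA₀ : A₀ * A₀ = 1)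
    (iA₁ : A₁ * A₁ = 1) (hs : s ^ 2 = 1 - γ ^ 2) (hs0 : s ≠ 0) :
    H →ₗᵢ[ℂ] HilbertTensor H Qubit where
  toLinearMap := (swapMap A₀ A₁ γ s).toLinearMap
  norm_map' := norm_swapMap sA₀ sA₁ iA₀ iA₁ hs hs0

theorem pauliZ_ket_zero : pauliZ (ket 0) = ket 0 := by
  ext i; fin_cases i <;> simp [pauliZ, ket, EuclideanSpace.single]

theorem pauliZ_ket_one : pauliZ (ket 1) = -ket 1 := by
  ext i; fin_cases i <;> simp [pauliZ, ket, EuclideanSpace.single]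

theorem pauliX_ket_zero : pauliX (ket 0) = ket 1 := by
  ext i; fin_cases i <;> simp [pauliX, ket, EuclideanSpace.single]

theorem pauliX_ket_one : pauliX (ket 1) = ket 0 := by
  ext i; fin_cases i <;> simp [pauliX, ket, EuclideanSpace.single]

/-- On the eigenspace A₁ = γA₀ + X, with γ = cos α. The swap turns A₀ into σ_z, and it turns X into
s σ_x because X exchanges the eigenspaces of A₀ and X² = s². -/
theorem swapMap_observable (iA₀ : A₀ * A₀ = 1) (iA₁ : A₁ * A₁ = 1) {α : ℝ}
    (hγ : γ = Real.cos α) (hs : s = Real.sin α) (hs0 : s ≠ 0) {v : H}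
    (hv : v ∈ angleSpace A₀ A₁ γ) (x : Fin 2) :
    swapMap A₀ A₁ γ s ((![A₀, A₁] : Fin 2 → (H →L[ℂ] H)) x v) =
      opTensor 1 (refObservable α x) (swapMap A₀ A₁ γ s v) := by
  have hAA : ∀ v, A₀ (A₀ v) = v := DFunLike.congr_fun iA₀
  have hs2 : s ^ 2 = 1 - γ ^ 2 := by rw [hs, hγ]; linarith [Real.sin_sq_add_cos_sq α]
  have hXX := offDiag_offDiag_of_mem iA₀ iA₁ hs2 hv
  have hAX : ∀ v, A₀ (offDiag A₀ A₁ v) = -offDiag A₀ A₁ (A₀ v) :=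
    DFunLike.congr_fun (offDiag_anticomm (A₁ := A₁) iA₀)
  have h0 := map_mem_angleSpace (commute_cosOp_left iA₀) hv
  have h1 := map_mem_angleSpace (commute_cosOp_right iA₁) hv
  have hA1 : A₁ v = offDiag A₀ A₁ v + (γ : ℂ) • A₀ v := by
    rw [← mem_angleSpace.mp h0]
    exact (sub_add_cancel (A₁ v) (cosOp A₀ A₁ (A₀ v))).symm
  have hXX0 := offDiag_offDiag_of_mem iA₀ iA₁ hs2 h0
  have hss : (s : ℂ) ≠ 0 := Complex.ofReal_ne_zero.mpr hs0
  have one_apply : ∀ w : H, (1 : H →L[ℂ] H) w = w := fun _ => rfl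
  fin_cases x
  · change swapMap A₀ A₁ γ s (A₀ v) = opTensor 1 pauliZ _
    rw [swapMap_apply_mem _ _ _ _ hv, swapMap_apply_mem _ _ _ _ h0, hAA, map_add,
      opTensor_vecTensor, opTensor_vecTensor, pauliZ_ket_zero, pauliZ_ket_one, one_apply, one_apply,
      map_neg, ← neg_sub v, smul_neg, map_neg, smul_neg, map_neg, neg_apply, add_comm v]
  · change swapMap A₀ A₁ γ s (A₁ v) = opTensor 1
      ((Real.cos α : ℂ) • pauliZ + (Real.sin α : ℂ) • pauliX) _
    rw [swapMap_apply_mem _ _ _ _ hv, swapMap_apply_mem _ _ _ _ h1, hA1, map_add (opTensor _ _),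
      opTensor_vecTensor, opTensor_vecTensor]
    simp only [add_apply, smul_apply, pauliZ_ket_zero, pauliZ_ket_one, pauliX_ket_zero,
      pauliX_ket_one, one_apply, map_add, map_smul, map_sub, map_neg, sub_apply, hAA, hAX, hXX,
      hXX0, neg_apply, smul_neg, ← hγ, ← hs]
    push_cast
    match_scalars <;> field_simp

end SwapIsometry

/-! ### The swap on the state, branch by branch -/

section ProjectiveEquivalence

/-- The measurement operator `(1 + (-1)^a A) / 2` of outcome `a` of an observable `A`. -/
def outcomeOp {E : Type*} [NormedAddCommGroup E] [InnerProductSpace ℂ E] (A : E →L[ℂ] E)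
    (a : Fin 2) : E →L[ℂ] E := (1 / 2 : ℂ) • (1 + (-1 : ℂ) ^ (a : ℕ) • A)

variable {E F : Type*} [NormedAddCommGroup E] [InnerProductSpace ℂ E]
    [NormedAddCommGroup F] [InnerProductSpace ℂ F]

theorem refMeasurement_eq (α : ℝ) (x a : Fin 2) :
    refMeasurement α x a = outcomeOp (refObservable α x) a := rfl

theorem opTensor_one_mul_left (S T : E →L[ℂ] E) :
    opTensor (S * T) (1 : F →L[ℂ] F) = opTensor S 1 * opTensor T 1 := by
  rw [← opTensor_mul, one_mul]

theorem opTensor_one_mul_right (S T : F →L[ℂ] F) :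
    opTensor (1 : E →L[ℂ] E) (S * T) = opTensor 1 S * opTensor 1 T := by
  rw [← opTensor_mul, one_mul]

theorem commute_opTensor (S : E →L[ℂ] E) (T : F →L[ℂ] F) :
    Commute (opTensor S (1 : F →L[ℂ] F)) (opTensor (1 : E →L[ℂ] E) T) := by
  rw [Commute, SemiconjBy, ← opTensor_mul, ← opTensor_mul, one_mul, one_mul, mul_one, mul_one]

theorem opTensor_eq_mul (S : E →L[ℂ] E) (T : F →L[ℂ] F) :
    opTensor S T = opTensor S 1 * opTensor 1 T := by
  rw [← opTensor_mul, one_mul, mul_one]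

theorem cosOp_opTensor_left (A₀ A₁ : E →L[ℂ] E) :
    cosOp (opTensor A₀ (1 : F →L[ℂ] F)) (opTensor A₁ 1) = opTensor (cosOp A₀ A₁) 1 := by
  rw [cosOp, cosOp, opTensor_smul_left, opTensor_add_left, opTensor_one_mul_left,
    opTensor_one_mul_left]

theorem cosOp_opTensor_right (B₀ B₁ : F →L[ℂ] F) :
    cosOp (opTensor (1 : E →L[ℂ] E) B₀) (opTensor 1 B₁) = opTensor 1 (cosOp B₀ B₁) := by
  rw [cosOp, cosOp, opTensor_smul_right, opTensor_add_right, opTensor_one_mul_right,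
    opTensor_one_mul_right]

theorem offDiag_opTensor_left (A₀ A₁ : E →L[ℂ] E) :
    offDiag (opTensor A₀ (1 : F →L[ℂ] F)) (opTensor A₁ 1) = opTensor (offDiag A₀ A₁) 1 := by
  rw [offDiag, offDiag, opTensor_sub_left, cosOp_opTensor_left, opTensor_one_mul_left]

theorem offDiag_opTensor_right (B₀ B₁ : F →L[ℂ] F) :
    offDiag (opTensor (1 : E →L[ℂ] E) B₀) (opTensor 1 B₁) = opTensor 1 (offDiag B₀ B₁) := by
  rw [offDiag, offDiag, opTensor_sub_right, cosOp_opTensor_right, opTensor_one_mul_right]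

/-- The qubit-extracting part of `swapMap`, without the projection to the eigenspace. -/
def swapCore (A₀ A₁ : E →L[ℂ] E) (s : ℝ) : E →L[ℂ] HilbertTensor E Qubit :=
  (vecTensor E Qubit).flip (ket 0) ∘L ((1 / 2 : ℂ) • (1 + A₀)) +
    (vecTensor E Qubit).flip (ket 1) ∘L
      (((s⁻¹ : ℝ) : ℂ) • (offDiag A₀ A₁ * ((1 / 2 : ℂ) • (1 - A₀))))

theorem refState_eq (θ α : ℝ) : (refStrategy θ α).state =
    (((Real.sin θ / √2 : ℝ) : ℂ) • ket 0) ⊗ₜ[ℂ] ket 1 +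
      (((Real.sin θ / √2 : ℝ) : ℂ) • ket 1) ⊗ₜ[ℂ] ket 0 +
        ((Real.cos θ : ℂ) • ket 1) ⊗ₜ[ℂ] ket 1 := by
  simp only [refStrategy, smul_add, TensorProduct.smul_tmul']

theorem norm_refState (θ α : ℝ) : ⟪(refStrategy θ α).state, (refStrategy θ α).state⟫_ℂ = 1 := by
  have h2 : (((Real.sin θ / √2 : ℝ) : ℂ)) * ((Real.sin θ / √2 : ℝ) : ℂ) =
      ((Real.sin θ ^ 2 / 2 : ℝ) : ℂ) := by
    rw [← Complex.ofReal_mul, div_mul_div_comm, Real.mul_self_sqrt (by norm_num), sq]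
  have hsc : ((Real.sin θ : ℝ) : ℂ) ^ 2 + ((Real.cos θ : ℝ) : ℂ) ^ 2 = 1 := by
    exact_mod_cast Real.sin_sq_add_cos_sq θ
  push_cast at hsc
  simp only [refState_eq, inner_add_left, inner_add_right, inner_smul_left, inner_smul_right,
    TensorProduct.inner_tmul, inner_ket, Complex.conj_ofReal]
  simp only [zero_ne_one, one_ne_zero, if_true, if_false, mul_zero, mul_one, add_zero,
    zero_add, h2]
  push_cast
  linear_combination hsc

theorem opTensor_comp_add_comp {E' F' : Type*} [NormedAddCommGroup E'] [InnerProductSpace ℂ E']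
    [NormedAddCommGroup F'] [InnerProductSpace ℂ F'] (j₀ j₁ : E →L[ℂ] E') (k₀ k₁ : F →L[ℂ] F')
    {S₀ S₁ : E →L[ℂ] E} {T₀ T₁ : F →L[ℂ] F} {ψ v₀₁ v₁₀ v₁₁ : HilbertTensor E F}
    (h00 : opTensor S₀ T₀ ψ = 0) (h01 : opTensor S₀ T₁ ψ = v₀₁) (h10 : opTensor S₁ T₀ ψ = v₁₀)
    (h11 : opTensor S₁ T₁ ψ = v₁₁) :
    opTensor (j₀ ∘L S₀ + j₁ ∘L S₁) (k₀ ∘L T₀ + k₁ ∘L T₁) ψ =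
      opTensor j₀ k₁ v₀₁ + opTensor j₁ k₀ v₁₀ + opTensor j₁ k₁ v₁₁ := by
  simp only [opTensor_add_left, opTensor_add_right, ← opTensor_comp, add_apply,
    ContinuousLinearMap.comp_apply, h00, h01, h10, h11, map_zero]
  abel

theorem map_refState_apply {G G' : Type*} [NormedAddCommGroup G] [NormedSpace ℂ G]
    [NormedAddCommGroup G'] [NormedSpace ℂ G'] (f : Qubit ⊗[ℂ] Qubit →ₗ[ℂ] (G →L[ℂ] G'))
    (g : Qubit → Qubit → (G →L[ℂ] G')) (hf : ∀ k l, f (k ⊗ₜ[ℂ] l) = g k l) (θ α : ℝ) (v : G) :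
    f (refStrategy θ α).state v = g (ket 0) (ket 1) (((Real.sin θ / √2 : ℝ) : ℂ) • v) +
      g (ket 1) (ket 0) (((Real.sin θ / √2 : ℝ) : ℂ) • v) +
        g (ket 1) (ket 1) ((Real.cos θ : ℂ) • v) := by
  rw [refStrategy]
  simp only [map_add, map_smul, add_apply, smul_apply, smul_add, hf]

theorem opTensor_swapCore (A₀ A₁ : E →L[ℂ] E) (B₀ B₁ : F →L[ℂ] F) (s θ α : ℝ)
    (ψ ς : HilbertTensor E F)
    (h00 : opTensor ((1 / 2 : ℂ) • (1 + A₀)) ((1 / 2 : ℂ) • (1 + B₀)) ψ = 0)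
    (h01 : opTensor ((1 / 2 : ℂ) • (1 + A₀))
      (((s⁻¹ : ℝ) : ℂ) • (offDiag B₀ B₁ * ((1 / 2 : ℂ) • (1 - B₀)))) ψ =
        ((Real.sin θ / √2 : ℝ) : ℂ) • ς)
    (h10 : opTensor (((s⁻¹ : ℝ) : ℂ) • (offDiag A₀ A₁ * ((1 / 2 : ℂ) • (1 - A₀))))
      ((1 / 2 : ℂ) • (1 + B₀)) ψ = ((Real.sin θ / √2 : ℝ) : ℂ) • ς)
    (h11 : opTensor (((s⁻¹ : ℝ) : ℂ) • (offDiag A₀ A₁ * ((1 / 2 : ℂ) • (1 - A₀))))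
      (((s⁻¹ : ℝ) : ℂ) • (offDiag B₀ B₁ * ((1 / 2 : ℂ) • (1 - B₀)))) ψ = (Real.cos θ : ℂ) • ς) :
    opTensor (swapCore A₀ A₁ s) (swapCore B₀ B₁ s) ψ =
      attach E F (refStrategy θ α).state ς :=
  (opTensor_comp_add_comp _ _ _ _ h00 h01 h10 h11).trans
    (map_refState_apply (attach E F)
      (fun k l => opTensor ((vecTensor E Qubit).flip k) ((vecTensor F Qubit).flip l))
      attach_tmul_eq θ α ς).symm

end ProjectiveEquivalence

/-! ### Self-testing for involutive observables -/

section ProjectiveSelfTest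

variable {E F : Type*} [NormedAddCommGroup E] [InnerProductSpace ℂ E] [CompleteSpace E]
    [NormedAddCommGroup F] [InnerProductSpace ℂ F] [CompleteSpace F]

theorem swapMap_comp_starProjection (A₀ A₁ : E →L[ℂ] E) (γ s : ℝ) :
    swapMap A₀ A₁ γ s ∘L (angleSpace A₀ A₁ γ).starProjection =
      swapCore A₀ A₁ s ∘L (angleSpace A₀ A₁ γ).starProjection := by
  refine ContinuousLinearMap.ext fun h => ?_
  rw [ContinuousLinearMap.comp_apply, ContinuousLinearMap.comp_apply,
    swapMap_apply_mem _ _ _ _ (Submodule.starProjection_apply_mem _ h)]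
  rfl

theorem opTensor_one_outcomeOp (A : F →L[ℂ] F) (a : Fin 2) (ξ : HilbertTensor E F) :
    opTensor (1 : E →L[ℂ] E) (outcomeOp A a) ξ =
      (1 / 2 : ℂ) • (ξ + (-1 : ℂ) ^ (a : ℕ) • opTensor 1 A ξ) := by
  rw [outcomeOp, opTensor_smul_right, opTensor_add_right, opTensor_smul_right, opTensor_one_one]
  rfl

theorem swapMap_outcomeOp {A₀ A₁ : E →L[ℂ] E} {γ s α : ℝ} (iA₀ : A₀ * A₀ = 1) (iA₁ : A₁ * A₁ = 1)
    (hγ : γ = Real.cos α) (hs : s = Real.sin α) (hs0 : s ≠ 0) (x a : Fin 2) :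
    swapMap A₀ A₁ γ s ∘L outcomeOp ((![A₀, A₁] : Fin 2 → (E →L[ℂ] E)) x) a ∘L
        (angleSpace A₀ A₁ γ).starProjection =
      opTensor 1 (refMeasurement α x a) ∘L swapMap A₀ A₁ γ s ∘L
        (angleSpace A₀ A₁ γ).starProjection := by
  refine ContinuousLinearMap.ext fun h => ?_
  simp only [ContinuousLinearMap.comp_apply]
  generalize hv : (angleSpace A₀ A₁ γ).starProjection h = v
  have hvm : v ∈ angleSpace A₀ A₁ γ := hv ▸ Submodule.starProjection_apply_mem _ h
  rw [refMeasurement_eq, opTensor_one_outcomeOp,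
    ← swapMap_observable iA₀ iA₁ hγ hs hs0 hvm x, ← map_smul, ← map_add, ← map_smul]
  rfl

theorem starProjection_angleSpace_left {A₀ A₁ : E →L[ℂ] E} {γ : ℝ} (sA₀ : IsSelfAdjoint A₀)
    (sA₁ : IsSelfAdjoint A₁) {ψ : HilbertTensor E F}
    (h : opTensor (cosOp A₀ A₁) (1 : F →L[ℂ] F) ψ = (γ : ℂ) • ψ) :
    opTensor (angleSpace A₀ A₁ γ).starProjection (1 : F →L[ℂ] F) ψ = ψ := by
  have hs : IsSelfAdjoint ((γ : ℂ) • (1 : E →L[ℂ] E)) := by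
    rw [IsSelfAdjoint, star_smul, star_one]; simp
  refine opTensor_starProjection_ker_left ((isSelfAdjoint_cosOp sA₀ sA₁).sub hs) ?_
  rw [opTensor_sub_left, opTensor_smul_left, opTensor_one_one, sub_apply, h, smul_apply,
    one_apply_eq_self, sub_self]

theorem starProjection_angleSpace_right {B₀ B₁ : F →L[ℂ] F} {γ : ℝ} (sB₀ : IsSelfAdjoint B₀)
    (sB₁ : IsSelfAdjoint B₁) {ψ : HilbertTensor E F}
    (h : opTensor (1 : E →L[ℂ] E) (cosOp B₀ B₁) ψ = (γ : ℂ) • ψ) :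
    opTensor (1 : E →L[ℂ] E) (angleSpace B₀ B₁ γ).starProjection ψ = ψ := by
  have hs : IsSelfAdjoint ((γ : ℂ) • (1 : F →L[ℂ] F)) := by
    rw [IsSelfAdjoint, star_smul, star_one]; simp
  refine opTensor_starProjection_ker_right ((isSelfAdjoint_cosOp sB₀ sB₁).sub hs) ?_
  rw [opTensor_sub_right, opTensor_smul_right, opTensor_one_one, sub_apply, h, smul_apply,
    one_apply_eq_self, sub_self]

theorem opTensor_eq_of_comp_projection {G G' : Type*} [NormedAddCommGroup G]
    [InnerProductSpace ℂ G] [NormedAddCommGroup G'] [InnerProductSpace ℂ G']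
    {Φ U : E →L[ℂ] G} {Φ' U' : F →L[ℂ] G'} {P : E →L[ℂ] E} {P' : F →L[ℂ] F}
    {ψ : HilbertTensor E F} {w : HilbertTensor G G'} (hψ : opTensor P P' ψ = ψ)
    (h : Φ ∘L P = U ∘L P) (h' : Φ' ∘L P' = U' ∘L P') (hw : opTensor U U' ψ = w) :
    opTensor Φ Φ' ψ = w := by
  rw [← hw, ← hψ, opTensor_opTensor, opTensor_opTensor, h, h']

theorem opTensor_intertwine {G G' : Type*} [NormedAddCommGroup G]
    [InnerProductSpace ℂ G] [NormedAddCommGroup G'] [InnerProductSpace ℂ G']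
    {Φ : E →L[ℂ] G} {Φ' : F →L[ℂ] G'} {P M : E →L[ℂ] E} {P' M' : F →L[ℂ] F}
    {O : G →L[ℂ] G} {O' : G' →L[ℂ] G'}
    {ψ : HilbertTensor E F} {w : HilbertTensor G G'} (hψ : opTensor P P' ψ = ψ)
    (h : Φ ∘L M ∘L P = O ∘L Φ ∘L P) (h' : Φ' ∘L M' ∘L P' = O' ∘L Φ' ∘L P')
    (hw : opTensor Φ Φ' ψ = w) :
    opTensor Φ Φ' (opTensor M M' ψ) = opTensor O O' w := by
  rw [← hw, ← hψ]
  simp only [opTensor_opTensor]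
  rw [h, h']

theorem norm_eq_one_of_inner_eq {G G' : Type*} [NormedAddCommGroup G]
    [InnerProductSpace ℂ G] [NormedAddCommGroup G'] [InnerProductSpace ℂ G'] {v : G} {w : G'}
    (h : ⟪v, v⟫_ℂ = ⟪w, w⟫_ℂ) (hw : ‖w‖ = 1) : ‖v‖ = 1 := by
  rw [inner_self_eq_norm_sq_to_K, inner_self_eq_norm_sq_to_K, hw] at h
  have h5 : ‖v‖ ^ 2 = (1 : ℝ) ^ 2 := by exact_mod_cast h
  exact (sq_eq_sq₀ (norm_nonneg _) zero_le_one).mp h5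

theorem opTensor_swapMap_eq_attach {A₀ A₁ : E →L[ℂ] E} {B₀ B₁ : F →L[ℂ] F} {γ s θ α : ℝ}
    (iA₀ : A₀ * A₀ = 1) (iA₁ : A₁ * A₁ = 1) (iB₀ : B₀ * B₀ = 1) (iB₁ : B₁ * B₁ = 1)
    (hγ : γ = Real.cos α) (hs : s = Real.sin α) (hs0 : s ≠ 0) {ψ ς : HilbertTensor E F}
    (hA : opTensor (angleSpace A₀ A₁ γ).starProjection (1 : F →L[ℂ] F) ψ = ψ)
    (hB : opTensor (1 : E →L[ℂ] E) (angleSpace B₀ B₁ γ).starProjection ψ = ψ)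
    (hc : opTensor (swapCore A₀ A₁ s) (swapCore B₀ B₁ s) ψ =
      attach E F (refStrategy θ α).state ς) :
    opTensor (swapMap A₀ A₁ γ s) (swapMap B₀ B₁ γ s) ψ = attach E F (refStrategy θ α).state ς ∧
    ∀ a b x y, opTensor (swapMap A₀ A₁ γ s) (swapMap B₀ B₁ γ s)
      (opTensor (outcomeOp ((![A₀, A₁] : Fin 2 → (E →L[ℂ] E)) x) a)
        (outcomeOp ((![B₀, B₁] : Fin 2 → (F →L[ℂ] F)) y) b) ψ) =
      attach E F (TensorProduct.mapL (refMeasurement α x a) (refMeasurement α y b)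
        (refStrategy θ α).state) ς := by
  have hAB : opTensor (angleSpace A₀ A₁ γ).starProjection (angleSpace B₀ B₁ γ).starProjection ψ =
      ψ := by
    rw [opTensor_eq_mul]
    change opTensor _ _ (opTensor _ _ ψ) = ψ
    rw [hB, hA]
  have h1 := opTensor_eq_of_comp_projection hAB (swapMap_comp_starProjection A₀ A₁ γ s)
    (swapMap_comp_starProjection B₀ B₁ γ s) hc
  exact ⟨h1, fun a b x y => (opTensor_intertwine hAB (swapMap_outcomeOp iA₀ iA₁ hγ hs hs0 x a)
    (swapMap_outcomeOp iB₀ iB₁ hγ hs hs0 y b) h1).trans (opTensor_attach _ _ _ _)⟩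

/-- The branches 01, 10, 11 of the swapped state are s⁻¹Yx, s⁻¹Xy and s⁻²XYz, and the branch 00 is
empty. Substituting x = κXz and y = κYz makes all three multiples of the single vector XYz, in the
ratio κs : κs : 1, which are the amplitudes of the reference state. -/
theorem exists_opTensor_swapCore_eq_attach {A₀ A₁ : E →L[ℂ] E} {B₀ B₁ : F →L[ℂ] F} {s θ κ : ℝ}
    (α : ℝ) (hs0 : s ≠ 0) (hθ : Real.cos θ ≠ 0) (hκ : Real.sin θ / √2 = κ * s * Real.cos θ)
    {x y z : HilbertTensor E F}
    (hAx : opTensor A₀ (1 : F →L[ℂ] F) x = x) (hBx : opTensor (1 : E →L[ℂ] E) B₀ x = -x)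
    (hAy : opTensor A₀ (1 : F →L[ℂ] F) y = -y) (hBy : opTensor (1 : E →L[ℂ] E) B₀ y = y)
    (hAz : opTensor A₀ (1 : F →L[ℂ] F) z = -z) (hBz : opTensor (1 : E →L[ℂ] E) B₀ z = -z)
    (hx : x = (κ : ℂ) • opTensor (offDiag A₀ A₁) (1 : F →L[ℂ] F) z)
    (hy : y = (κ : ℂ) • opTensor (1 : E →L[ℂ] E) (offDiag B₀ B₁) z) :
    ∃ ς : HilbertTensor E F, opTensor (swapCore A₀ A₁ s) (swapCore B₀ B₁ s) (x + y + z) =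
      attach E F (refStrategy θ α).state ς := by
  obtain ⟨ω, hω⟩ : ∃ ω, ω = opTensor (offDiag A₀ A₁) (offDiag B₀ B₁) z := ⟨_, rfl⟩
  have hE : ∀ (σ : ℂ) v, opTensor ((1 / 2 : ℂ) • (1 + σ • A₀)) (1 : F →L[ℂ] F) v =
      (1 / 2 : ℂ) • (v + σ • opTensor A₀ 1 v) := by
    intro σ v
    rw [opTensor_smul_left, opTensor_add_left, opTensor_smul_left, opTensor_one_one]; rfl
  have hF : ∀ (σ : ℂ) v, opTensor (1 : E →L[ℂ] E) ((1 / 2 : ℂ) • (1 + σ • B₀)) v =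
      (1 / 2 : ℂ) • (v + σ • opTensor 1 B₀ v) := by
    intro σ v
    rw [opTensor_smul_right, opTensor_add_right, opTensor_smul_right, opTensor_one_one]; rfl
  have split : ∀ (S : E →L[ℂ] E) (T : F →L[ℂ] F) v,
      opTensor S T v = opTensor S 1 (opTensor 1 T v) := by
    intro S T v; rw [opTensor_eq_mul]; rfl
  have split' : ∀ (S : E →L[ℂ] E) (T : F →L[ℂ] F) v,
      opTensor S T v = opTensor 1 T (opTensor S 1 v) := by
    intro S T v; rw [opTensor_opTensor]; rfl
  have oneA : (1 + A₀ : E →L[ℂ] E) = 1 + (1 : ℂ) • A₀ := by rw [one_smul]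
  have oneA' : (1 - A₀ : E →L[ℂ] E) = 1 + (-1 : ℂ) • A₀ := by rw [neg_one_smul, sub_eq_add_neg]
  have oneB : (1 + B₀ : F →L[ℂ] F) = 1 + (1 : ℂ) • B₀ := by rw [one_smul]
  have oneB' : (1 - B₀ : F →L[ℂ] F) = 1 + (-1 : ℂ) • B₀ := by rw [neg_one_smul, sub_eq_add_neg]
  have F0 : opTensor (1 : E →L[ℂ] E) ((1 / 2 : ℂ) • (1 + B₀)) (x + y + z) = y := by
    rw [oneB, hF, map_add, map_add, hBx, hBy, hBz]; module
  have F1 : opTensor (1 : E →L[ℂ] E) ((1 / 2 : ℂ) • (1 - B₀)) (x + y + z) = x + z := by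
    rw [oneB', hF, map_add, map_add, hBx, hBy, hBz]; module
  have E0y : opTensor ((1 / 2 : ℂ) • (1 + A₀)) (1 : F →L[ℂ] F) y = 0 := by
    rw [oneA, hE, hAy]; module
  have E1y : opTensor ((1 / 2 : ℂ) • (1 - A₀)) (1 : F →L[ℂ] F) y = y := by
    rw [oneA', hE, hAy]; module
  have E0xz : opTensor ((1 / 2 : ℂ) • (1 + A₀)) (1 : F →L[ℂ] F) (x + z) = x := by
    rw [oneA, hE, map_add, hAx, hAz]; module
  have E1xz : opTensor ((1 / 2 : ℂ) • (1 - A₀)) (1 : F →L[ℂ] F) (x + z) = z := by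
    rw [oneA', hE, map_add, hAx, hAz]; module
  have XE : ∀ v : HilbertTensor E F, opTensor (((s⁻¹ : ℝ) : ℂ) •
      (offDiag A₀ A₁ * ((1 / 2 : ℂ) • (1 - A₀)))) (1 : F →L[ℂ] F) v =
      ((s⁻¹ : ℝ) : ℂ) • opTensor (offDiag A₀ A₁) (1 : F →L[ℂ] F)
        (opTensor ((1 / 2 : ℂ) • (1 - A₀)) (1 : F →L[ℂ] F) v) := by
    intro v; rw [opTensor_smul_left, opTensor_one_mul_left]; rfl
  have YF : ∀ v : HilbertTensor E F, opTensor (1 : E →L[ℂ] E)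
      (((s⁻¹ : ℝ) : ℂ) • (offDiag B₀ B₁ * ((1 / 2 : ℂ) • (1 - B₀)))) v =
      ((s⁻¹ : ℝ) : ℂ) • opTensor (1 : E →L[ℂ] E) (offDiag B₀ B₁)
        (opTensor (1 : E →L[ℂ] E) ((1 / 2 : ℂ) • (1 - B₀)) v) := by
    intro v; rw [opTensor_smul_right, opTensor_one_mul_right]; rfl
  have hcomm : ∀ (S : E →L[ℂ] E) (T : F →L[ℂ] F) v,
      opTensor S 1 (opTensor 1 T v) = opTensor 1 T (opTensor S 1 v) := fun S T v =>
    (split S T v).symm.trans (split' S T v)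
  have hYx : opTensor (1 : E →L[ℂ] E) (offDiag B₀ B₁) x = (κ : ℂ) • ω := by
    rw [hx, map_smul, hω, ← split']
  have hXy : opTensor (offDiag A₀ A₁) (1 : F →L[ℂ] F) y = (κ : ℂ) • ω := by
    rw [hy, map_smul, hω, ← split]
  -- The junk is (cos θ)⁻¹ s⁻² XYz; the factor is fixed by the branch 11.
  have c1 : ((s⁻¹ : ℝ) : ℂ) * κ = ((Real.sin θ / √2 : ℝ) : ℂ) *
      (((Real.cos θ)⁻¹ * (s⁻¹ * s⁻¹) : ℝ) : ℂ) := by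
    rw [hκ]; norm_cast; field_simp
  have c2 : ((s⁻¹ : ℝ) : ℂ) * ((s⁻¹ : ℝ) : ℂ) = ((Real.cos θ : ℝ) : ℂ) *
      (((Real.cos θ)⁻¹ * (s⁻¹ * s⁻¹) : ℝ) : ℂ) := by
    norm_cast; field_simp
  have h01 : opTensor ((1 / 2 : ℂ) • (1 + A₀))
      (((s⁻¹ : ℝ) : ℂ) • (offDiag B₀ B₁ * ((1 / 2 : ℂ) • (1 - B₀)))) (x + y + z) =
        ((Real.sin θ / √2 : ℝ) : ℂ) • (((Real.cos θ)⁻¹ * (s⁻¹ * s⁻¹) : ℝ) : ℂ) • ω := by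
    rw [split, YF, F1, map_smul, ← split, split', E0xz, hYx, smul_smul, smul_smul, c1]
  have h10 : opTensor (((s⁻¹ : ℝ) : ℂ) • (offDiag A₀ A₁ * ((1 / 2 : ℂ) • (1 - A₀))))
      ((1 / 2 : ℂ) • (1 + B₀)) (x + y + z) =
        ((Real.sin θ / √2 : ℝ) : ℂ) • (((Real.cos θ)⁻¹ * (s⁻¹ * s⁻¹) : ℝ) : ℂ) • ω := by
    rw [split, F0, XE, E1y, hXy, smul_smul, smul_smul, c1]
  have h11 : opTensor (((s⁻¹ : ℝ) : ℂ) • (offDiag A₀ A₁ * ((1 / 2 : ℂ) • (1 - A₀))))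
      (((s⁻¹ : ℝ) : ℂ) • (offDiag B₀ B₁ * ((1 / 2 : ℂ) • (1 - B₀)))) (x + y + z) =
        ((Real.cos θ : ℝ) : ℂ) • (((Real.cos θ)⁻¹ * (s⁻¹ * s⁻¹) : ℝ) : ℂ) • ω := by
    rw [split, YF, F1, map_smul, XE, hcomm, E1xz, ← split, ← hω, smul_smul, smul_smul, c2]
  have h00 : opTensor ((1 / 2 : ℂ) • (1 + A₀)) ((1 / 2 : ℂ) • (1 + B₀)) (x + y + z) = 0 := by
    rw [split, F0, E0y]
  exact ⟨_, opTensor_swapCore A₀ A₁ B₀ B₁ s θ α _ _ h00 h01 h10 h11⟩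

theorem exists_junk_of_relations {A₀ A₁ : E →L[ℂ] E} {B₀ B₁ : F →L[ℂ] F} {γ s θ α κ : ℝ}
    (sA₀ : IsSelfAdjoint A₀) (sA₁ : IsSelfAdjoint A₁)
    (sB₀ : IsSelfAdjoint B₀) (sB₁ : IsSelfAdjoint B₁)
    (iA₀ : A₀ * A₀ = 1) (iA₁ : A₁ * A₁ = 1) (iB₀ : B₀ * B₀ = 1) (iB₁ : B₁ * B₁ = 1)
    (hγ : γ = Real.cos α) (hs : s = Real.sin α) (hs0 : s ≠ 0) (hθ : Real.cos θ ≠ 0)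
    (hκ : Real.sin θ / √2 = κ * s * Real.cos θ)
    {x y z : HilbertTensor E F} (hψ : ‖x + y + z‖ = 1)
    (hAx : opTensor A₀ (1 : F →L[ℂ] F) x = x) (hBx : opTensor (1 : E →L[ℂ] E) B₀ x = -x)
    (hAy : opTensor A₀ (1 : F →L[ℂ] F) y = -y) (hBy : opTensor (1 : E →L[ℂ] E) B₀ y = y)
    (hAz : opTensor A₀ (1 : F →L[ℂ] F) z = -z) (hBz : opTensor (1 : E →L[ℂ] E) B₀ z = -z)
    (hcA : opTensor (cosOp A₀ A₁) (1 : F →L[ℂ] F) (x + y + z) = (γ : ℂ) • (x + y + z))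
    (hcB : opTensor (1 : E →L[ℂ] E) (cosOp B₀ B₁) (x + y + z) = (γ : ℂ) • (x + y + z))
    (hx : x = (κ : ℂ) • opTensor (offDiag A₀ A₁) (1 : F →L[ℂ] F) z)
    (hy : y = (κ : ℂ) • opTensor (1 : E →L[ℂ] E) (offDiag B₀ B₁) z) :
    ∃ ς : HilbertTensor E F, ‖ς‖ = 1 ∧
    ∀ a b i j, opTensor (swapMap A₀ A₁ γ s) (swapMap B₀ B₁ γ s)
      (opTensor (outcomeOp ((![A₀, A₁] : Fin 2 → (E →L[ℂ] E)) i) a)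
        (outcomeOp ((![B₀, B₁] : Fin 2 → (F →L[ℂ] F)) j) b) (x + y + z)) =
      attach E F (TensorProduct.mapL (refMeasurement α i a) (refMeasurement α j b)
        (refStrategy θ α).state) ς := by
  have hs2 : s ^ 2 = 1 - γ ^ 2 := by rw [hs, hγ]; linarith [Real.sin_sq_add_cos_sq α]
  obtain ⟨ς, hς⟩ := exists_opTensor_swapCore_eq_attach α hs0 hθ hκ hAx hBx hAy hBy hAz hBz hx hy
  obtain ⟨h1, h2⟩ := opTensor_swapMap_eq_attach iA₀ iA₁ iB₀ iB₁ hγ hs hs0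
    (starProjection_angleSpace_left sA₀ sA₁ hcA) (starProjection_angleSpace_right sB₀ sB₁ hcB) hς
  have h3 := inner_opTensor_isometry (swapIsometry sA₀ sA₁ iA₀ iA₁ hs2 hs0)
    (swapIsometry sB₀ sB₁ iB₀ iB₁ hs2 hs0) (x + y + z) (x + y + z)
  -- The local isometries preserve the norm of the state and the reference state is normalized, so
  -- the junk has norm one.
  have h4 := (inner_attach (refStrategy θ α).state (refStrategy θ α).state ς ς).symm.trans
    ((congrArg (fun w => ⟪w, w⟫_ℂ) h1).symm.trans h3)
  rw [norm_refState, one_mul] at h4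
  exact ⟨ς, norm_eq_one_of_inner_eq h4 hψ, h2⟩

end ProjectiveSelfTest

/-! ### One party's action expressed through the other's -/

section InvariantSubspace

variable {K : Type*} [NormedAddCommGroup K] [InnerProductSpace ℂ K]

theorem offDiag_offDiag_of_cosOp_eq {A₀ A₁ : K →L[ℂ] K} (iA₀ : A₀ * A₀ = 1) (iA₁ : A₁ * A₁ = 1)
    {γ : ℝ} {z : K} (h : cosOp A₀ A₁ z = (γ : ℂ) • z) :
    offDiag A₀ A₁ (offDiag A₀ A₁ z) = ((1 - γ ^ 2 : ℝ) : ℂ) • z := by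
  have h2 := DFunLike.congr_fun (offDiag_sq iA₀ iA₁) z
  change offDiag A₀ A₁ (offDiag A₀ A₁ z) = z - cosOp A₀ A₁ (cosOp A₀ A₁ z) at h2
  rw [h2, h, map_smul, h]
  push_cast
  module

/-- A subspace containing ψ and invariant under Bob's operators contains y = (1 + B₀)ψ/2, then z,
which is a multiple of Yy, then x. The relations write A₀ψ and A₁ψ as combinations of x, y, z and
Yx. This is what later shows that Alice's dilated observables do not move ψ out of the embedded
space. -/
theorem apply_mem_of_relations {A₀ A₁ B₀ B₁ : K →L[ℂ] K}
    (iA₀ : A₀ * A₀ = 1) (iA₁ : A₁ * A₁ = 1) (iB₀ : B₀ * B₀ = 1) (iB₁ : B₁ * B₁ = 1)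
    (c₀₀ : Commute A₀ B₀) (c₀₁ : Commute A₀ B₁) (c₁₀ : Commute A₁ B₀) (c₁₁ : Commute A₁ B₁)
    {γ κ : ℝ} (hγ : 1 - γ ^ 2 ≠ 0) (hκ : κ ≠ 0)
    {x y z : K} (hAx : A₀ x = x) (hBx : B₀ x = -x) (hAy : A₀ y = -y) (hBy : B₀ y = y)
    (hAz : A₀ z = -z) (hBz : B₀ z = -z)
    (ax : cosOp A₀ A₁ x = (γ : ℂ) • x) (ay : cosOp A₀ A₁ y = (γ : ℂ) • y)
    (az : cosOp A₀ A₁ z = (γ : ℂ) • z) (bz : cosOp B₀ B₁ z = (γ : ℂ) • z)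
    (hx : x = (κ : ℂ) • offDiag A₀ A₁ z) (hy : y = (κ : ℂ) • offDiag B₀ B₁ z)
    (W : Submodule ℂ K) (hψ : x + y + z ∈ W) (hW₀ : ∀ v ∈ W, B₀ v ∈ W) (hW₁ : ∀ v ∈ W, B₁ v ∈ W) :
    ∀ i, (![A₀, A₁] : Fin 2 → (K →L[ℂ] K)) i (x + y + z) ∈ W := by
  have hWb : ∀ v ∈ W, cosOp B₀ B₁ v ∈ W := fun v hv =>
    W.smul_mem _ (W.add_mem (hW₀ _ (hW₁ _ hv)) (hW₁ _ (hW₀ _ hv)))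
  have hWY : ∀ v ∈ W, offDiag B₀ B₁ v ∈ W := fun v hv =>
    W.sub_mem (hW₁ _ hv) (hWb _ (hW₀ _ hv))
  have hγ' : ((1 - γ ^ 2 : ℝ) : ℂ) ≠ 0 := by exact_mod_cast hγ
  have hκ' : (κ : ℂ) ≠ 0 := by exact_mod_cast hκ
  have my : y ∈ W := by
    have h : (1 / 2 : ℂ) • ((x + y + z) + B₀ (x + y + z)) = y := by
      rw [map_add, map_add, hBx, hBy, hBz]; module
    exact h ▸ W.smul_mem _ (W.add_mem hψ (hW₀ _ hψ))
  -- Since y = κYz and Y² = 1 - γ² on z, z is recovered from y by one more application of Y.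
  have mz : z ∈ W := by
    have h : ((κ : ℂ) * ((1 - γ ^ 2 : ℝ) : ℂ))⁻¹ • offDiag B₀ B₁ y = z := by
      conv_lhs => rw [hy]
      rw [map_smul, offDiag_offDiag_of_cosOp_eq iB₀ iB₁ bz, smul_smul, smul_smul, mul_assoc,
        inv_mul_cancel₀ (mul_ne_zero hκ' hγ'), one_smul]
    exact h ▸ W.smul_mem _ (hWY _ my)
  have mx : x ∈ W := by
    have h : x + y + z - y - z = x := by abel
    exact h ▸ W.sub_mem (W.sub_mem hψ my) mz
  have Xz : offDiag A₀ A₁ z = (κ : ℂ)⁻¹ • x := by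
    conv_rhs => rw [hx]
    rw [smul_smul, inv_mul_cancel₀ hκ', one_smul]
  have Xx : offDiag A₀ A₁ x = (κ : ℂ) • ((1 - γ ^ 2 : ℝ) : ℂ) • z := by
    conv_lhs => rw [hx]
    rw [map_smul, offDiag_offDiag_of_cosOp_eq iA₀ iA₁ az]
  have cXY : Commute (offDiag A₀ A₁) (offDiag B₀ B₁) :=
    ((c₀₀.symm.offDiag_right c₁₀.symm).symm.offDiag_right (c₀₁.symm.offDiag_right c₁₁.symm).symm)
  -- Both sides equal κXYz; this is the only place where Alice's X is traded for Bob's Y on a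
  -- vector.
  have Xy : offDiag A₀ A₁ y = offDiag B₀ B₁ x := by
    conv_lhs => rw [hy]
    conv_rhs => rw [hx]
    rw [map_smul, map_smul]
    exact congrArg _ (DFunLike.congr_fun cXY.eq z)
  have mA₀ : A₀ (x + y + z) ∈ W := by
    rw [map_add, map_add, hAx, hAy, hAz]
    exact W.add_mem (W.add_mem mx (W.neg_mem my)) (W.neg_mem mz)
  have hA₁ : A₁ (x + y + z) = offDiag A₀ A₁ (x + y + z) + cosOp A₀ A₁ (A₀ (x + y + z)) := by
    simp [offDiag]
  intro i
  fin_cases i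
  · exact mA₀
  · change A₁ (x + y + z) ∈ W
    have hA₀ : A₀ (x + y + z) = x + -y + -z := by rw [map_add, map_add, hAx, hAy, hAz]
    rw [hA₁, hA₀, map_add, map_add, Xx, Xy, Xz, map_add, map_add, map_neg, map_neg, ax, ay, az]
    refine W.add_mem (W.add_mem (W.add_mem ?_ (hWY _ mx)) (W.smul_mem _ mx)) ?_
    · exact W.smul_mem _ (W.smul_mem _ mz)
    · exact W.add_mem (W.add_mem (W.smul_mem _ mx) (W.neg_mem (W.smul_mem _ my)))
        (W.neg_mem (W.smul_mem _ mz))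

end InvariantSubspace

/-! ### Sector decomposition from P(0,0|0,0) = 0 -/

section Sectors

variable {E F : Type*} [NormedAddCommGroup E] [InnerProductSpace ℂ E] [CompleteSpace E]
    [NormedAddCommGroup F] [InnerProductSpace ℂ F] [CompleteSpace F]

theorem outcomeOp_zero (A : E →L[ℂ] E) : outcomeOp A 0 = (1 / 2 : ℂ) • (1 + A) := by
  simp [outcomeOp]

theorem outcomeOp_one (A : E →L[ℂ] E) : outcomeOp A 1 = (1 / 2 : ℂ) • (1 - A) := by
  simp [outcomeOp, sub_eq_add_neg]

theorem outcomeOp_zero_add_one (A : E →L[ℂ] E) : outcomeOp A 0 + outcomeOp A 1 = 1 := by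
  rw [outcomeOp_zero, outcomeOp_one]; module

theorem outcomeOp_zero_sub_one (A : E →L[ℂ] E) : outcomeOp A 0 - outcomeOp A 1 = A := by
  rw [outcomeOp_zero, outcomeOp_one]; module

theorem isSelfAdjoint_outcomeOp {A : E →L[ℂ] E} (hA : IsSelfAdjoint A) (a : Fin 2) :
    IsSelfAdjoint (outcomeOp A a) := by
  fin_cases a
  · change IsSelfAdjoint (outcomeOp A 0)
    rw [outcomeOp_zero, IsSelfAdjoint, star_smul, star_add, star_one, hA.star_eq]; simp
  · change IsSelfAdjoint (outcomeOp A 1)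
    rw [outcomeOp_one, IsSelfAdjoint, star_smul, star_sub, star_one, hA.star_eq]; simp

theorem outcomeOp_mul_self {A : E →L[ℂ] E} (hA : A * A = 1) (a : Fin 2) :
    outcomeOp A a * outcomeOp A a = outcomeOp A a := by
  fin_cases a
  · change outcomeOp A 0 * outcomeOp A 0 = outcomeOp A 0
    rw [outcomeOp_zero, smul_mul_smul_comm, add_mul, mul_add, mul_add, hA]
    simp only [one_mul, mul_one]
    module
  · change outcomeOp A 1 * outcomeOp A 1 = outcomeOp A 1
    rw [outcomeOp_one, smul_mul_smul_comm, sub_mul, mul_sub, mul_sub, hA]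
    simp only [one_mul, mul_one]
    module

theorem mul_outcomeOp_zero {A : E →L[ℂ] E} (hA : A * A = 1) :
    A * outcomeOp A 0 = outcomeOp A 0 := by
  rw [outcomeOp_zero, mul_smul_comm, mul_add, hA, mul_one, add_comm]

theorem mul_outcomeOp_one {A : E →L[ℂ] E} (hA : A * A = 1) :
    A * outcomeOp A 1 = -outcomeOp A 1 := by
  rw [outcomeOp_one, mul_smul_comm, mul_sub, hA, mul_one, ← smul_neg, neg_sub]

theorem eq_zero_of_inner_projection {K : Type*} [NormedAddCommGroup K] [InnerProductSpace ℂ K]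
    [CompleteSpace K] {T : K →L[ℂ] K} (hT : IsSelfAdjoint T) (h2 : T * T = T) {ψ : K}
    (h : ⟪ψ, T ψ⟫_ℂ = 0) : T ψ = 0 := by
  have e : ⟪T ψ, T ψ⟫_ℂ = ⟪ψ, T ψ⟫_ℂ := by
    rw [← ContinuousLinearMap.adjoint_inner_right, ContinuousLinearMap.isSelfAdjoint_iff'.mp hT]
    exact congrArg _ (DFunLike.congr_fun h2 ψ)
  rw [h] at e
  exact inner_self_eq_zero.mp e

/-- For projections, zero probability means that the projected component itself vanishes, so only
three of the four joint eigenspaces of A₀ and B₀ carry the state. -/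
theorem exists_sectors {A₀ : E →L[ℂ] E} {B₀ : F →L[ℂ] F} (sA₀ : IsSelfAdjoint A₀)
    (sB₀ : IsSelfAdjoint B₀) (iA₀ : A₀ * A₀ = 1) (iB₀ : B₀ * B₀ = 1) {ψ : HilbertTensor E F}
    (h : ⟪ψ, opTensor (outcomeOp A₀ 0) (outcomeOp B₀ 0) ψ⟫_ℂ = 0) :
    ∃ x y z : HilbertTensor E F, ψ = x + y + z ∧
      opTensor A₀ (1 : F →L[ℂ] F) x = x ∧ opTensor (1 : E →L[ℂ] E) B₀ x = -x ∧
      opTensor A₀ (1 : F →L[ℂ] F) y = -y ∧ opTensor (1 : E →L[ℂ] E) B₀ y = y ∧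
      opTensor A₀ (1 : F →L[ℂ] F) z = -z ∧ opTensor (1 : E →L[ℂ] E) B₀ z = -z := by
  have h0 := eq_zero_of_inner_projection
    ((isSelfAdjoint_outcomeOp sA₀ 0).opTensor (isSelfAdjoint_outcomeOp sB₀ 0))
    (by rw [← opTensor_mul, outcomeOp_mul_self iA₀, outcomeOp_mul_self iB₀]) h
  refine ⟨opTensor (outcomeOp A₀ 0) (outcomeOp B₀ 1) ψ,
    opTensor (outcomeOp A₀ 1) (outcomeOp B₀ 0) ψ,
    opTensor (outcomeOp A₀ 1) (outcomeOp B₀ 1) ψ, ?_, ?_, ?_, ?_, ?_, ?_, ?_⟩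
  · have h1 :
        opTensor (outcomeOp A₀ 0 + outcomeOp A₀ 1) (outcomeOp B₀ 0 + outcomeOp B₀ 1) ψ = ψ := by
      rw [outcomeOp_zero_add_one, outcomeOp_zero_add_one, opTensor_one_one, one_apply_eq_self]
    rw [opTensor_add_left, opTensor_add_right, opTensor_add_right, add_apply, add_apply, add_apply,
      h0, zero_add] at h1
    rw [← add_assoc] at h1
    exact h1.symm
  all_goals
    rw [← mul_apply_eq_comp, ← opTensor_mul]
    first
    | rw [mul_outcomeOp_zero iA₀, one_mul]
    | rw [mul_outcomeOp_zero iB₀, one_mul]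
    | rw [mul_outcomeOp_one iA₀, one_mul, opTensor_neg_left, neg_apply]
    | rw [mul_outcomeOp_one iB₀, one_mul, opTensor_neg_right, neg_apply]

theorem chshExpectation_opTensor_eq_chsh {A₀ A₁ : E →L[ℂ] E} {B₀ B₁ : F →L[ℂ] F}
    {ψ : HilbertTensor E F} {P : Correlation}
    (h : ∀ a b x y, ⟪ψ, opTensor (outcomeOp ((![A₀, A₁] : Fin 2 → (E →L[ℂ] E)) x) a)
      (outcomeOp ((![B₀, B₁] : Fin 2 → (F →L[ℂ] F)) y) b) ψ⟫_ℂ = (P a b x y : ℂ)) :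
    chshExpectation (opTensor A₀ (1 : F →L[ℂ] F)) (opTensor A₁ 1) (opTensor (1 : E →L[ℂ] E) B₀)
      (opTensor 1 B₁) ψ = chsh P := by
  have key : ∀ x y, ⟪ψ, opTensor ((![A₀, A₁] : Fin 2 → (E →L[ℂ] E)) x) (1 : F →L[ℂ] F)
      (opTensor (1 : E →L[ℂ] E) ((![B₀, B₁] : Fin 2 → (F →L[ℂ] F)) y) ψ)⟫_ℂ =
      ((P 0 0 x y - P 0 1 x y - P 1 0 x y + P 1 1 x y : ℝ) : ℂ) := by
    intro x y
    rw [← mul_apply_eq_comp, ← opTensor_eq_mul]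
    conv_lhs => rw [← outcomeOp_zero_sub_one ((![A₀, A₁] : Fin 2 → (E →L[ℂ] E)) x),
      ← outcomeOp_zero_sub_one ((![B₀, B₁] : Fin 2 → (F →L[ℂ] F)) y)]
    rw [opTensor_sub_left, opTensor_sub_right, opTensor_sub_right, sub_apply, sub_apply, sub_apply,
      inner_sub_right, inner_sub_right, inner_sub_right, h, h, h, h]
    push_cast
    ring
  have k00 := key 0 0
  have k01 := key 0 1
  have k10 := key 1 0
  have k11 := key 1 1
  simp only [Matrix.cons_val_zero, Matrix.cons_val_one] at k00 k01 k10 k11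
  rw [chshExpectation, inner_add_right, inner_sub_right, inner_sub_right, inner_neg_right,
    k00, k01, k10, k11, chsh]
  simp only [Fin.sum_univ_two, Complex.add_re, Complex.sub_re, Complex.neg_re, Complex.ofReal_re]
  norm_num
  ring

end Sectors

/-! ### Observables of two-outcome POVMs -/

section POVM

variable {E : Type*} [NormedAddCommGroup E] [InnerProductSpace ℂ E] [CompleteSpace E]

theorem IsPOVM.isSelfAdjoint_sub {M : Fin 2 → (E →L[ℂ] E)} (h : IsPOVM M) :
    IsSelfAdjoint (M 0 - M 1) :=
  (h.1 0).isSelfAdjoint.sub (h.1 1).isSelfAdjoint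

theorem IsPOVM.outcomeOp_sub {M : Fin 2 → (E →L[ℂ] E)} (h : IsPOVM M) (a : Fin 2) :
    outcomeOp (M 0 - M 1) a = M a := by
  have h1 : M 0 + M 1 = 1 := by rw [← h.2, Fin.sum_univ_two]
  fin_cases a
  · change outcomeOp (M 0 - M 1) 0 = M 0
    rw [outcomeOp_zero, ← h1]; module
  · change outcomeOp (M 0 - M 1) 1 = M 1
    rw [outcomeOp_one, ← h1]; module

/-- M₁ = 1 - M₀ commutes with M₀, so 1 - (M₀ - M₁)² = 4M₀M₁ is a product of commuting positive
operators. -/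
theorem IsPOVM.one_sub_sq_nonneg {M : Fin 2 → (E →L[ℂ] E)} (h : IsPOVM M) :
    0 ≤ 1 - (M 0 - M 1) * (M 0 - M 1) := by
  have h1 : M 1 = 1 - M 0 := by rw [← h.2, Fin.sum_univ_two]; abel
  have hc : Commute (M 0) (M 1) := by
    rw [h1]; exact (Commute.one_right _).sub_right (.refl _)
  have hp : 0 ≤ M 0 * M 1 := hc.mul_nonneg
    ((ContinuousLinearMap.nonneg_iff_isPositive _).mpr (h.1 0))
    ((ContinuousLinearMap.nonneg_iff_isPositive _).mpr (h.1 1))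
  have e : 1 - (M 0 - M 1) * (M 0 - M 1) =
      M 0 * M 1 + M 0 * M 1 + (M 0 * M 1 + M 0 * M 1) := by
    rw [h1]; noncomm_ring
  rw [e]
  exact add_nonneg (add_nonneg hp hp) (add_nonneg hp hp)

end POVM

/-! ### Compressions of dilated measurements -/

section Compression

variable {E F E' F' : Type*} [NormedAddCommGroup E] [InnerProductSpace ℂ E] [CompleteSpace E]
    [NormedAddCommGroup F] [InnerProductSpace ℂ F] [CompleteSpace F]
    [NormedAddCommGroup E'] [InnerProductSpace ℂ E'] [CompleteSpace E']
    [NormedAddCommGroup F'] [InnerProductSpace ℂ F'] [CompleteSpace F']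

theorem LinearIsometry.adjoint_comp_toContinuousLinearMap (V : E →ₗᵢ[ℂ] E') :
    V.toContinuousLinearMap.adjoint ∘L V.toContinuousLinearMap = 1 :=
  (ContinuousLinearMap.norm_map_iff_adjoint_comp_self _).mp V.norm_map

theorem adjoint_comp_outcomeOp_comp {V : E →ₗᵢ[ℂ] E'} {T : E' →L[ℂ] E'} {A : E →L[ℂ] E}
    (h : V.toContinuousLinearMap.adjoint ∘L T ∘L V.toContinuousLinearMap = A) (a : Fin 2) :
    V.toContinuousLinearMap.adjoint ∘L outcomeOp T a ∘L V.toContinuousLinearMap =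
      outcomeOp A a := by
  rw [outcomeOp, outcomeOp, ← h, ← V.adjoint_comp_toContinuousLinearMap]
  ext v
  have hV : V.toContinuousLinearMap.adjoint (V v) = v :=
    DFunLike.congr_fun V.adjoint_comp_toContinuousLinearMap v
  simp [hV]

theorem inner_opTensor_compression (V : E →L[ℂ] E') (W : F →L[ℂ] F') (S : E' →L[ℂ] E')
    (T : F' →L[ℂ] F') (ψ : HilbertTensor E F) :
    ⟪opTensor V W ψ, opTensor S T (opTensor V W ψ)⟫_ℂ =
      ⟪ψ, opTensor (V.adjoint ∘L S ∘L V) (W.adjoint ∘L T ∘L W) ψ⟫_ℂ := by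
  rw [← ContinuousLinearMap.adjoint_inner_right, adjoint_opTensor, opTensor_opTensor,
    opTensor_opTensor]
  rfl

/-- If the range projections of `V` and `W` fix `S ξ` and `T ξ`, `ξ = (V ⊗ W) ψ`, then the
compressions of `S` and `T` act on `ψ` as `S` and `T` on `ξ`. -/
theorem opTensor_compression_apply {V : E →L[ℂ] E'} {W : F →L[ℂ] F'} {S : E' →L[ℂ] E'}
    {T : F' →L[ℂ] F'} {ψ : HilbertTensor E F}
    (hS : opTensor (V ∘L V.adjoint) (1 : F' →L[ℂ] F') (opTensor S 1 (opTensor V W ψ)) =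
      opTensor S 1 (opTensor V W ψ))
    (hT : opTensor (1 : E' →L[ℂ] E') (W ∘L W.adjoint) (opTensor 1 T (opTensor V W ψ)) =
      opTensor 1 T (opTensor V W ψ)) :
    opTensor V W (opTensor (V.adjoint ∘L S ∘L V) (W.adjoint ∘L T ∘L W) ψ) =
      opTensor S T (opTensor V W ψ) := by
  have h1 : opTensor V W (opTensor (V.adjoint ∘L S ∘L V) (W.adjoint ∘L T ∘L W) ψ) =
      opTensor 1 ((W ∘L W.adjoint) ∘L T)
        (opTensor (V ∘L V.adjoint) (1 : F' →L[ℂ] F') (opTensor S 1 (opTensor V W ψ))) := by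
    simp only [opTensor_opTensor]; rfl
  have h2 : opTensor 1 ((W ∘L W.adjoint) ∘L T) (opTensor S (1 : F' →L[ℂ] F') (opTensor V W ψ)) =
      opTensor S (1 : F' →L[ℂ] F') (opTensor (1 : E' →L[ℂ] E') (W ∘L W.adjoint)
        (opTensor 1 T (opTensor V W ψ))) := by
    simp only [opTensor_opTensor]; rfl
  rw [h1, hS, h2, hT]
  simp only [opTensor_opTensor]; rfl

theorem opTensor_outcomeOp_fixed_left {Q T : E →L[ℂ] E} {ξ : HilbertTensor E F}
    (h0 : opTensor Q (1 : F →L[ℂ] F) ξ = ξ)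
    (h : opTensor Q (1 : F →L[ℂ] F) (opTensor T 1 ξ) = opTensor T 1 ξ) (a : Fin 2) :
    opTensor Q (1 : F →L[ℂ] F) (opTensor (outcomeOp T a) 1 ξ) = opTensor (outcomeOp T a) 1 ξ := by
  rw [outcomeOp, opTensor_smul_left, opTensor_add_left, opTensor_smul_left, opTensor_one_one]
  simp only [smul_apply, add_apply, one_apply_eq_self, map_smul, map_add, h0, h]

theorem opTensor_outcomeOp_fixed_right {Q T : F →L[ℂ] F} {ξ : HilbertTensor E F}
    (h0 : opTensor (1 : E →L[ℂ] E) Q ξ = ξ)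
    (h : opTensor (1 : E →L[ℂ] E) Q (opTensor 1 T ξ) = opTensor 1 T ξ) (a : Fin 2) :
    opTensor (1 : E →L[ℂ] E) Q (opTensor 1 (outcomeOp T a) ξ) = opTensor 1 (outcomeOp T a) ξ := by
  rw [outcomeOp, opTensor_smul_right, opTensor_add_right, opTensor_smul_right, opTensor_one_one]
  simp only [smul_apply, add_apply, one_apply_eq_self, map_smul, map_add, h0, h]

end Compression

/-! ### The bound and the self-test for pure states -/

section PureStates

theorem opTensor_isometry_comp {E F D D' G G' : Type*}
    [NormedAddCommGroup E] [InnerProductSpace ℂ E] [NormedAddCommGroup F] [InnerProductSpace ℂ F]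
    [NormedAddCommGroup D] [InnerProductSpace ℂ D] [NormedAddCommGroup D'] [InnerProductSpace ℂ D']
    [NormedAddCommGroup G] [InnerProductSpace ℂ G] [NormedAddCommGroup G'] [InnerProductSpace ℂ G']
    (Φ : D →ₗᵢ[ℂ] G) (Φ' : D' →ₗᵢ[ℂ] G') (V : E →ₗᵢ[ℂ] D) (W : F →ₗᵢ[ℂ] D')
    (ξ : HilbertTensor E F) :
    opTensor (Φ.comp V).toContinuousLinearMap (Φ'.comp W).toContinuousLinearMap ξ =
      opTensor Φ.toContinuousLinearMap Φ'.toContinuousLinearMap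
        (opTensor V.toContinuousLinearMap W.toContinuousLinearMap ξ) :=
by
  have h₁ : (Φ.comp V).toContinuousLinearMap =
      Φ.toContinuousLinearMap ∘L V.toContinuousLinearMap := rfl
  have h₂ : (Φ'.comp W).toContinuousLinearMap =
      Φ'.toContinuousLinearMap ∘L W.toContinuousLinearMap := rfl
  rw [opTensor_opTensor, h₁, h₂]

theorem EquivUpToLocalIsometries.of_dilation {HA HB DA DB : Type u}
    [NormedAddCommGroup HA] [InnerProductSpace ℂ HA]
    [NormedAddCommGroup HB] [InnerProductSpace ℂ HB]
    [nA : NormedAddCommGroup DA] [iA : InnerProductSpace ℂ DA] [cA : CompleteSpace DA]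
    [nB : NormedAddCommGroup DB] [iB : InnerProductSpace ℂ DB] [cB : CompleteSpace DB]
    {ψ : HilbertTensor HA HB} {ξ ς : HilbertTensor DA DB}
    {M : Fin 2 → Fin 2 → (HA →L[ℂ] HA)} {N : Fin 2 → Fin 2 → (HB →L[ℂ] HB)}
    {M' : Fin 2 → Fin 2 → (DA →L[ℂ] DA)} {N' : Fin 2 → Fin 2 → (DB →L[ℂ] DB)}
    {R : QubitStrategy} (V : HA →ₗᵢ[ℂ] DA) (W : HB →ₗᵢ[ℂ] DB)
    (Φ : DA →ₗᵢ[ℂ] HilbertTensor DA Qubit) (Φ' : DB →ₗᵢ[ℂ] HilbertTensor DB Qubit)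
    (hV : ∀ a b i j, opTensor V.toContinuousLinearMap W.toContinuousLinearMap
      (opTensor (M i a) (N j b) ψ) = opTensor (M' i a) (N' j b) ξ)
    (hς : ‖ς‖ = 1)
    (h : ∀ a b i j, opTensor Φ.toContinuousLinearMap Φ'.toContinuousLinearMap
      (opTensor (M' i a) (N' j b) ξ) =
        attach DA DB (TensorProduct.mapL (R.alice i a) (R.bob j b) R.state) ς) :
    EquivUpToLocalIsometries ψ M N R :=
  by
  refine ⟨DA, DB, nA, iA, cA, nB, iB, cB, Φ.comp V, Φ'.comp W, ς, hς, fun a b i j => ?_⟩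
  rw [opTensor_isometry_comp]
  rw [hV]
  exact h a b i j

/-- The dilation has the same correlation, so the bound for involutions applies. In the equality
case the swap isometries composed with the dilations are the required local isometries, once the
original measurements are shown to act on ψ as the dilated ones act on its image. -/
theorem chsh_le_and_equiv_of_realizes {HA HB : Type u}
    [NormedAddCommGroup HA] [InnerProductSpace ℂ HA] [CompleteSpace HA]
    [NormedAddCommGroup HB] [InnerProductSpace ℂ HB] [CompleteSpace HB]
    {γ θ : ℝ} (hγ : γ ^ 3 - 9 * γ ^ 2 - γ + 1 = 0) (hγ1 : 0.28 < γ) (hγ2 : γ < 0.29)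
    (hθ : Real.cos θ ≠ 0)
    (hκ : Real.sin θ / √2 = (13 + 44 * γ - 5 * γ ^ 2) / 8 * √(1 - γ ^ 2) * Real.cos θ)
    {ψ : HilbertTensor HA HB}
    {M : Fin 2 → Fin 2 → (HA →L[ℂ] HA)} {N : Fin 2 → Fin 2 → (HB →L[ℂ] HB)}
    {P : Correlation} (hP : Realizes ψ M N P) (h0 : P 0 0 0 0 = 0) :
    chsh P ≤ 1 + 6 * γ - γ ^ 2 ∧ (chsh P = 1 + 6 * γ - γ ^ 2 →
      EquivUpToLocalIsometries ψ M N (refStrategy θ (Real.arccos γ))) := by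
  obtain ⟨hψ, hM, hN, hMN⟩ := hP
  obtain ⟨DA, _, _, _, V, T₀, T₁, sT₀, sT₁, iT₀, iT₁, cT₀, cT₁⟩ := exists_involutive_dilation
    (hM 0).isSelfAdjoint_sub (hM 1).isSelfAdjoint_sub (hM 0).one_sub_sq_nonneg
    (hM 1).one_sub_sq_nonneg
  obtain ⟨DB, _, _, _, W, U₀, U₁, sU₀, sU₁, iU₀, iU₁, cU₀, cU₁⟩ := exists_involutive_dilation
    (hN 0).isSelfAdjoint_sub (hN 1).isSelfAdjoint_sub (hN 0).one_sub_sq_nonneg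
    (hN 1).one_sub_sq_nonneg
  have hMc : ∀ x a, V.toContinuousLinearMap.adjoint ∘L
      outcomeOp ((![T₀, T₁] : Fin 2 → (DA →L[ℂ] DA)) x) a ∘L V.toContinuousLinearMap = M x a := by
    intro x a
    fin_cases x
    · exact (adjoint_comp_outcomeOp_comp cT₀ a).trans ((hM 0).outcomeOp_sub a)
    · exact (adjoint_comp_outcomeOp_comp cT₁ a).trans ((hM 1).outcomeOp_sub a)
  have hNc : ∀ y b, W.toContinuousLinearMap.adjoint ∘L
      outcomeOp ((![U₀, U₁] : Fin 2 → (DB →L[ℂ] DB)) y) b ∘L W.toContinuousLinearMap = N y b := by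
    intro y b
    fin_cases y
    · exact (adjoint_comp_outcomeOp_comp cU₀ b).trans ((hN 0).outcomeOp_sub b)
    · exact (adjoint_comp_outcomeOp_comp cU₁ b).trans ((hN 1).outcomeOp_sub b)
  obtain ⟨ξ, hξ⟩ : ∃ ξ, ξ = opTensor V.toContinuousLinearMap W.toContinuousLinearMap ψ := ⟨_, rfl⟩
  have hξ1 : ‖ξ‖ = 1 := norm_eq_one_of_inner_eq (by rw [hξ, inner_opTensor_isometry]) hψ
  have hd : ∀ a b x y, ⟪ξ, opTensor (outcomeOp ((![T₀, T₁] : Fin 2 → (DA →L[ℂ] DA)) x) a)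
      (outcomeOp ((![U₀, U₁] : Fin 2 → (DB →L[ℂ] DB)) y) b) ξ⟫_ℂ = (P a b x y : ℂ) := by
    intro a b x y
    rw [hξ, inner_opTensor_compression, hMc, hNc, hMN]
  have hfixA : opTensor (V.toContinuousLinearMap ∘L V.toContinuousLinearMap.adjoint)
      (1 : DB →L[ℂ] DB) ξ = ξ := by
    rw [hξ, opTensor_opTensor, ContinuousLinearMap.comp_assoc, V.adjoint_comp_toContinuousLinearMap]
    rfl
  have hfixB : opTensor (1 : DA →L[ℂ] DA)
      (W.toContinuousLinearMap ∘L W.toContinuousLinearMap.adjoint) ξ = ξ := by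
    rw [hξ, opTensor_opTensor, ContinuousLinearMap.comp_assoc, W.adjoint_comp_toContinuousLinearMap]
    rfl
  obtain ⟨x, y, z, hxyz, hAx, hBx, hAy, hBy, hAz, hBz⟩ := exists_sectors sT₀ sU₀ iT₀ iU₀ (ψ := ξ)
    ((hd 0 0 0 0).trans (by rw [h0, Complex.ofReal_zero]))
  have hchsh := chshExpectation_opTensor_eq_chsh hd
  rw [hxyz] at hchsh hξ1
  have sl : ∀ T : DA →L[ℂ] DA, IsSelfAdjoint T → IsSelfAdjoint (opTensor T (1 : DB →L[ℂ] DB)) :=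
    fun T hT => hT.opTensor (.one _)
  have sr : ∀ T : DB →L[ℂ] DB, IsSelfAdjoint T → IsSelfAdjoint (opTensor (1 : DA →L[ℂ] DA) T) :=
    fun T hT => IsSelfAdjoint.opTensor (.one _) hT
  have il : ∀ T : DA →L[ℂ] DA, T * T = 1 →
      opTensor T (1 : DB →L[ℂ] DB) * opTensor T (1 : DB →L[ℂ] DB) = 1 := fun T hT => by
    rw [← opTensor_one_mul_left, hT, opTensor_one_one]
  have ir : ∀ T : DB →L[ℂ] DB, T * T = 1 →
      opTensor (1 : DA →L[ℂ] DA) T * opTensor (1 : DA →L[ℂ] DA) T = 1 := fun T hT => by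
    rw [← opTensor_one_mul_right, hT, opTensor_one_one]
  have main := chshExpectation_le_and_eq (sl T₀ sT₀) (sl T₁ sT₁) (sr U₀ sU₀) (sr U₁ sU₁)
    (il T₀ iT₀) (il T₁ iT₁) (ir U₀ iU₀) (ir U₁ iU₁) (commute_opTensor T₀ U₀)
    (commute_opTensor T₀ U₁) (commute_opTensor T₁ U₀) (commute_opTensor T₁ U₁) hγ hγ1 hγ2
    hAx hBx hAy hBy hAz hBz
  rw [hchsh, hξ1, one_pow, mul_one] at main
  refine ⟨main.1, fun heq => ?_⟩
  obtain ⟨⟨ax, ay, az⟩, ⟨bx, by', bz⟩, hx, hy⟩ := main.2 heq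
  have hγs : 0 < 1 - γ ^ 2 := by nlinarith
  have hκ0 : (13 + 44 * γ - 5 * γ ^ 2) / 8 ≠ 0 := by nlinarith
  have hcomm : ∀ (S : DA →L[ℂ] DA) (T : DB →L[ℂ] DB) (v : HilbertTensor DA DB),
      opTensor S (1 : DB →L[ℂ] DB) (opTensor (1 : DA →L[ℂ] DA) T v) =
        opTensor (1 : DA →L[ℂ] DA) T (opTensor S (1 : DB →L[ℂ] DB) v) := fun S T v =>
    DFunLike.congr_fun (commute_opTensor S T).eq v
  -- The subspace is the fixed space of VV* ⊗ 1. It contains the embedded state, and Bob's operators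
  -- preserve it because they act on the other factor.
  have memA := apply_mem_of_relations (il T₀ iT₀) (il T₁ iT₁) (ir U₀ iU₀) (ir U₁ iU₁)
    (commute_opTensor T₀ U₀) (commute_opTensor T₀ U₁) (commute_opTensor T₁ U₀)
    (commute_opTensor T₁ U₁) hγs.ne' hκ0 hAx hBx hAy hBy hAz hBz ax ay az bz hx hy
    (LinearMap.eqLocus (opTensor (V.toContinuousLinearMap ∘L V.toContinuousLinearMap.adjoint)
      (1 : DB →L[ℂ] DB)).toLinearMap LinearMap.id) (by rw [← hxyz]; exact hfixA)
    (fun v hv => (hcomm _ U₀ v).trans (congrArg (opTensor (1 : DA →L[ℂ] DA) U₀) hv))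
    (fun v hv => (hcomm _ U₁ v).trans (congrArg (opTensor (1 : DA →L[ℂ] DA) U₁) hv))
  -- The same with the parties exchanged: x and y swap roles, so the state appears as y + x + z.
  have memB := apply_mem_of_relations (ir U₀ iU₀) (ir U₁ iU₁) (il T₀ iT₀) (il T₁ iT₁)
    (commute_opTensor T₀ U₀).symm (commute_opTensor T₁ U₀).symm (commute_opTensor T₀ U₁).symm
    (commute_opTensor T₁ U₁).symm hγs.ne' hκ0 hBy hAy hBx hAx hBz hAz by' bx bz az hy hx
    (LinearMap.eqLocus (opTensor (1 : DA →L[ℂ] DA)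
      (W.toContinuousLinearMap ∘L W.toContinuousLinearMap.adjoint)).toLinearMap LinearMap.id)
    (by rw [add_comm y x, ← hxyz]; exact hfixB)
    (fun v hv => (hcomm T₀ _ v).symm.trans (congrArg (opTensor T₀ (1 : DB →L[ℂ] DB)) hv))
    (fun v hv => (hcomm T₁ _ v).symm.trans (congrArg (opTensor T₁ (1 : DB →L[ℂ] DB)) hv))
  rw [← hxyz] at memA
  rw [add_comm y x, ← hxyz] at memB
  have fixA : ∀ i, opTensor (V.toContinuousLinearMap ∘L V.toContinuousLinearMap.adjoint)
      (1 : DB →L[ℂ] DB) (opTensor ((![T₀, T₁] : Fin 2 → (DA →L[ℂ] DA)) i) 1 ξ) =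
        opTensor ((![T₀, T₁] : Fin 2 → (DA →L[ℂ] DA)) i) 1 ξ := by
    intro i; fin_cases i
    · exact memA 0
    · exact memA 1
  have fixB : ∀ i, opTensor (1 : DA →L[ℂ] DA)
      (W.toContinuousLinearMap ∘L W.toContinuousLinearMap.adjoint)
      (opTensor 1 ((![U₀, U₁] : Fin 2 → (DB →L[ℂ] DB)) i) ξ) =
        opTensor 1 ((![U₀, U₁] : Fin 2 → (DB →L[ℂ] DB)) i) ξ := by
    intro i; fin_cases i
    · exact memB 0
    · exact memB 1
  have hcomp : ∀ a b i j, opTensor V.toContinuousLinearMap W.toContinuousLinearMap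
      (opTensor (M i a) (N j b) ψ) =
      opTensor (outcomeOp ((![T₀, T₁] : Fin 2 → (DA →L[ℂ] DA)) i) a)
        (outcomeOp ((![U₀, U₁] : Fin 2 → (DB →L[ℂ] DB)) j) b) ξ := by
    intro a b i j
    rw [← hMc, ← hNc, hξ]
    refine opTensor_compression_apply ?_ ?_
    · rw [← hξ]; exact opTensor_outcomeOp_fixed_left hfixA (fixA i) a
    · rw [← hξ]; exact opTensor_outcomeOp_fixed_right hfixB (fixB j) b
  have hs0 : √(1 - γ ^ 2) ≠ 0 := (Real.sqrt_pos.mpr hγs).ne'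
  have hs2 : √(1 - γ ^ 2) ^ 2 = 1 - γ ^ 2 := Real.sq_sqrt hγs.le
  rw [cosOp_opTensor_left] at ax ay az
  rw [cosOp_opTensor_right] at bx by' bz
  rw [offDiag_opTensor_left] at hx
  rw [offDiag_opTensor_right] at hy
  obtain ⟨ς, hς, heqv⟩ := exists_junk_of_relations (θ := θ) (α := Real.arccos γ)
    sT₀ sT₁ sU₀ sU₁ iT₀ iT₁ iU₀ iU₁ (Real.cos_arccos (by linarith) (by linarith)).symm
    (Real.sin_arccos γ).symm hs0 hθ hκ hξ1 hAx hBx hAy hBy hAz hBz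
    (by rw [map_add, map_add, ax, ay, az, smul_add, smul_add])
    (by rw [map_add, map_add, bx, by', bz, smul_add, smul_add]) hx hy
  refine EquivUpToLocalIsometries.of_dilation V W (swapIsometry sT₀ sT₁ iT₀ iT₁ hs2 hs0)
    (swapIsometry sU₀ sU₁ iU₀ iU₁ hs2 hs0) (ξ := x + y + z) (fun a b i j => ?_) hς heqv
  rw [hcomp, hxyz]

end PureStates

/-! ### Cyclicity of the trace for Hilbert–Schmidt factors -/

section Trace

variable {H : Type*} [NormedAddCommGroup H] [InnerProductSpace ℂ H] [CompleteSpace H]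

theorem HilbertBasis.hasSum_norm_inner_sq {ι : Type*} (e : HilbertBasis ι ℂ H) (v : H) :
    HasSum (fun i => ‖⟪e i, v⟫_ℂ‖ ^ 2) (‖v‖ ^ 2) := by
  have h := e.hasSum_inner_mul_inner v v
  rw [inner_self_eq_norm_sq_to_K] at h
  have h2 := Complex.hasSum_re h
  have e1 : ∀ i, (⟪v, e i⟫_ℂ * ⟪e i, v⟫_ℂ).re = ‖⟪e i, v⟫_ℂ‖ ^ 2 := by
    intro i
    rw [← inner_conj_symm, ← Complex.normSq_eq_conj_mul_self, Complex.ofReal_re,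
      Complex.normSq_eq_norm_sq]
  simp only [e1] at h2
  convert h2 using 1
  norm_cast

theorem HilbertBasis.summable_norm_inner_sq {ι κ : Type*} (e : HilbertBasis ι ℂ H) {v : κ → H}
    (hv : Summable fun i => ‖v i‖ ^ 2) :
    Summable fun p : κ × ι => ‖⟪e p.2, v p.1⟫_ℂ‖ ^ 2 := by
  have h2 : ∀ i, HasSum (fun j => ‖⟪e j, v i⟫_ℂ‖ ^ 2) (‖v i‖ ^ 2) := fun i =>
    e.hasSum_norm_inner_sq (v i)
  have h0 : 0 ≤ fun p : κ × ι => ‖⟪e p.2, v p.1⟫_ℂ‖ ^ 2 := fun p => sq_nonneg _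
  have h1 : (fun i => ∑' j, ‖⟪e j, v i⟫_ℂ‖ ^ 2) = fun i => ‖v i‖ ^ 2 := funext fun i =>
    (h2 i).tsum_eq
  have h3 := (summable_prod_of_nonneg h0).mpr ⟨fun i => (h2 i).summable, by
    change Summable (fun i => ∑' j, ‖⟪e j, v i⟫_ℂ‖ ^ 2)
    rw [h1]
    exact hv⟩
  exact h3

theorem HilbertBasis.summable_prod_inner_mul_inner {ι κ : Type*} (e : HilbertBasis ι ℂ H)
    {v w : κ → H}
    (hv : Summable fun i => ‖v i‖ ^ 2) (hw : Summable fun i => ‖w i‖ ^ 2) :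
    Summable fun p : κ × ι => ⟪v p.1, e p.2⟫_ℂ * ⟪e p.2, w p.1⟫_ℂ := by
  refine Summable.of_norm_bounded
    ((e.summable_norm_inner_sq hv).add (e.summable_norm_inner_sq hw)) fun p => ?_
  rw [norm_mul, norm_inner_symm]
  nlinarith [sq_nonneg (‖⟪e p.2, v p.1⟫_ℂ‖ - ‖⟪e p.2, w p.1⟫_ℂ‖),
    sq_nonneg (‖⟪e p.2, v p.1⟫_ℂ‖ + ‖⟪e p.2, w p.1⟫_ℂ‖)]

/-- Cyclicity of the trace for a bounded operator and a Hilbert–Schmidt square. -/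
theorem hasSum_inner_sqrt_of_hasSum {ι : Type*} (e : HilbertBasis ι ℂ H) {S T : H →L[ℂ] H}
    (hS : IsSelfAdjoint S) (hs : Summable fun i => ‖S (e i)‖ ^ 2) {t : ℂ}
    (h : HasSum (fun i => ⟪e i, T (S (S (e i)))⟫_ℂ) t) :
    HasSum (fun i => ⟪S (e i), T (S (e i))⟫_ℂ) t := by
  have sS : ∀ v w, ⟪S v, w⟫_ℂ = ⟪v, S w⟫_ℂ := fun v w => by
    conv_lhs => rw [← ContinuousLinearMap.isSelfAdjoint_iff'.mp hS]
    rw [ContinuousLinearMap.adjoint_inner_left]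
  have hT : Summable fun i => ‖T (S (e i))‖ ^ 2 := by
    refine Summable.of_nonneg_of_le (fun _ => sq_nonneg _) (fun i => ?_) (hs.mul_left (‖T‖ ^ 2))
    rw [← mul_pow]
    exact pow_le_pow_left₀ (norm_nonneg _) (T.le_opNorm _) 2
  -- The double series ⟨Seᵢ, eⱼ⟩⟨eⱼ, TSeᵢ⟩ converges absolutely because both families are square
  -- summable. Summing it in either order gives the two sides.
  obtain ⟨s, hsf⟩ := e.summable_prod_inner_mul_inner hs hT
  have h1 : HasSum (fun i => ⟪S (e i), T (S (e i))⟫_ℂ) s := by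
    have h3 : ∀ i, HasSum (fun j => ⟪S (e i), e j⟫_ℂ * ⟪e j, T (S (e i))⟫_ℂ)
      ⟪S (e i), T (S (e i))⟫_ℂ := fun i => e.hasSum_inner_mul_inner _ _
    exact hsf.prod_fiberwise h3
  have h2 : HasSum (fun i => ⟪e i, T (S (S (e i)))⟫_ℂ) s := by
    have hsf' : HasSum (fun p : ι × ι => ⟪S (e p.2), e p.1⟫_ℂ * ⟪e p.1, T (S (e p.2))⟫_ℂ) s :=
      (Equiv.prodComm ι ι).hasSum_iff.mpr hsf
    refine hsf'.prod_fiberwise fun i => ?_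
    have h3 := e.hasSum_inner_mul_inner (S (T.adjoint (e i))) (S (e i))
    have h4 : ⟪S (T.adjoint (e i)), S (e i)⟫_ℂ = ⟪e i, T (S (S (e i)))⟫_ℂ := by
      rw [sS, ContinuousLinearMap.adjoint_inner_left]
    have h5 : (fun j => ⟪S (T.adjoint (e i)), e j⟫_ℂ * ⟪e j, S (e i)⟫_ℂ) =
        fun j => ⟪S (e j), e i⟫_ℂ * ⟪e i, T (S (e j))⟫_ℂ := by
      funext j
      rw [sS, ContinuousLinearMap.adjoint_inner_left, sS, mul_comm]
    rw [h4, h5] at h3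
    exact h3
  rwa [h2.unique h] at h1

end Trace

/-! ### Equivalence determines the correlation -/

section LocalIsometries

theorem inner_eq_of_intertwine {H G Q L : Type*} [NormedAddCommGroup H] [InnerProductSpace ℂ H]
    [NormedAddCommGroup G] [InnerProductSpace ℂ G] [NormedAddCommGroup Q] [InnerProductSpace ℂ Q]
    [NormedAddCommGroup L] [InnerProductSpace ℂ L] {f : H →L[ℂ] G} {g : Q →ₗ[ℂ] (L →L[ℂ] G)}
    {ς : L} (hς : ‖ς‖ = 1) (hf : ∀ ξ η, ⟪f ξ, f η⟫_ℂ = ⟪ξ, η⟫_ℂ)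
    (hg : ∀ φ φ', ⟪g φ ς, g φ' ς⟫_ℂ = ⟪φ, φ'⟫_ℂ * ⟪ς, ς⟫_ℂ)
    {v : Fin 2 → Fin 2 → H} {w : Fin 2 → Fin 2 → Q} (h : ∀ a b, f (v a b) = g (w a b) ς)
    {v' : H} {w' : Q} (h' : f v' = g w' ς) :
    ⟪∑ a, ∑ b, v a b, v'⟫_ℂ = ⟪∑ a, ∑ b, w a b, w'⟫_ℂ := by
  have h1 : f (∑ a, ∑ b, v a b) = g (∑ a, ∑ b, w a b) ς := by
    simp only [map_sum, h, sum_apply]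
  rw [← hf, h1, h', hg, inner_self_eq_norm_sq_to_K, hς]
  simp

/-- Summing the equivalence over the outcomes of setting 0 shows that ψ itself goes to the reference
state with the same junk. Probabilities are inner products of ψ with the measured vectors, and these
are preserved since the junk is a unit vector. -/
theorem correlation_eq_of_equiv {HA HB : Type u}
    [NormedAddCommGroup HA] [InnerProductSpace ℂ HA] [CompleteSpace HA]
    [NormedAddCommGroup HB] [InnerProductSpace ℂ HB] [CompleteSpace HB]
    {ψ : HilbertTensor HA HB}
    {M : Fin 2 → Fin 2 → (HA →L[ℂ] HA)} {N : Fin 2 → Fin 2 → (HB →L[ℂ] HB)}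
    {P : Correlation} {R : QubitStrategy} (hP : Realizes ψ M N P)
    (hR : ∑ a, R.alice 0 a = 1) (hR' : ∑ b, R.bob 0 b = 1)
    (h : EquivUpToLocalIsometries ψ M N R) : P = R.correlation := by
  obtain ⟨-, hM, hN, hMN⟩ := hP
  obtain ⟨JA, JB, _, _, _, _, _, _, ΦA, ΦB, ς, hς, h⟩ := h
  funext a b x y
  have h1 := inner_eq_of_intertwine hς (inner_opTensor_isometry ΦA ΦB)
    (fun φ φ' => inner_attach φ φ' ς ς) (fun a b => h a b 0 0) (h a b x y)
  have h2 : ∑ a, ∑ b, opTensor (M 0 a) (N 0 b) ψ = ψ := by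
    have h3 : opTensor (∑ a, M 0 a) (∑ b, N 0 b) ψ = ψ := by
      rw [(hM 0).2, (hN 0).2, opTensor_one_one, one_apply_eq_self]
    simpa only [Fin.sum_univ_two, opTensor_add_left, opTensor_add_right, add_apply,
      add_assoc, add_left_comm] using h3
  have h3 : ∑ a, ∑ b, TensorProduct.mapL (R.alice 0 a) (R.bob 0 b) R.state = R.state := by
    have h4 : TensorProduct.mapL (∑ a, R.alice 0 a) (∑ b, R.bob 0 b) R.state = R.state := by
      rw [hR, hR']
      exact DFunLike.congr_fun TensorProduct.mapL_id_id _
    simpa only [Fin.sum_univ_two, TensorProduct.mapL_add_left, TensorProduct.mapL_add_right,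
      add_apply, add_assoc, add_left_comm] using h4
  rw [h2, h3, hMN] at h1
  rw [QubitStrategy.correlation, ← h1, Complex.ofReal_re]

end LocalIsometries

/-! ### Mixed states -/

section MixedStates

theorem ContinuousLinearMap.IsPositive.exists_sqrt {H : Type*} [NormedAddCommGroup H]
    [InnerProductSpace ℂ H] [CompleteSpace H] {T : H →L[ℂ] H} (hT : T.IsPositive) :
    ∃ S : H →L[ℂ] H, IsSelfAdjoint S ∧ S * S = T := by
  have h := (ContinuousLinearMap.nonneg_iff_isPositive T).mpr hT
  exact ⟨CFC.sqrt T, .of_nonneg (CFC.sqrt_nonneg T), CFC.sqrt_mul_sqrt_self T h⟩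

theorem ContinuousLinearMap.IsPositive.opTensor {E F : Type*}
    [NormedAddCommGroup E] [InnerProductSpace ℂ E] [CompleteSpace E]
    [NormedAddCommGroup F] [InnerProductSpace ℂ F] [CompleteSpace F]
    {S : E →L[ℂ] E} {T : F →L[ℂ] F} (hS : S.IsPositive) (hT : T.IsPositive) :
    (opTensor S T).IsPositive := by
  obtain ⟨S', sS, rfl⟩ := hS.exists_sqrt
  obtain ⟨T', sT, rfl⟩ := hT.exists_sqrt
  have h := ContinuousLinearMap.isPositive_adjoint_comp_self (_root_.opTensor S' T')
  rw [ContinuousLinearMap.isSelfAdjoint_iff'.mp (sS.opTensor sT), opTensor_comp] at h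
  exact h

theorem ContinuousLinearMap.IsPositive.inner_eq_re {H : Type*} [NormedAddCommGroup H]
    [InnerProductSpace ℂ H] {T : H →L[ℂ] H} (hT : T.IsPositive) (v : H) :
    ⟪v, T v⟫_ℂ = ((⟪v, T v⟫_ℂ).re : ℂ) ∧ 0 ≤ (⟪v, T v⟫_ℂ).re := by
  have h := Complex.nonneg_iff.mp (hT.inner_nonneg_right v)
  exact ⟨Complex.ext rfl (by rw [Complex.ofReal_im, ← h.2]), h.1⟩

theorem chsh_smul (r : ℝ) (P : Correlation) : chsh (r • P) = r * chsh P := by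
  simp only [chsh, Fin.sum_univ_two, Pi.smul_apply, smul_eq_mul]
  ring

theorem hasSum_chsh {ι : Type*} {Q : ι → Correlation} {P : Correlation}
    (h : ∀ a b x y, HasSum (fun i => Q i a b x y) (P a b x y)) :
    HasSum (fun i => chsh (Q i)) (chsh P) :=
  hasSum_sum fun x _ => hasSum_sum fun y _ => hasSum_sum fun a _ => hasSum_sum fun b _ =>
    (h a b x y).mul_left _

theorem sum_refMeasurement (α : ℝ) (x : Fin 2) : ∑ a, refMeasurement α x a = 1 := by
  simp only [Fin.sum_univ_two, refMeasurement_eq, outcomeOp_zero_add_one]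

/-- The homogeneous form of the pure-state result, for unnormalized vectors, so that it can be
summed over a decomposition of a density operator; zero vectors are allowed there. -/
theorem chsh_le_and_eq_of_vector {HA HB : Type u}
    [NormedAddCommGroup HA] [InnerProductSpace ℂ HA] [CompleteSpace HA]
    [NormedAddCommGroup HB] [InnerProductSpace ℂ HB] [CompleteSpace HB]
    {γ θ : ℝ} (hγ : γ ^ 3 - 9 * γ ^ 2 - γ + 1 = 0) (hγ1 : 0.28 < γ) (hγ2 : γ < 0.29)
    (hθ : Real.cos θ ≠ 0)
    (hκ : Real.sin θ / √2 = (13 + 44 * γ - 5 * γ ^ 2) / 8 * √(1 - γ ^ 2) * Real.cos θ)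
    {φ : HilbertTensor HA HB}
    {M : Fin 2 → Fin 2 → (HA →L[ℂ] HA)} {N : Fin 2 → Fin 2 → (HB →L[ℂ] HB)}
    (hM : ∀ x, IsPOVM (M x)) (hN : ∀ y, IsPOVM (N y)) {Q : Correlation}
    (hQ : ∀ a b x y, ⟪φ, opTensor (M x a) (N y b) φ⟫_ℂ = (Q a b x y : ℂ)) (h0 : Q 0 0 0 0 = 0) :
    chsh Q ≤ (1 + 6 * γ - γ ^ 2) * ‖φ‖ ^ 2 ∧ (chsh Q = (1 + 6 * γ - γ ^ 2) * ‖φ‖ ^ 2 →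
      Q = ‖φ‖ ^ 2 • (refStrategy θ (Real.arccos γ)).correlation) := by
  by_cases hφ : φ = 0
  · have hQ0 : Q = (0 : ℝ) • (refStrategy θ (Real.arccos γ)).correlation := by
      rw [zero_smul]
      funext a b x y
      have h := hQ a b x y
      rw [hφ, inner_zero_left] at h
      exact_mod_cast h.symm
    have hc : chsh Q = 0 := by rw [hQ0, chsh_smul, zero_mul]
    rw [hc, hφ, norm_zero, zero_pow two_ne_zero, mul_zero]
    exact ⟨le_rfl, fun _ => hQ0⟩
  · have hn : ‖φ‖ ≠ 0 := norm_ne_zero_iff.mpr hφ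
    have hn2 : 0 < ‖φ‖ ^ 2 := by positivity
    have hr : Realizes (((‖φ‖⁻¹ : ℝ) : ℂ) • φ) M N ((‖φ‖ ^ 2)⁻¹ • Q) := by
      refine ⟨?_, hM, hN, fun a b x y => ?_⟩
      · rw [norm_smul, Complex.norm_real, norm_inv, norm_norm, inv_mul_cancel₀ hn]
      · rw [map_smul, inner_smul_left, inner_smul_right, hQ, Complex.conj_ofReal]
        simp only [Pi.smul_apply, smul_eq_mul]
        push_cast
        ring
    obtain ⟨h1, h2⟩ := chsh_le_and_equiv_of_realizes hγ hγ1 hγ2 hθ hκ hr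
      (by simp only [Pi.smul_apply, h0, smul_zero])
    rw [chsh_smul] at h1 h2
    refine ⟨?_, fun heq => ?_⟩
    · rwa [inv_mul_le_iff₀ hn2, mul_comm] at h1
    · have h3 := correlation_eq_of_equiv hr (sum_refMeasurement _ 0) (sum_refMeasurement _ 0)
        (h2 (by rw [heq]; field_simp))
      rw [← h3, smul_smul, mul_inv_cancel₀ hn2.ne', one_smul]

/-- A density operator decomposes into vectors (its square root applied to a basis), and so do the
expectations of a family of positive operators. -/
theorem IsDensityOperator.exists_decomposition {H : Type u} [NormedAddCommGroup H]
    [InnerProductSpace ℂ H] [CompleteSpace H] {ρ : H →L[ℂ] H} (hρ : IsDensityOperator ρ)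
    {T : Fin 2 → Fin 2 → Fin 2 → Fin 2 → (H →L[ℂ] H)} (hT : ∀ a b x y, (T a b x y).IsPositive)
    {P : Correlation} (hP : ∀ a b x y, HasTrace (T a b x y ∘L ρ) (P a b x y : ℂ)) :
    ∃ (ι : Type u) (φ : ι → H) (Q : ι → Correlation), HasSum (fun i => ‖φ i‖ ^ 2) 1 ∧
      (∀ i a b x y, ⟪φ i, T a b x y (φ i)⟫_ℂ = (Q i a b x y : ℂ)) ∧
      (∀ i a b x y, 0 ≤ Q i a b x y) ∧
      ∀ a b x y, HasSum (fun i => Q i a b x y) (P a b x y) := by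
  obtain ⟨hρ, hρ1⟩ := hρ
  obtain ⟨S, sS, rfl⟩ := hρ.exists_sqrt
  obtain ⟨ι, e, -⟩ := exists_hilbertBasis ℂ H
  have hs : HasSum (fun i => ‖S (e i)‖ ^ 2) 1 := by
    have h := Complex.hasSum_re (hρ1 ι e)
    have h2 : (fun i => (⟪e i, (S * S) (e i)⟫_ℂ).re) = fun i => ‖S (e i)‖ ^ 2 := by
      funext i
      have h3 : ⟪e i, (S * S) (e i)⟫_ℂ = ⟪S (e i), S (e i)⟫_ℂ := by
        conv_rhs => rw [← ContinuousLinearMap.adjoint_inner_right,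
          ContinuousLinearMap.isSelfAdjoint_iff'.mp sS]
        rfl
      rw [h3, inner_self_eq_norm_sq_to_K]
      norm_cast
    rw [Complex.one_re, h2] at h
    exact h
  refine ⟨ι, fun i => S (e i), fun i a b x y => (⟪S (e i), T a b x y (S (e i))⟫_ℂ).re, hs,
    fun i a b x y => ((hT a b x y).inner_eq_re _).1,
    fun i a b x y => ((hT a b x y).inner_eq_re _).2, fun a b x y => ?_⟩
  exact Complex.hasSum_re (hasSum_inner_sqrt_of_hasSum e sS hs.summable (hP a b x y ι e))

/-- The bound is summed over the vectors √ρ eᵢ. In the equality case the nonnegative deficits sum to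
zero, so each vector is extremal and contributes the reference correlation with weight ‖√ρ eᵢ‖²; the
weights sum to one. -/
theorem chsh_le_and_eq_of_mem_quantumClassOne
    {γ θ : ℝ} (hγ : γ ^ 3 - 9 * γ ^ 2 - γ + 1 = 0) (hγ1 : 0.28 < γ) (hγ2 : γ < 0.29)
    (hθ : Real.cos θ ≠ 0)
    (hκ : Real.sin θ / √2 = (13 + 44 * γ - 5 * γ ^ 2) / 8 * √(1 - γ ^ 2) * Real.cos θ)
    {P : Correlation} (hP : P ∈ quantumClassOne.{u}) :
    chsh P ≤ 1 + 6 * γ - γ ^ 2 ∧ (chsh P = 1 + 6 * γ - γ ^ 2 →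
      P = (refStrategy θ (Real.arccos γ)).correlation) := by
  obtain ⟨⟨HA, HB, _, _, _, _, _, _, ρ, M, N, hρ, hM, hN, hMN⟩, h0⟩ := hP
  obtain ⟨ι, φ, Q, hs, hQ, hnn, hsum⟩ := hρ.exists_decomposition
    (T := fun a b x y => opTensor (M x a) (N y b))
    (fun a b x y => ((hM x).1 a).opTensor ((hN y).1 b)) hMN
  -- A vanishing sum of nonnegative terms: the constraint P(0,0|0,0) = 0 passes to every vector.
  have hzero : ∀ i, Q i 0 0 0 0 = 0 := by
    have h := hsum 0 0 0 0
    rw [h0, hasSum_zero_iff_of_nonneg fun i => hnn i 0 0 0 0] at h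
    exact fun i => congrFun h i
  have hv := fun i => chsh_le_and_eq_of_vector hγ hγ1 hγ2 hθ hκ hM hN (hQ i) (hzero i)
  have hc := hasSum_chsh hsum
  have hl := hs.mul_left (1 + 6 * γ - γ ^ 2)
  rw [mul_one] at hl
  refine ⟨hasSum_le (fun i => (hv i).1) hc hl, fun heq => ?_⟩
  have hd := hl.sub hc
  rw [heq, sub_self, hasSum_zero_iff_of_nonneg (fun i => sub_nonneg.mpr (hv i).1)] at hd
  have hQeq : ∀ i, Q i = ‖φ i‖ ^ 2 • (refStrategy θ (Real.arccos γ)).correlation := fun i =>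
    (hv i).2 (sub_eq_zero.mp (congrFun hd i)).symm
  funext a b x y
  have h1 := hs.mul_right ((refStrategy θ (Real.arccos γ)).correlation a b x y)
  rw [one_mul] at h1
  have h2 : (fun i => Q i a b x y) =
      fun i => ‖φ i‖ ^ 2 * (refStrategy θ (Real.arccos γ)).correlation a b x y := funext fun i => by
    rw [hQeq]; rfl
  exact (h2 ▸ hsum a b x y).unique h1

end MixedStates

/-! ### Pure realizations give quantum correlations -/

section QuantumSet

theorem hasTrace_comp_rankOne {H : Type u} [NormedAddCommGroup H] [InnerProductSpace ℂ H]
    (T : H →L[ℂ] H) (ψ : H) :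
    HasTrace (T ∘L InnerProductSpace.rankOne ℂ ψ ψ) ⟪ψ, T ψ⟫_ℂ := by
  intro ι e
  have h := e.hasSum_inner_mul_inner ψ (T ψ)
  have h2 : (fun i => ⟪e i, (T ∘L InnerProductSpace.rankOne ℂ ψ ψ) (e i)⟫_ℂ) =
      fun i => ⟪ψ, e i⟫_ℂ * ⟪e i, T ψ⟫_ℂ := funext fun i => by
    rw [ContinuousLinearMap.comp_apply, InnerProductSpace.rankOne_apply, map_smul,
      inner_smul_right]
  rw [h2]
  exact h

theorem isDensityOperator_rankOne {H : Type u} [NormedAddCommGroup H] [InnerProductSpace ℂ H]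
    {ψ : H} (h : ‖ψ‖ = 1) : IsDensityOperator (InnerProductSpace.rankOne ℂ ψ ψ) := by
  refine ⟨InnerProductSpace.isPositive_rankOne_self ψ, ?_⟩
  have h2 := hasTrace_comp_rankOne (1 : H →L[ℂ] H) ψ
  rw [one_apply_eq_self, inner_self_eq_norm_sq_to_K, h, RCLike.ofReal_one, one_pow] at h2
  exact h2

theorem Realizes.mem_quantumSet {HA HB : Type u}
    [NormedAddCommGroup HA] [InnerProductSpace ℂ HA] [CompleteSpace HA]
    [NormedAddCommGroup HB] [InnerProductSpace ℂ HB] [CompleteSpace HB]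
    {ψ : HilbertTensor HA HB}
    {M : Fin 2 → Fin 2 → (HA →L[ℂ] HA)} {N : Fin 2 → Fin 2 → (HB →L[ℂ] HB)}
    {P : Correlation} (h : Realizes ψ M N P) : P ∈ quantumSet.{u} :=
  ⟨HA, HB, _, _, inferInstance, _, _, inferInstance, InnerProductSpace.rankOne ℂ ψ ψ, M, N,
    isDensityOperator_rankOne h.1, h.2.1, h.2.2.1, fun a b x y => by
      rw [← h.2.2.2 a b x y]; exact hasTrace_comp_rankOne _ _⟩

theorem IsPOVM.conj {E E' : Type*} [NormedAddCommGroup E] [InnerProductSpace ℂ E] [CompleteSpace E]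
    [NormedAddCommGroup E'] [InnerProductSpace ℂ E'] [CompleteSpace E'] (U : E ≃ₗᵢ[ℂ] E')
    {M : Fin 2 → (E →L[ℂ] E)} (h : IsPOVM M) :
    IsPOVM fun a => U.toLinearIsometry.toContinuousLinearMap ∘L M a ∘L
      U.toLinearIsometry.toContinuousLinearMap.adjoint := by
  refine ⟨fun a => (h.1 a).conj_adjoint _, ?_⟩
  have h1 : M 0 + M 1 = 1 := by rw [← h.2, Fin.sum_univ_two]
  rw [Fin.sum_univ_two, ← ContinuousLinearMap.comp_add, ← ContinuousLinearMap.add_comp, h1]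
  ext v
  obtain ⟨w, rfl⟩ := U.surjective v
  have h2 : U.toLinearIsometry.toContinuousLinearMap.adjoint (U w) = w :=
    DFunLike.congr_fun U.toLinearIsometry.adjoint_comp_toContinuousLinearMap w
  change U (U.toLinearIsometry.toContinuousLinearMap.adjoint (U w)) = U w
  rw [h2]

theorem LinearIsometry.adjoint_comp_conj_comp {E E' : Type*} [NormedAddCommGroup E]
    [InnerProductSpace ℂ E] [CompleteSpace E] [NormedAddCommGroup E'] [InnerProductSpace ℂ E']
    [CompleteSpace E'] (V : E →ₗᵢ[ℂ] E') (S : E →L[ℂ] E) :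
    V.toContinuousLinearMap.adjoint ∘L (V.toContinuousLinearMap ∘L S ∘L
      V.toContinuousLinearMap.adjoint) ∘L V.toContinuousLinearMap = S := by
  have hV : ∀ v, V.toContinuousLinearMap.adjoint (V v) = v :=
    DFunLike.congr_fun V.adjoint_comp_toContinuousLinearMap
  ext v
  change V.toContinuousLinearMap.adjoint (V (S (V.toContinuousLinearMap.adjoint (V v)))) = S v
  rw [hV, hV]

theorem Realizes.conj {E F E' F' : Type*}
    [NormedAddCommGroup E] [InnerProductSpace ℂ E] [CompleteSpace E]
    [NormedAddCommGroup F] [InnerProductSpace ℂ F] [CompleteSpace F]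
    [NormedAddCommGroup E'] [InnerProductSpace ℂ E'] [CompleteSpace E']
    [NormedAddCommGroup F'] [InnerProductSpace ℂ F'] [CompleteSpace F']
    (U : E ≃ₗᵢ[ℂ] E') (W : F ≃ₗᵢ[ℂ] F') {ψ : HilbertTensor E F}
    {M : Fin 2 → Fin 2 → (E →L[ℂ] E)} {N : Fin 2 → Fin 2 → (F →L[ℂ] F)}
    {P : Correlation} (h : Realizes ψ M N P) :
    Realizes (opTensor U.toLinearIsometry.toContinuousLinearMap
        W.toLinearIsometry.toContinuousLinearMap ψ)
      (fun x a => U.toLinearIsometry.toContinuousLinearMap ∘L M x a ∘L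
        U.toLinearIsometry.toContinuousLinearMap.adjoint)
      (fun y b => W.toLinearIsometry.toContinuousLinearMap ∘L N y b ∘L
        W.toLinearIsometry.toContinuousLinearMap.adjoint) P := by
  refine ⟨norm_eq_one_of_inner_eq (inner_opTensor_isometry _ _ _ _) h.1, fun x => (h.2.1 x).conj U,
    fun y => (h.2.2.1 y).conj W, fun a b x y => ?_⟩
  rw [inner_opTensor_compression, U.toLinearIsometry.adjoint_comp_conj_comp,
    W.toLinearIsometry.adjoint_comp_conj_comp, h.2.2.2]

end QuantumSet

/-! ### The reference strategy and its CHSH value -/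

section Reference

theorem IsPOVM.outcomeOp {E : Type*} [NormedAddCommGroup E] [InnerProductSpace ℂ E]
    [CompleteSpace E] {A : E →L[ℂ] E} (sA : IsSelfAdjoint A) (iA : A * A = 1) :
    IsPOVM (outcomeOp A) := by
  refine ⟨fun a => ?_, by rw [Fin.sum_univ_two, outcomeOp_zero_add_one]⟩
  have h := ContinuousLinearMap.isPositive_adjoint_comp_self (_root_.outcomeOp A a)
  rw [ContinuousLinearMap.isSelfAdjoint_iff'.mp (isSelfAdjoint_outcomeOp sA a)] at h
  exact (outcomeOp_mul_self iA a) ▸ h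

theorem IsSelfAdjoint.real_smul_add_real_smul {E : Type*} [NormedAddCommGroup E]
    [InnerProductSpace ℂ E] [CompleteSpace E] {Z X : E →L[ℂ] E} (hZ : IsSelfAdjoint Z)
    (hX : IsSelfAdjoint X) (a b : ℝ) : IsSelfAdjoint ((a : ℂ) • Z + (b : ℂ) • X) := by
  rw [IsSelfAdjoint, star_add, star_smul, star_smul, hZ.star_eq, hX.star_eq]
  simp

theorem smul_add_smul_mul_self {E : Type*} [NormedAddCommGroup E] [InnerProductSpace ℂ E]
    {Z X : E →L[ℂ] E} (hZ : Z * Z = 1) (hX : X * X = 1) (h : Z * X = -(X * Z)) {a b : ℝ}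
    (hab : a ^ 2 + b ^ 2 = 1) :
    ((a : ℂ) • Z + (b : ℂ) • X) * ((a : ℂ) • Z + (b : ℂ) • X) = 1 := by
  have hab' : (a : ℂ) * a + b * b = 1 := by rw [← sq, ← sq]; exact_mod_cast hab
  have h1 : ((a : ℂ) • Z + (b : ℂ) • X) * ((a : ℂ) • Z + (b : ℂ) • X) =
      ((a : ℂ) * a + b * b) • (1 : E →L[ℂ] E) := by
    simp only [add_mul, mul_add, smul_mul_smul_comm, hZ, hX, h]
    module
  rw [h1, hab', one_smul]

theorem refObservable_zero (α : ℝ) :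
    refObservable α 0 = ((1 : ℝ) : ℂ) • pauliZ + ((0 : ℝ) : ℂ) • pauliX := by
  rw [Complex.ofReal_one, Complex.ofReal_zero]
  exact ((congrArg₂ (· + ·) (one_smul ℂ pauliZ) (zero_smul ℂ pauliX)).trans (add_zero _)).symm

theorem refObservable_eq (α : ℝ) (x : Fin 2) :
    ∃ a b : ℝ, a ^ 2 + b ^ 2 = 1 ∧
      refObservable α x = (a : ℂ) • pauliZ + (b : ℂ) • pauliX := by
  fin_cases x
  · exact ⟨1, 0, by norm_num, refObservable_zero α⟩
  · exact ⟨Real.cos α, Real.sin α, Real.cos_sq_add_sin_sq α, by simp [refObservable]⟩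

theorem isSelfAdjoint_pauliZ : IsSelfAdjoint pauliZ := by
  rw [IsSelfAdjoint, pauliZ, ← map_star]
  congr 1
  ext i j; fin_cases i <;> fin_cases j <;> simp

theorem isSelfAdjoint_pauliX : IsSelfAdjoint pauliX := by
  rw [IsSelfAdjoint, pauliX, ← map_star]
  congr 1
  ext i j; fin_cases i <;> fin_cases j <;> simp

theorem isSelfAdjoint_refObservable (α : ℝ) (x : Fin 2) : IsSelfAdjoint (refObservable α x) := by
  obtain ⟨a, b, -, h⟩ := refObservable_eq α x
  rw [h]
  exact isSelfAdjoint_pauliZ.real_smul_add_real_smul isSelfAdjoint_pauliX a b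

theorem pauliZ_mul_self : pauliZ * pauliZ = 1 := by
  rw [pauliZ, ← map_mul, ← map_one (Matrix.toEuclideanCLM (n := Fin 2) (𝕜 := ℂ))]
  congr 1
  ext i j; fin_cases i <;> fin_cases j <;> simp

theorem pauliX_mul_self : pauliX * pauliX = 1 := by
  rw [pauliX, ← map_mul, ← map_one (Matrix.toEuclideanCLM (n := Fin 2) (𝕜 := ℂ))]
  congr 1
  ext i j; fin_cases i <;> fin_cases j <;> simp

theorem pauliZ_mul_pauliX : pauliZ * pauliX = -(pauliX * pauliZ) := by
  rw [pauliZ, pauliX, ← map_mul (Matrix.toEuclideanCLM (n := Fin 2) (𝕜 := ℂ)),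
    ← map_mul (Matrix.toEuclideanCLM (n := Fin 2) (𝕜 := ℂ)),
    ← map_neg (Matrix.toEuclideanCLM (n := Fin 2) (𝕜 := ℂ))]
  congr 1
  ext i j; fin_cases i <;> fin_cases j <;> simp

theorem refObservable_mul_self (α : ℝ) (x : Fin 2) :
    refObservable α x * refObservable α x = 1 := by
  obtain ⟨a, b, hab, h⟩ := refObservable_eq α x
  rw [h]
  exact smul_add_smul_mul_self pauliZ_mul_self pauliX_mul_self pauliZ_mul_pauliX hab

theorem isPOVM_refMeasurement (α : ℝ) (x : Fin 2) : IsPOVM (refMeasurement α x) :=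
  IsPOVM.outcomeOp (isSelfAdjoint_refObservable α x) (refObservable_mul_self α x)

theorem inner_coe_opTensor_coe {E F : Type*} [NormedAddCommGroup E] [InnerProductSpace ℂ E]
    [NormedAddCommGroup F] [InnerProductSpace ℂ F] (S : E →L[ℂ] E) (T : F →L[ℂ] F)
    (φ : E ⊗[ℂ] F) :
    ⟪(φ : HilbertTensor E F), opTensor S T (φ : HilbertTensor E F)⟫_ℂ =
      ⟪φ, TensorProduct.mapL S T φ⟫_ℂ := by
  rw [opTensor_coe, UniformSpace.Completion.inner_coe]

theorem realizes_refStrategy (θ α : ℝ) :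
    Realizes ((refStrategy θ α).state : HilbertTensor Qubit Qubit) (refStrategy θ α).alice
      (refStrategy θ α).bob (refStrategy θ α).correlation := by
  refine ⟨?_, isPOVM_refMeasurement α, isPOVM_refMeasurement α, fun a b x y => ?_⟩
  · refine norm_eq_one_of_inner_eq (w := (1 : ℂ)) ?_ norm_one
    rw [UniformSpace.Completion.inner_coe, norm_refState]
    simp
  · rw [QubitStrategy.correlation, ← inner_coe_opTensor_coe]
    exact (((isPOVM_refMeasurement α x).1 a).opTensor
      ((isPOVM_refMeasurement α y).1 b)).inner_eq_re _ |>.1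

/-- The qubit lives in the lowest universe, so the strategy is transported along a relabelling of
the basis by `ULift` to reach universe `u`. -/
theorem refCorrelation_mem_quantumSet (θ α : ℝ) :
    (refStrategy θ α).correlation ∈ quantumSet.{u} :=
  ((realizes_refStrategy θ α).conj
    (LinearIsometryEquiv.piLpCongrLeft 2 ℂ ℂ (Equiv.ulift.{u} (α := Fin 2)).symm)
    (LinearIsometryEquiv.piLpCongrLeft 2 ℂ ℂ (Equiv.ulift.{u} (α := Fin 2)).symm)).mem_quantumSet

/-- Outcome 0 of σ_z annihilates |1⟩, and the state has no |00⟩ component. -/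
theorem refCorrelation_zero (θ α : ℝ) : (refStrategy θ α).correlation 0 0 0 0 = 0 := by
  have h0 : refMeasurement α 0 0 (ket 1) = 0 := by
    change (1 / 2 : ℂ) • (ket 1 + (-1 : ℂ) ^ 0 • pauliZ (ket 1)) = 0
    rw [pauliZ_ket_one]; simp
  have h : TensorProduct.mapL (refMeasurement α 0 0) (refMeasurement α 0 0)
      (refStrategy θ α).state = 0 := by
    rw [refState_eq]
    simp only [map_add, TensorProduct.mapL_tmul, map_smul, h0, smul_zero, TensorProduct.zero_tmul,
      TensorProduct.tmul_zero, add_zero]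
  rw [QubitStrategy.correlation]
  change (⟪(refStrategy θ α).state, TensorProduct.mapL (refMeasurement α 0 0) (refMeasurement α 0 0)
      (refStrategy θ α).state⟫_ℂ).re = 0
  rw [h, inner_zero_right, Complex.zero_re]

theorem inner_refState_mapL (θ α : ℝ) {A B : Qubit →L[ℂ] Qubit} {a b a' b' : ℝ}
    (hA : A = (a : ℂ) • pauliZ + (b : ℂ) • pauliX)
    (hB : B = (a' : ℂ) • pauliZ + (b' : ℂ) • pauliX) :
    ⟪(refStrategy θ α).state, TensorProduct.mapL A B (refStrategy θ α).state⟫_ℂ =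
      ((2 * (Real.sin θ / √2) ^ 2 * (b * b' - a * a') -
        2 * (Real.sin θ / √2) * Real.cos θ * (b * a' + a * b') +
        Real.cos θ ^ 2 * (a * a') : ℝ) : ℂ) := by
  have hA0 : A (ket 0) = (a : ℂ) • ket 0 + (b : ℂ) • ket 1 := by
    rw [hA, add_apply, smul_apply, smul_apply, pauliZ_ket_zero, pauliX_ket_zero]
  have hA1 : A (ket 1) = (b : ℂ) • ket 0 + (-a : ℂ) • ket 1 := by
    rw [hA, add_apply, smul_apply, smul_apply, pauliZ_ket_one, pauliX_ket_one]; module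
  have hB0 : B (ket 0) = (a' : ℂ) • ket 0 + (b' : ℂ) • ket 1 := by
    rw [hB, add_apply, smul_apply, smul_apply, pauliZ_ket_zero, pauliX_ket_zero]
  have hB1 : B (ket 1) = (b' : ℂ) • ket 0 + (-a' : ℂ) • ket 1 := by
    rw [hB, add_apply, smul_apply, smul_apply, pauliZ_ket_one, pauliX_ket_one]; module
  obtain ⟨r, hr⟩ : ∃ r, r = Real.sin θ / √2 := ⟨_, rfl⟩
  rw [refState_eq, ← hr]
  simp only [map_add, map_smul, TensorProduct.mapL_tmul, hA0, hA1, hB0, hB1]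
  simp only [inner_add_left, inner_add_right, inner_smul_left, inner_smul_right,
    TensorProduct.inner_tmul, inner_ket, Complex.conj_ofReal]
  simp only [zero_ne_one, one_ne_zero, if_true, if_false, mul_zero, mul_one, add_zero, zero_add]
  push_cast
  ring

/-- After sin θ/√2 = κ sin α cos θ is substituted, the value is cos²θ times a polynomial in γ, which
reduces to the claimed number modulo the cubic. -/
theorem chsh_refCorrelation {γ θ α : ℝ} (hγ : γ ^ 3 - 9 * γ ^ 2 - γ + 1 = 0)
    (hα : Real.cos α = γ) (hs : Real.sin α ^ 2 = 1 - γ ^ 2)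
    (hθ : Real.cos θ ^ 2 = (2 - 6 * γ + γ ^ 2) / 7)
    (hκ : Real.sin θ / √2 = (13 + 44 * γ - 5 * γ ^ 2) / 8 * Real.sin α * Real.cos θ) :
    chsh (refStrategy θ α).correlation = 1 + 6 * γ - γ ^ 2 := by
  have h := chshExpectation_opTensor_eq_chsh
    (A₀ := refObservable α 0) (A₁ := refObservable α 1) (B₀ := refObservable α 0)
    (B₁ := refObservable α 1) (ψ := ((refStrategy θ α).state : HilbertTensor Qubit Qubit))
    (P := (refStrategy θ α).correlation) (fun a b x y => by
      have h1 := (realizes_refStrategy θ α).2.2.2 a b x y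
      fin_cases x <;> fin_cases y <;> exact h1)
  have e0 : refObservable α 0 = ((1 : ℝ) : ℂ) • pauliZ + ((0 : ℝ) : ℂ) • pauliX :=
    refObservable_zero α
  have e1 : refObservable α 1 = (γ : ℂ) • pauliZ + (Real.sin α : ℂ) • pauliX := by
    rw [← hα]; rfl
  have e : ∀ S T : Qubit →L[ℂ] Qubit,
      ⟪((refStrategy θ α).state : HilbertTensor Qubit Qubit), opTensor S (1 : Qubit →L[ℂ] Qubit)
        (opTensor (1 : Qubit →L[ℂ] Qubit) T (refStrategy θ α).state)⟫_ℂ =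
      ⟪(refStrategy θ α).state, TensorProduct.mapL S T (refStrategy θ α).state⟫_ℂ := fun S T => by
    rw [← inner_coe_opTensor_coe, ← mul_apply_eq_comp, ← opTensor_eq_mul]
  rw [← h, chshExpectation, inner_add_right, inner_sub_right, inner_sub_right, inner_neg_right,
    e, e, e, e, inner_refState_mapL θ α e0 e0, inner_refState_mapL θ α e0 e1,
    inner_refState_mapL θ α e1 e0, inner_refState_mapL θ α e1 e1, hκ]
  simp only [Complex.add_re, Complex.sub_re, Complex.neg_re, Complex.ofReal_re]
  obtain ⟨κ, hκ'⟩ : ∃ κ, κ = (13 + 44 * γ - 5 * γ ^ 2) / 8 := ⟨_, rfl⟩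
  rw [← hκ']
  obtain ⟨s, hs'⟩ : ∃ s, s = Real.sin α := ⟨_, rfl⟩
  rw [← hs'] at hs ⊢
  have h1 : ∀ q : ℝ, q ^ 2 = (2 - 6 * γ + γ ^ 2) / 7 →
      q ^ 2 * (2 * κ ^ 2 * s ^ 2 * (1 + 2 * γ + s ^ 2 - γ ^ 2) - 1 - 2 * γ + γ ^ 2 +
        4 * κ * s ^ 2 * (1 - γ)) = 1 + 6 * γ - γ ^ 2 := by
    intro q hq
    rw [hq, hs, hκ']
    linear_combination (201 / 56 + 89 / 8 * γ + 323 / 112 * γ ^ 2 - 1363 / 56 * γ ^ 3 -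
      359 / 112 * γ ^ 4 + 1551 / 112 * γ ^ 5 - 195 / 56 * γ ^ 6 + 25 / 112 * γ ^ 7) * hγ
  rw [← h1 _ hθ]
  ring

end Reference

/-! ### The algebraic numbers ξ₁, ξ₂, ξ₃ -/

theorem exists_root_cubic : ∃ γ : ℝ, γ ^ 3 - 9 * γ ^ 2 - γ + 1 = 0 ∧ 0.28620 < γ ∧ γ < 0.28621 := by
  have hc : ContinuousOn (fun x : ℝ => x ^ 3 - 9 * x ^ 2 - x + 1) (Set.Icc 0.28620 0.28621) := by
    fun_prop
  obtain ⟨γ, hγ, h0⟩ := intermediate_value_Ioo' (by norm_num) hc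
    (show (0 : ℝ) ∈ _ by constructor <;> norm_num)
  exact ⟨γ, h0, hγ.1, hγ.2⟩

theorem isLeast_root_gamma {γ : ℝ} (h : γ ^ 3 - 9 * γ ^ 2 - γ + 1 = 0) (h1 : 0.28620 < γ)
    (h2 : γ < 0.28621) : IsLeast {x : ℝ | 0 < x ∧ x ^ 3 - 9 * x ^ 2 - x + 1 = 0} γ := by
  refine ⟨⟨by linarith, h⟩, fun x hx => ?_⟩
  obtain ⟨hx0, hx⟩ := hx
  by_contra! hlt
  have h3 : (γ - x) * (9 * (γ + x) + 1 - (γ ^ 2 + γ * x + x ^ 2)) = 0 := by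
    linear_combination hx - h
  have h4 : 0 < 9 * (γ + x) + 1 - (γ ^ 2 + γ * x + x ^ 2) := by nlinarith
  exact (mul_pos (sub_pos.mpr hlt) h4).ne' h3

/-- All constants lie in ℚ(γ), and ξ₂ = (2 - 6γ + γ²)/7 = (3 - ξ₃)/7. A smaller positive root x is
excluded because the difference of the two cubic values is ξ - x times a factor that is positive for
0 < x < ξ. -/
theorem isLeast_root_cos_sq {γ : ℝ} (h : γ ^ 3 - 9 * γ ^ 2 - γ + 1 = 0) (h1 : 0.28620 < γ)
    (h2 : γ < 0.28621) :
    IsLeast {x : ℝ | 0 < x ∧ 7 * x ^ 3 - 35 * x ^ 2 + 21 * x - 1 = 0}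
      ((2 - 6 * γ + γ ^ 2) / 7) := by
  obtain ⟨ξ, hξ⟩ : ∃ ξ, ξ = (2 - 6 * γ + γ ^ 2) / 7 := ⟨_, rfl⟩
  have hξ1 : 0.05 < ξ := by rw [hξ]; nlinarith
  have hξ2 : ξ < 0.06 := by rw [hξ]; nlinarith
  have h0 : 7 * ξ ^ 3 - 35 * ξ ^ 2 + 21 * ξ - 1 = 0 := by
    rw [hξ]
    linear_combination (1 / 49 : ℝ) * (113 - γ - 9 * γ ^ 2 + γ ^ 3) * h
  rw [← hξ]
  refine ⟨⟨by linarith, h0⟩, fun x hx => ?_⟩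
  obtain ⟨hx0, hx⟩ := hx
  by_contra! hlt
  have h3 : (ξ - x) * (7 * (ξ ^ 2 + ξ * x + x ^ 2) - 35 * (ξ + x) + 21) = 0 := by
    linear_combination h0 - hx
  have h4 : 0 < 7 * (ξ ^ 2 + ξ * x + x ^ 2) - 35 * (ξ + x) + 21 := by nlinarith [mul_pos hx0 hx0]
  exact (mul_pos (sub_pos.mpr hlt) h4).ne' h3

theorem isLeast_root_chsh {γ : ℝ} (h : γ ^ 3 - 9 * γ ^ 2 - γ + 1 = 0) (h1 : 0.28620 < γ)
    (h2 : γ < 0.28621) :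
    IsLeast {x : ℝ | 0 < x ∧ x ^ 3 + 26 * x ^ 2 - 36 * x - 104 = 0} (1 + 6 * γ - γ ^ 2) := by
  obtain ⟨ξ, hξ⟩ : ∃ ξ, ξ = 1 + 6 * γ - γ ^ 2 := ⟨_, rfl⟩
  have hξ1 : 2.6 < ξ := by rw [hξ]; nlinarith
  have h0 : ξ ^ 3 + 26 * ξ ^ 2 - 36 * ξ - 104 = 0 := by
    rw [hξ]
    linear_combination (-113 + γ + 9 * γ ^ 2 - γ ^ 3) * h
  rw [← hξ]
  refine ⟨⟨by linarith, h0⟩, fun x hx => ?_⟩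
  obtain ⟨hx0, hx⟩ := hx
  by_contra! hlt
  have h3 : (ξ - x) * (ξ ^ 2 + ξ * x + x ^ 2 + 26 * (ξ + x) - 36) = 0 := by
    linear_combination h0 - hx
  have h4 : 0 < ξ ^ 2 + ξ * x + x ^ 2 + 26 * (ξ + x) - 36 := by
    have := mul_pos hx0 (show 0 < ξ by linarith)
    nlinarith
  exact (mul_pos (sub_pos.mpr hlt) h4).ne' h3

/-- Squared, this is the normalization cos²θ (1 + 2κ²(1 - γ²)) = 1 of the state with amplitudes κs,
κs, 1; it is how cos²θ = ξ₂ arises. The sign conditions allow taking the root. -/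
theorem sin_div_sqrt_two_eq {γ θ : ℝ} (h : γ ^ 3 - 9 * γ ^ 2 - γ + 1 = 0) (h1 : 0.28620 < γ)
    (h2 : γ < 0.28621) (hs0 : 0 ≤ Real.sin θ) (hc0 : 0 ≤ Real.cos θ)
    (hθ : Real.cos θ ^ 2 = (2 - 6 * γ + γ ^ 2) / 7) :
    Real.sin θ / √2 = (13 + 44 * γ - 5 * γ ^ 2) / 8 * √(1 - γ ^ 2) * Real.cos θ := by
  have hκ : 0 ≤ (13 + 44 * γ - 5 * γ ^ 2) / 8 := by nlinarith
  refine (sq_eq_sq₀ (by positivity) (by positivity)).mp ?_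
  rw [div_pow, mul_pow, mul_pow, Real.sq_sqrt (by norm_num), Real.sq_sqrt (by nlinarith),
    Real.sin_sq, hθ]
  linear_combination (-1 / 2 : ℝ) * (89 / 112 + 45 / 8 * γ - 527 / 224 * γ ^ 2 - 173 / 32 * γ ^ 3 +
    365 / 224 * γ ^ 4 - 25 / 224 * γ ^ 5) * h

end

/-! ### Assembly of the main theorem -/

theorem mainTheorem4 : ∃ ξ₁ ξ₂ ξ₃ : ℝ,
    IsLeast {x : ℝ | 0 < x ∧ x ^ 3 - 9 * x ^ 2 - x + 1 = 0} ξ₁ ∧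
    IsLeast {x : ℝ | 0 < x ∧ 7 * x ^ 3 - 35 * x ^ 2 + 21 * x - 1 = 0} ξ₂ ∧
    IsLeast {x : ℝ | 0 < x ∧ x ^ 3 + 26 * x ^ 2 - 36 * x - 104 = 0} ξ₃ ∧
    |ξ₁ - 0.2862| < 0.00005 ∧ |ξ₂ - 0.0521| < 0.00005 ∧ |ξ₃ - 2.6353| < 0.00005 ∧
    ∃ (R : QubitStrategy) (PQ4 : Correlation),
      R = refStrategy (Real.arccos √ξ₂) (Real.arccos ξ₁) ∧ PQ4 = R.correlation ∧
      IsGreatest (chsh '' quantumClassOne.{u}) ξ₃ ∧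
      PQ4 ∈ quantumClassOne.{u} ∧
      (∀ P ∈ quantumClassOne.{u}, chsh P = ξ₃ ↔ P = PQ4) ∧
      SelfTests.{u} PQ4 R ∧
      ∀ (HA HB : Type u)
        [NormedAddCommGroup HA] [InnerProductSpace ℂ HA] [CompleteSpace HA]
        [NormedAddCommGroup HB] [InnerProductSpace ℂ HB] [CompleteSpace HB]
        (ψ : HilbertTensor HA HB)
        (M : Fin 2 → Fin 2 → (HA →L[ℂ] HA)) (N : Fin 2 → Fin 2 → (HB →L[ℂ] HB))
        (P : Correlation),
        Realizes ψ M N P → P 0 0 0 0 = 0 → chsh P = ξ₃ →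
          EquivUpToLocalIsometries ψ M N R := by
  obtain ⟨γ, h, h1, h2⟩ := exists_root_cubic
  have g1 : 0.28 < γ := by linarith
  have g2 : γ < 0.29 := by linarith
  have hξ : 0 < (2 - 6 * γ + γ ^ 2) / 7 := by nlinarith
  have hξ1 : (2 - 6 * γ + γ ^ 2) / 7 < 1 := by nlinarith
  obtain ⟨θ, hθ⟩ : ∃ θ, θ = Real.arccos √((2 - 6 * γ + γ ^ 2) / 7) := ⟨_, rfl⟩
  have hcos : Real.cos θ = √((2 - 6 * γ + γ ^ 2) / 7) := by
    rw [hθ]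
    exact Real.cos_arccos (by linarith [Real.sqrt_nonneg ((2 - 6 * γ + γ ^ 2) / 7)])
      (Real.sqrt_le_one.mpr hξ1.le)
  have hcos2 : Real.cos θ ^ 2 = (2 - 6 * γ + γ ^ 2) / 7 := by rw [hcos, Real.sq_sqrt hξ.le]
  have hcos0 : 0 < Real.cos θ := by rw [hcos]; exact Real.sqrt_pos.mpr hξ
  have hsin0 : 0 ≤ Real.sin θ := by
    rw [hθ, Real.sin_arccos]; exact Real.sqrt_nonneg _
  have hκ := sin_div_sqrt_two_eq h h1 h2 hsin0 hcos0.le hcos2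
  have hα : Real.cos (Real.arccos γ) = γ := Real.cos_arccos (by linarith) (by linarith)
  have hcorr : chsh (refStrategy θ (Real.arccos γ)).correlation = 1 + 6 * γ - γ ^ 2 :=
    chsh_refCorrelation h hα (by rw [Real.sin_sq, hα]) hcos2 (by rw [Real.sin_arccos]; exact hκ)
  have hmem : (refStrategy θ (Real.arccos γ)).correlation ∈ quantumClassOne.{u} :=
    ⟨refCorrelation_mem_quantumSet _ _, refCorrelation_zero _ _⟩
  have hbound := fun P (hP : P ∈ quantumClassOne.{u}) =>
    chsh_le_and_eq_of_mem_quantumClassOne h g1 g2 hcos0.ne' hκ hP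
  refine ⟨γ, (2 - 6 * γ + γ ^ 2) / 7, 1 + 6 * γ - γ ^ 2, isLeast_root_gamma h h1 h2,
    isLeast_root_cos_sq h h1 h2, isLeast_root_chsh h h1 h2, ?_, ?_, ?_,
    refStrategy θ (Real.arccos γ), _, by rw [hθ], rfl, ⟨⟨_, hmem, hcorr⟩, ?_⟩, hmem,
    fun P hP => ⟨(hbound P hP).2, fun e => e ▸ hcorr⟩,
    ⟨hmem.1, realizes_refStrategy _ _, ?_⟩, ?_⟩
  · rw [abs_lt]; constructor <;> linarith
  · rw [abs_lt]; constructor <;> nlinarith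
  · rw [abs_lt]; constructor <;> nlinarith
  · rintro _ ⟨P, hP, rfl⟩
    exact (hbound P hP).1
  · intro HA HB _ _ _ _ _ _ ψ M N hP
    exact (chsh_le_and_equiv_of_realizes h g1 g2 hcos0.ne' hκ hP hmem.2).2 hcorr
  · intro HA HB _ _ _ _ _ _ ψ M N P hP h0 hc
    exact (chsh_le_and_equiv_of_realizes h g1 g2 hcos0.ne' hκ hP h0).2 hc
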